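/- Let $M$ be a smooth $8$-manifold with a $Spin(7)$-structure, i.e. a smooth $4$-form $\Phi$ and a smooth Riemannian metric $g$ (determined by $\Phi$) such that at every point of $M$ there is a $g$-orthonormal basis $e_0,\dots,e_7$ of (co)vectors in which $$\Phi=-e_{0127}+e_{0236}-e_{0347}-e_{0567}+e_{0146}+e_{0245}-e_{0135}-e_{3456}-e_{1457}-e_{1256}-e_{1234}-e_{2357}-e_{1367}+e_{2467},$$ where $e_{ijkl}=e_i\wedge e_j\wedge e_k\wedge e_l$. Let $\nabla^g$ be the Levi-Civita connection and let $\delta\Phi$ be the codifferential, $(\delta\Phi)_{klm}=-\nabla^g_j\Phi_{jklm}$ (components in an orthonormal frame, repeated indices summed). The Lee form is $\theta_a=\frac1{42}(\delta\Phi)_{ijk}\Phi_{ijka}$, and the torsion $3$-form is $T=\delta\Phi+\frac76\,\theta\lrcorner\Phi$, with $(\theta\lrcorner\Phi)_{jkl}=\theta_s\Phi_{sjkl}$. The $Spin(7)$-torsion connection $\nabla$ is given by $g(\nabla_XY,Z)=g(\nabla^g_XY,Z)+\frac12T(X,Y,Z)$; it is the unique linear connection with totally skew-symmetric torsion satisfying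 $\nabla g=\nabla\Phi=0$, and its torsion is $T$. Let $Scal^g$ and $Scal$ be the scalar curvatures (the $g$-traces of the Ricci tensors) of $\nabla^g$ and $\nabla$. Suppose that the structure is balanced, i.e. $\theta=0$ on $M$. 1. If $Scal^g=0$ on $M$ or $Scal=0$ on $M$, then the structure is parallel: $\nabla^g\Phi=0$. 2. In particular, if the torsion $3$-form is closed, $dT=0$, then $\nabla^g\Phi=0$. -/

import Mathlib

open scoped Manifold ContDiff

noncomputable section

namespace Spin7

/-- The Euclidean space `ℝ⁸`, with coordinates indexed by `0, …, 7`. -/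
abbrev R8 : Type := EuclideanSpace ℝ (Fin 8)

/-- The decomposable 4-form `e_a ∧ e_b ∧ e_c ∧ e_d` on `ℝ⁸`
(its value on `v₀, …, v₃` is the determinant of the matrix `(v_r)_{a,b,c,d}`). -/
def wedge4 (a b c d : Fin 8) : R8 [⋀^Fin 4]→ₗ[ℝ] ℝ :=
  (Matrix.detRowAlternating (R := ℝ) (n := Fin 4)).compLinearMap
    (LinearMap.pi fun s => (EuclideanSpace.proj (𝕜 := ℝ) (![a, b, c, d] s)).toLinearMap)

/-- The model 4-form on `ℝ⁸` whose stabilizer in `GL(8, ℝ)` is `Spin(7)`. -/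
def modelForm : R8 [⋀^Fin 4]→ₗ[ℝ] ℝ :=
  - wedge4 0 1 2 7 + wedge4 0 2 3 6 - wedge4 0 3 4 7 - wedge4 0 5 6 7
  + wedge4 0 1 4 6 + wedge4 0 2 4 5 - wedge4 0 1 3 5
  - wedge4 3 4 5 6 - wedge4 1 4 5 7 - wedge4 1 2 5 6 - wedge4 1 2 3 4
  - wedge4 2 3 5 7 - wedge4 1 3 6 7 + wedge4 2 4 6 7

/-! ### Tensor calculus in coordinates on `ℝ⁸`

The components of a metric and of a 4-form in a coordinate system are functions
`g i j : ℝ⁸ → ℝ` and `φ i j k l : ℝ⁸ → ℝ`. -/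

/-- Components of a covariant 2-tensor field in coordinates. -/
abbrev Comp2 : Type := Fin 8 → Fin 8 → R8 → ℝ
/-- Components of a covariant 3-tensor field, or connection coefficients, in coordinates. -/
abbrev Comp3 : Type := Fin 8 → Fin 8 → Fin 8 → R8 → ℝ
/-- Components of a covariant 4-tensor field in coordinates. -/
abbrev Comp4 : Type := Fin 8 → Fin 8 → Fin 8 → Fin 8 → R8 → ℝ

/-- The partial derivative `∂_i f`. -/
def pd (i : Fin 8) (f : R8 → ℝ) (u : R8) : ℝ :=
  fderiv ℝ f u (EuclideanSpace.single i 1)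

/-- The inverse metric `g^{ij}`. -/
def invMetric (g : Comp2) : Comp2 := fun i j u =>
  (Matrix.of fun a b => g a b u)⁻¹ i j

/-- The Christoffel symbols `Γ^k_{ij}` of the Levi-Civita connection, written
`christoffel g k i j`, so that `∇^g_{∂_i} ∂_j = Γ^k_{ij} ∂_k`. -/
def christoffel (g : Comp2) : Comp3 := fun k i j u =>
  (1 / 2) * ∑ l, invMetric g k l u * (pd i (g j l) u + pd j (g i l) u - pd l (g i j) u)

/-- The components `(∇^g_p φ)_{ijkl}` of the Levi-Civita covariant derivative of a 4-form. -/
def nablaForm (g : Comp2) (φ : Comp4) (p i j k l : Fin 8) (u : R8) : ℝ :=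
  pd p (φ i j k l) u
    - ∑ s, (christoffel g s p i u * φ s j k l u + christoffel g s p j u * φ i s k l u
        + christoffel g s p k u * φ i j s l u + christoffel g s p l u * φ i j k s u)

/-- The codifferential of a 4-form: `(δφ)_{klm} = - g^{pq} (∇^g_p φ)_{qklm}`. -/
def codiff (g : Comp2) (φ : Comp4) : Comp3 := fun k l m u =>
  - ∑ p, ∑ q, invMetric g p q u * nablaForm g φ p q k l m u

/-- The Lee form `θ = (1/7) (δφ) ⌟ φ`, that is `θ_a = (1/42) (δφ)^{ijk} φ_{ijka}`. -/
def lee (g : Comp2) (φ : Comp4) (a : Fin 8) (u : R8) : ℝ :=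
  (1 / 42) * ∑ i, ∑ j, ∑ k, ∑ i', ∑ j', ∑ k',
    invMetric g i i' u * invMetric g j j' u * invMetric g k k' u
      * codiff g φ i j k u * φ i' j' k' a u

/-- The torsion 3-form `T = δφ + (7/6) θ ⌟ φ`. -/
def torsion (g : Comp2) (φ : Comp4) : Comp3 := fun i j k u =>
  codiff g φ i j k u + (7 / 6) * ∑ s, ∑ t, invMetric g s t u * lee g φ s u * φ t i j k u

/-- The exterior derivative of a 3-form. -/
def extDeriv3 (T : Comp3) : Comp4 := fun i j k l u =>
  pd i (T j k l) u - pd j (T i k l) u + pd k (T i j l) u - pd l (T i j k) u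

/-- The coefficients of the torsion connection `∇ = ∇^g + T/2`, that is
`∇_{∂_i} ∂_j = (Γ^k_{ij} + (1/2) g^{kl} T_{ijl}) ∂_k`. -/
def torsionConn (g : Comp2) (φ : Comp4) : Comp3 := fun k i j u =>
  christoffel g k i j u + (1 / 2) * ∑ l, invMetric g k l u * torsion g φ i j l u

/-- The curvature of the linear connection `∇_{∂_i} ∂_j = A^k_{ij} ∂_k`, with
`R(X, Y) = [∇_X, ∇_Y] - ∇_{[X, Y]}`:
`R(∂_i, ∂_j) ∂_k = (curvature A l i j k) ∂_l`, summed over `l`. -/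
def curvature (A : Comp3) : Comp4 := fun l i j k u =>
  pd i (A l j k) u - pd j (A l i k) u
    + ∑ m, (A m j k u * A l i m u - A m i k u * A l j m u)

/-- The Ricci tensor `Ric(∂_j, ∂_k)`, the trace of `X ↦ R(X, ∂_j) ∂_k`. -/
def ricci (A : Comp3) : Comp2 := fun j k u => ∑ i, curvature A i i j k u

/-- The scalar curvature of a linear connection with respect to a metric: `g^{jk} Ric_{jk}`. -/
def scal (g : Comp2) (A : Comp3) (u : R8) : ℝ :=
  ∑ j, ∑ k, invMetric g j k u * ricci A j k u

/-! ### `Spin(7)`-structures on manifolds -/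

section Manifold

variable {M : Type*} [TopologicalSpace M] [ChartedSpace R8 M]

/-- The coordinate vector `∂_i` of the chart `e`, at the point of `M` with coordinates `u`. -/
def coordVec (e : OpenPartialHomeomorph M R8) (i : Fin 8) (u : R8) :
    TangentSpace 𝓘(ℝ, R8) (e.symm u) :=
  mfderiv 𝓘(ℝ, R8) 𝓘(ℝ, R8) e.symm u (EuclideanSpace.single i 1 : R8)

/-- The components `Φ(∂_i, ∂_j, ∂_k, ∂_l)` of a 4-form in the chart `e`. -/
def formComp (Φ : ∀ x : M, (TangentSpace 𝓘(ℝ, R8) x) [⋀^Fin 4]→ₗ[ℝ] ℝ)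
    (e : OpenPartialHomeomorph M R8) : Comp4 := fun i j k l u =>
  Φ (e.symm u) ![coordVec e i u, coordVec e j u, coordVec e k u, coordVec e l u]

variable [IsManifold 𝓘(ℝ, R8) ∞ M]

variable (M) in
/-- A (smooth) `Spin(7)`-structure on a smooth 8-manifold: a smooth 4-form `Φ` and a smooth
Riemannian metric `g` such that every tangent space has a `g`-orthonormal frame in which `Φ` is
the model 4-form. (The metric is determined by `Φ`.) -/
structure Spin7Structure where
  /-- The Riemannian metric induced by the structure. -/
  metric : Bundle.ContMDiffRiemannianMetric 𝓘(ℝ, R8) ∞ R8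
    (fun x : M => TangentSpace 𝓘(ℝ, R8) x)
  /-- The fundamental 4-form. -/
  form : ∀ x : M, (TangentSpace 𝓘(ℝ, R8) x) [⋀^Fin 4]→ₗ[ℝ] ℝ
  form_smooth : ∀ e ∈ atlas R8 M, ∀ i j k l : Fin 8,
    ContDiffOn ℝ ∞ (formComp form e i j k l) e.target
  adapted : ∀ x : M, ∃ f : R8 ≃ₗ[ℝ] TangentSpace 𝓘(ℝ, R8) x,
    (∀ v w : R8, metric.inner x (f v) (f w) = inner ℝ v w) ∧
    ∀ v : Fin 4 → R8, form x (fun r => f (v r)) = modelForm v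

namespace Spin7Structure

variable (S : Spin7Structure M)

/-- The components `g(∂_i, ∂_j)` of the metric in the chart `e`. -/
def gComp (e : OpenPartialHomeomorph M R8) : Comp2 := fun i j u =>
  S.metric.inner (e.symm u) (coordVec e i u) (coordVec e j u)

/-- The components of the fundamental 4-form in the chart `e`. -/
def ΦComp (e : OpenPartialHomeomorph M R8) : Comp4 := formComp S.form e

/-- The Lee form vanishes identically, `θ = 0`. -/
def IsBalanced : Prop :=
  ∀ e ∈ atlas R8 M, ∀ u ∈ e.target, ∀ a : Fin 8, lee (S.gComp e) (S.ΦComp e) a u = 0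

/-- The fundamental form is parallel for the Levi-Civita connection, `∇^g Φ = 0`. -/
def IsParallel : Prop :=
  ∀ e ∈ atlas R8 M, ∀ u ∈ e.target, ∀ p i j k l : Fin 8,
    nablaForm (S.gComp e) (S.ΦComp e) p i j k l u = 0

/-- The Riemannian scalar curvature vanishes identically, `Scal^g = 0`. -/
def RiemannianScalarFlat : Prop :=
  ∀ e ∈ atlas R8 M, ∀ u ∈ e.target, scal (S.gComp e) (christoffel (S.gComp e)) u = 0

/-- The scalar curvature of the torsion connection vanishes identically, `Scal = 0`. -/
def TorsionScalarFlat : Prop :=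
  ∀ e ∈ atlas R8 M, ∀ u ∈ e.target,
    scal (S.gComp e) (torsionConn (S.gComp e) (S.ΦComp e)) u = 0

/-- The torsion 3-form is closed, `dT = 0`. -/
def HasClosedTorsion : Prop :=
  ∀ e ∈ atlas R8 M, ∀ u ∈ e.target, ∀ i j k l : Fin 8,
    extDeriv3 (torsion (S.gComp e) (S.ΦComp e)) i j k l u = 0

end Spin7Structure

end Manifold

end Spin7

end

/-! Everything happens in one chart, at one point, and is governed by a single nonnegative function:
`divSq`, the sum of `δΦ_I δΦ^I` over all index triples `I`. The three hypotheses each force `divSq =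
0`, and for a balanced structure this forces `∇^g Φ = 0`.

Why `δΦ` controls `∇^g Φ`: a metric connection moves `Φ` inside an orbit of `SO(8)`, so each `∇_a Φ`
lies in the tangent space of the orbit, which is `Λ⁴₇`. Here the orbit is detected by an equation:
the triple cross product defined by `Φ` has a Gram matrix that is a polynomial in the metric alone
(`contract₃_dotProduct`). Differentiating this along a frame that is parallel to first order gives a
linear equation for `∇_a Φ` (`LocalSpin7.crossTangent`), whose alternating solutions are exactly
`Λ⁴₇` (`CrossTangent.exists_eq_sum`). In an adapted frame this reads `∇_a Φ = ∑ c_{am} λ^m`, where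
`λ^m` is attached to the Clifford matrix `J_m`, and `θ = 0` becomes `∑ c_{am} (J_m)_{ap} = 0`. The
Clifford relations then give `divSq = 12 |c|²`, while the crossed contraction `∇_p Φ^{aI} ∇_a Φ^p_I`
equals `36 |c|²`.

Why scalar curvature controls `divSq`: when `θ = 0`, two contractions of `Φ` with `∇^g Φ` vanish
identically. Subtracting their divergences turns the second derivatives of `Φ` into curvature
(`weitzenboeck`), and this curvature term is `24 Scal^g` (`sum_curvature_contraction`). Hence `divSq
- 3 divSq = 24 Scal^g`, that is `12 Scal^g = -divSq`. As `T = δΦ`, also `Scal = Scal^g - divSq / 4 =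
-divSq / 3`. So the vanishing of either scalar curvature gives `divSq = 0`.

Closed torsion needs no curvature: `θ = 0` says `Φ^{aI} T_I = 0`. The divergence of this identity is
`-divSq` plus a contraction of `Φ` with `dT`, so `dT = 0` gives `divSq = 0`. -/

noncomputable section

namespace Spin7

open scoped Matrix

/-! ### Alternating arrays with four indices -/

/-- An array with four indices changes sign under transposition of neighbouring indices. -/
structure Alt4 (D : Fin 8 → Fin 8 → Fin 8 → Fin 8 → ℝ) : Prop where
  swap₁ : ∀ i j k l, D i j k l = -D j i k l
  swap₂ : ∀ i j k l, D i j k l = -D i k j l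
  swap₃ : ∀ i j k l, D i j k l = -D i j l k

namespace Alt4

variable {D : Fin 8 → Fin 8 → Fin 8 → Fin 8 → ℝ}

theorem eq_zero₁ (h : Alt4 D) (i k l : Fin 8) : D i i k l = 0 := by linarith [h.swap₁ i i k l]
theorem eq_zero₂ (h : Alt4 D) (i j l : Fin 8) : D i j j l = 0 := by linarith [h.swap₂ i j j l]
theorem eq_zero₃ (h : Alt4 D) (i j k : Fin 8) : D i j k k = 0 := by linarith [h.swap₃ i j k k]

theorem swap₁₃ (h : Alt4 D) (i j k l : Fin 8) : D i j k l = -D k j i l := by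
  rw [h.swap₁, h.swap₂, h.swap₁ j k i l]; ring

theorem swap₂₄ (h : Alt4 D) (i j k l : Fin 8) : D i j k l = -D i l k j := by
  rw [h.swap₂, h.swap₃, h.swap₂ i k l j]; ring

theorem swap₁₄ (h : Alt4 D) (i j k l : Fin 8) : D i j k l = -D l j k i := by
  rw [h.swap₃, h.swap₁₃, h.swap₃ l j i k]; ring

/-- An alternating array vanishes if it does so on strictly increasing indices. -/
theorem eq_zero_of_lt (h : Alt4 D)
    (hD : ∀ i j k l, i < j → j < k → k < l → D i j k l = 0) (i j k l : Fin 8) :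
    D i j k l = 0 := by
  have h3 : ∀ i j k l, i < j → j < k → D i j k l = 0 := by
    intro i j k l hij hjk
    rcases lt_trichotomy k l with hkl | rfl | hkl
    · exact hD i j k l hij hjk hkl
    · exact h.eq_zero₃ i j k
    rw [h.swap₃]
    rcases lt_trichotomy j l with hjl | rfl | hjl
    · simp [hD i j l k hij hjl hkl]
    · simp [h.eq_zero₂]
    rw [h.swap₂]
    rcases lt_trichotomy i l with hil | rfl | hil
    · simp [hD i l j k hil hjl hjk]
    · simp [h.eq_zero₁]
    rw [h.swap₁]
    simp [hD l i j k hil hij hjk]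
  have h2 : ∀ i j k l, i < j → D i j k l = 0 := by
    intro i j k l hij
    rcases lt_trichotomy j k with hjk | rfl | hjk
    · exact h3 i j k l hij hjk
    · exact h.eq_zero₂ i j l
    rw [h.swap₂]
    rcases lt_trichotomy i k with hik | rfl | hik
    · simp [h3 i k j l hik hjk]
    · simp [h.eq_zero₁]
    rw [h.swap₁]
    simp [h3 k i j l hik hij]
  rcases lt_trichotomy i j with hij | rfl | hij
  · exact h2 i j k l hij
  · exact h.eq_zero₁ i k l
  · rw [h.swap₁, h2 j i k l hij, neg_zero]

theorem sub {D' : Fin 8 → Fin 8 → Fin 8 → Fin 8 → ℝ} (h : Alt4 D) (h' : Alt4 D') :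
    Alt4 fun i j k l => D i j k l - D' i j k l where
  swap₁ i j k l := by rw [h.swap₁, h'.swap₁]; ring
  swap₂ i j k l := by rw [h.swap₂, h'.swap₂]; ring
  swap₃ i j k l := by rw [h.swap₃, h'.swap₃]; ring

end Alt4

/-! ### The combinatorics of the model form

The indices `0, …, 7` are labelled by the elements of `𝔽₂³` in such a way that the monomials of
the model form are the affine planes. -/

/-- The label in `𝔽₂³` (a number below 8, added bitwise) of an index. -/
def label (i : ℕ) : ℕ := (0x36574210 >>> (4 * i)) % 8

/-- The index with a given label. -/
def unlabel (v : ℕ) : ℕ := (0x46537210 >>> (4 * v)) % 8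

/-- The signs of the octonionic multiplication table, as exponents of `-1`. -/
def octSign (i j : ℕ) : ℕ := (0x55278d69c31bb100 >>> (8 * i + j)) % 2

/-- The sign `(-1)ⁿ`. -/
def signOf (n : ℕ) : ℤ := bif (n % 2).beq 0 then 1 else -1

/-- The index whose label is the sum of the labels of `i` and `m + 1`. -/
def mate (m : Fin 7) (i : Fin 8) : Fin 8 := Fin.ofNat 8 (unlabel (label i ^^^ label (m + 1)))

/-- The fourth point of the affine plane through three points. -/
def fourth (i j k : Fin 8) : Fin 8 := Fin.ofNat 8 (unlabel (label i ^^^ label j ^^^ label k))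

/-- The nonzero entry in row `i` of the `m`-th Clifford matrix. -/
def cliffordSign (m : Fin 7) (i : Fin 8) : ℤ := signOf (octSign i (mate m i))

/-- The sign of the monomial of the model form through three points (`0` if two coincide). -/
def cayleySign (i j k : Fin 8) : ℤ :=
  bif i.val.beq j || i.val.beq k || j.val.beq k then 0
  else signOf (1 + octSign i j + octSign k (fourth i j k))

/-- The signs of the components of the basis of `Λ⁴₇`. -/
def lambdaSign (m : Fin 7) (i j k : Fin 8) : ℤ :=
  bif i.val.beq j || i.val.beq k || i.val.beq (fourth (mate m i) j k) then 0
  else cliffordSign m i * cayleySign (mate m i) j k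

/-- The entries of seven anticommuting complex structures on `ℝ⁸`, a basis of `Λ²₇`. -/
def clifford (m : Fin 7) (i j : Fin 8) : ℤ := if j = mate m i then cliffordSign m i else 0

/-- The components of the model form. -/
def cayley (i j k l : Fin 8) : ℤ := if l = fourth i j k then cayleySign i j k else 0

/-- The components of a basis of `Λ⁴₇`. -/
def lambda (m : Fin 7) (i j k l : Fin 8) : ℤ :=
  if l = fourth (mate m i) j k then lambdaSign m i j k else 0

theorem cayley_swap₁ : ∀ i j k l, cayley i j k l = -cayley j i k l := by decide +kernel
theorem cayley_swap₂ : ∀ i j k l, cayley i j k l = -cayley i k j l := by decide +kernel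
theorem cayley_swap₃ : ∀ i j k l, cayley i j k l = -cayley i j l k := by decide +kernel
theorem lambda_swap₁ : ∀ m i j k l, lambda m i j k l = -lambda m j i k l := by decide +kernel
theorem lambda_swap₂ : ∀ m i j k l, lambda m i j k l = -lambda m i k j l := by decide +kernel
theorem lambda_swap₃ : ∀ m i j k l, lambda m i j k l = -lambda m i j l k := by decide +kernel

theorem fourth_inj : ∀ p q x y, fourth p x y = fourth q x y ↔ p = q := by decide +kernel
theorem clifford_antisymm : ∀ m i j, clifford m i j = -clifford m j i := by decide +kernel

/-- The Clifford relations. They drive both the norm identity for the cross product and the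
evaluation of the quadratic invariants of `∇^g Φ`. -/
theorem clifford_anticomm : ∀ m n i j, ∑ k, (clifford m i k * clifford n k j +
    clifford n i k * clifford m k j) = -2 * ((if m = n then 1 else 0) * if i = j then 1 else 0) := by
  simp only [Fin.sum_univ_eight]
  decide +kernel

/-- Acting on 2-forms, the model form has eigenvalue `-3` on `Λ²₇` and `1` on its complement `Λ²₂₁`,
so the identity minus this operator is four times the projection onto `Λ²₇`, the span of the `J_m`.
-/
theorem sum_clifford_mul : ∀ i j k l, ∑ m, clifford m i j * clifford m k l =
    (if i = k then 1 else 0) * (if j = l then 1 else 0) -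
      (if i = l then 1 else 0) * (if j = k then 1 else 0) - cayley i j k l := by
  simp only [Fin.sum_univ_seven]
  decide +kernel

/-- The quadratic equation `t² + 2t - 3 = 0` of the operator defined by the model form on 2-forms.
Since `cayley i j x` has at most one nonzero entry, the inner sum is eliminated before the finite
check. -/
theorem sum_cayley_mul (i j k l : Fin 8) : ∑ x, ∑ y, cayley i j x y * cayley k l x y =
    6 * ((if i = k then 1 else 0) * (if j = l then 1 else 0) -
      (if i = l then 1 else 0) * (if j = k then 1 else 0)) - 4 * cayley i j k l := by
  have h : ∀ i j k l : Fin 8,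
      ∑ x, (if fourth i j x = fourth k l x then cayleySign i j x * cayleySign k l x else 0) =
      6 * ((if i = k then 1 else 0) * (if j = l then 1 else 0) -
      (if i = l then 1 else 0) * (if j = k then 1 else 0)) - 4 * cayley i j k l := by
    simp only [Fin.sum_univ_eight]
    decide +kernel
  rw [← h]
  refine Finset.sum_congr rfl fun x _ => ?_
  simp [cayley, eq_comm]

/-- The array `lambda m` is the model form with `J_m` applied in the first slot, with the entries
having a repeated index removed. All entries together would contribute `42 J_m`, and the removed
ones account for `18 J_m`. -/
theorem sum_lambda_mul_cayley (m : Fin 7) (i j : Fin 8) :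
    ∑ x, ∑ y, ∑ z, lambda m i x y z * cayley j x y z = 24 * clifford m i j := by
  have h : ∀ (m : Fin 7) (i : Fin 8),
      ∑ x, ∑ y, lambdaSign m i x y * cayleySign (mate m i) x y = 24 * cliffordSign m i := by
    simp only [Fin.sum_univ_eight]
    decide +kernel
  have h' : ∀ x y, ∑ z, lambda m i x y z * cayley j x y z =
      if j = mate m i then lambdaSign m i x y * cayleySign (mate m i) x y else 0 := by
    intro x y
    by_cases hj : j = mate m i
    · subst hj; simp [lambda, cayley]
    · simp [lambda, cayley, fourth_inj, hj]
  simp only [h', clifford]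
  by_cases hj : j = mate m i <;> simp [hj, h]

/-- The supports of the two rows meet only if the labels of the mates agree, which leaves one sum
over two indices for the finite check. The commutator term is what later separates the two quadratic
invariants of `∇^g Φ`. -/
theorem sum_lambda_mul_lambda (m n : Fin 7) (i j : Fin 8) :
    ∑ x, ∑ y, ∑ z, lambda m i x y z * lambda n j x y z =
      24 * ((if m = n then 1 else 0) * if i = j then 1 else 0) -
        6 * ∑ k, (clifford m i k * clifford n k j - clifford n i k * clifford m k j) := by
  have h : ∀ (m n : Fin 7) (i j : Fin 8), (if mate m i = mate n j then
      ∑ x, ∑ y, lambdaSign m i x y * lambdaSign n j x y else 0) =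
      24 * ((if m = n then 1 else 0) * if i = j then 1 else 0) -
        6 * ∑ k, (clifford m i k * clifford n k j - clifford n i k * clifford m k j) := by
    simp only [Fin.sum_univ_eight]
    decide +kernel
  rw [← h]
  have h' : ∀ x y, ∑ z, lambda m i x y z * lambda n j x y z =
      if mate m i = mate n j then lambdaSign m i x y * lambdaSign n j x y else 0 := by
    intro x y
    by_cases hj : mate m i = mate n j
    · simp [lambda, hj]
    · simp [lambda, fourth_inj, hj, Ne.symm hj]
  simp only [h']
  split_ifs <;> simp

/-! ### The components of the model form -/

/-- The value of `e_a ∧ e_b` on two basis vectors. -/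
def wedgeCoeff₂ (a b i j : Fin 8) : ℤ :=
  (if a = i then 1 else 0) * (if b = j then 1 else 0) -
    (if b = i then 1 else 0) * (if a = j then 1 else 0)

/-- The value of `e_a ∧ e_b ∧ e_c` on three basis vectors. -/
def wedgeCoeff₃ (a b c i j k : Fin 8) : ℤ :=
  (if a = i then 1 else 0) * wedgeCoeff₂ b c j k - (if b = i then 1 else 0) * wedgeCoeff₂ a c j k
    + (if c = i then 1 else 0) * wedgeCoeff₂ a b j k

/-- The value of `e_a ∧ e_b ∧ e_c ∧ e_d` on four basis vectors. -/
def wedgeCoeff (a b c d i j k l : Fin 8) : ℤ :=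
  (if a = i then 1 else 0) * wedgeCoeff₃ b c d j k l
    - (if b = i then 1 else 0) * wedgeCoeff₃ a c d j k l
    + (if c = i then 1 else 0) * wedgeCoeff₃ a b d j k l
    - (if d = i then 1 else 0) * wedgeCoeff₃ a b c j k l

theorem wedge4_apply (a b c d : Fin 8) (v : Fin 4 → R8) :
    wedge4 a b c d v = Matrix.det (Matrix.of fun r s => v r (![a, b, c, d] s)) := rfl

theorem wedge4_single (a b c d i j k l : Fin 8) :
    wedge4 a b c d ![EuclideanSpace.single i 1, EuclideanSpace.single j 1,
      EuclideanSpace.single k 1, EuclideanSpace.single l 1] = wedgeCoeff a b c d i j k l := by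
  rw [wedge4_apply, Matrix.det_succ_row_zero]
  simp only [Fin.sum_univ_succ, Matrix.det_fin_three]
  simp [Fin.succAbove, wedgeCoeff, wedgeCoeff₃, wedgeCoeff₂, -mul_ite, -ite_mul]
  ring

theorem cayley_eq_sum_wedgeCoeff : ∀ i j k l, i < j → j < k → k < l →
    cayley i j k l = -wedgeCoeff 0 1 2 7 i j k l + wedgeCoeff 0 2 3 6 i j k l
      - wedgeCoeff 0 3 4 7 i j k l - wedgeCoeff 0 5 6 7 i j k l + wedgeCoeff 0 1 4 6 i j k l
      + wedgeCoeff 0 2 4 5 i j k l - wedgeCoeff 0 1 3 5 i j k l - wedgeCoeff 3 4 5 6 i j k l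
      - wedgeCoeff 1 4 5 7 i j k l - wedgeCoeff 1 2 5 6 i j k l - wedgeCoeff 1 2 3 4 i j k l
      - wedgeCoeff 2 3 5 7 i j k l - wedgeCoeff 1 3 6 7 i j k l + wedgeCoeff 2 4 6 7 i j k l := by
  decide +kernel

theorem alt4_cayley : Alt4 fun i j k l => (cayley i j k l : ℝ) where
  swap₁ i j k l := by rw [cayley_swap₁]; push_cast; rfl
  swap₂ i j k l := by rw [cayley_swap₂]; push_cast; rfl
  swap₃ i j k l := by rw [cayley_swap₃]; push_cast; rfl

theorem alt4_lambda (m : Fin 7) : Alt4 fun i j k l => (lambda m i j k l : ℝ) where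
  swap₁ i j k l := by rw [lambda_swap₁]; push_cast; rfl
  swap₂ i j k l := by rw [lambda_swap₂]; push_cast; rfl
  swap₃ i j k l := by rw [lambda_swap₃]; push_cast; rfl

/-- The values of an alternating 4-form on four vectors taken from a family form an alternating
array. -/
theorem alt4_of_alternatingMap {V : Type*} [AddCommGroup V] [Module ℝ V] (f : V [⋀^Fin 4]→ₗ[ℝ] ℝ)
    (v : Fin 8 → V) : Alt4 fun i j k l => f ![v i, v j, v k, v l] where
  swap₁ i j k l := by
    rw [← f.map_swap _ (show (0 : Fin 4) ≠ 1 by decide)]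
    congr 1; ext r; fin_cases r <;> rfl
  swap₂ i j k l := by
    rw [← f.map_swap _ (show (1 : Fin 4) ≠ 2 by decide)]
    congr 1; ext r; fin_cases r <;> rfl
  swap₃ i j k l := by
    rw [← f.map_swap _ (show (2 : Fin 4) ≠ 3 by decide)]
    congr 1; ext r; fin_cases r <;> rfl

theorem modelForm_single (i j k l : Fin 8) :
    modelForm ![EuclideanSpace.single i 1, EuclideanSpace.single j 1,
      EuclideanSpace.single k 1, EuclideanSpace.single l 1] = cayley i j k l := by
  -- Both sides alternate, so only strictly increasing indices have to be compared.
  refine sub_eq_zero.1 (((alt4_of_alternatingMap modelForm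
    fun i => EuclideanSpace.single i 1).sub alt4_cayley).eq_zero_of_lt ?_ i j k l)
  intro i j k l hij hjk hkl
  rw [cayley_eq_sum_wedgeCoeff i j k l hij hjk hkl]
  simp only [modelForm, AlternatingMap.add_apply, AlternatingMap.sub_apply,
    AlternatingMap.neg_apply, wedge4_single]
  push_cast
  ring

/-- Expansion of an alternating 4-form in a family of vectors. -/
theorem alternatingMap_sum {V : Type*} [AddCommGroup V] [Module ℝ V] (f : V [⋀^Fin 4]→ₗ[ℝ] ℝ)
    (e : Fin 8 → V) (x y z w : Fin 8 → ℝ) :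
    f ![∑ i, x i • e i, ∑ i, y i • e i, ∑ i, z i • e i, ∑ i, w i • e i] =
      ∑ i, ∑ j, ∑ k, ∑ l, x i * y j * z k * w l * f ![e i, e j, e k, e l] := by
  have h0 : ∀ (y z w : V) (c : Fin 8 → ℝ),
      f ![∑ i, c i • e i, y, z, w] = ∑ i, c i * f ![e i, y, z, w] := by
    intro y z w c
    have hu : ∀ u, Function.update ![0, y, z, w] 0 u = ![u, y, z, w] := by
      intro u; ext s; fin_cases s <;> rfl
    have := map_sum (f.toMultilinearMap.toLinearMap ![0, y, z, w] 0) (fun i => c i • e i) Finset.univ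
    simp only [map_smul, MultilinearMap.toLinearMap_apply, hu, smul_eq_mul,
      AlternatingMap.coe_multilinearMap] at this
    exact this
  have h1 : ∀ (x z w : V) (c : Fin 8 → ℝ),
      f ![x, ∑ i, c i • e i, z, w] = ∑ i, c i * f ![x, e i, z, w] := by
    intro x z w c
    have hu : ∀ u, Function.update ![x, 0, z, w] 1 u = ![x, u, z, w] := by
      intro u; ext s; fin_cases s <;> rfl
    have := map_sum (f.toMultilinearMap.toLinearMap ![x, 0, z, w] 1) (fun i => c i • e i) Finset.univ
    simp only [map_smul, MultilinearMap.toLinearMap_apply, hu, smul_eq_mul,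
      AlternatingMap.coe_multilinearMap] at this
    exact this
  have h2 : ∀ (x y w : V) (c : Fin 8 → ℝ),
      f ![x, y, ∑ i, c i • e i, w] = ∑ i, c i * f ![x, y, e i, w] := by
    intro x y w c
    have hu : ∀ u, Function.update ![x, y, 0, w] 2 u = ![x, y, u, w] := by
      intro u; ext s; fin_cases s <;> rfl
    have := map_sum (f.toMultilinearMap.toLinearMap ![x, y, 0, w] 2) (fun i => c i • e i) Finset.univ
    simp only [map_smul, MultilinearMap.toLinearMap_apply, hu, smul_eq_mul,
      AlternatingMap.coe_multilinearMap] at this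
    exact this
  have h3 : ∀ (x y z : V) (c : Fin 8 → ℝ),
      f ![x, y, z, ∑ i, c i • e i] = ∑ i, c i * f ![x, y, z, e i] := by
    intro x y z c
    have hu : ∀ u, Function.update ![x, y, z, 0] 3 u = ![x, y, z, u] := by
      intro u; ext s; fin_cases s <;> rfl
    have := map_sum (f.toMultilinearMap.toLinearMap ![x, y, z, 0] 3) (fun i => c i • e i) Finset.univ
    simp only [map_smul, MultilinearMap.toLinearMap_apply, hu, smul_eq_mul,
      AlternatingMap.coe_multilinearMap] at this
    exact this
  simp only [h0, h1, h2, h3, Finset.mul_sum]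
  refine Finset.sum_congr rfl fun i _ => Finset.sum_congr rfl fun j _ =>
    Finset.sum_congr rfl fun k _ => Finset.sum_congr rfl fun l _ => ?_
  ring

theorem sum_smul_single (v : R8) : ∑ i, v i • EuclideanSpace.single i (1 : ℝ) = v := by
  ext j; simp [Finset.sum_apply, Pi.single_apply]

/-- The components of the model form on four arbitrary vectors. -/
theorem modelForm_apply (x y z w : R8) : modelForm ![x, y, z, w] =
    ∑ i, ∑ j, ∑ k, ∑ l, x i * y j * z k * w l * (cayley i j k l : ℝ) := by
  have h := alternatingMap_sum modelForm (fun i => EuclideanSpace.single i 1) x y z w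
  simpa only [sum_smul_single, modelForm_single] using h

/-! ### Local description of a `Spin(7)`-structure -/

/-- The components `g`, `φ` of a metric and a 4-form on an open set `U` of `ℝ⁸` define a smooth
`Spin(7)`-structure: at every point there is a coframe in which they are the model ones. -/
structure LocalSpin7 (U : Set R8) (g : Comp2) (φ : Comp4) : Prop where
  isOpen : IsOpen U
  metric_smooth : ∀ i j, ContDiffOn ℝ ∞ (g i j) U
  form_smooth : ∀ i j k l, ContDiffOn ℝ ∞ (φ i j k l) U
  frame : ∀ u ∈ U, ∃ P : Matrix (Fin 8) (Fin 8) ℝ, IsUnit P.det ∧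
    (∀ i j, g i j u = ∑ a, P i a * P j a) ∧
    ∀ i j k l, φ i j k l u =
      ∑ a, ∑ b, ∑ c, ∑ d, P i a * P j b * P k c * P l d * (cayley a b c d : ℝ)

section Manifold

variable {M : Type*} [TopologicalSpace M] [ChartedSpace R8 M] [IsManifold 𝓘(ℝ, R8) ∞ M]

/-- The coordinate field is the tangent map of the inverse chart applied to a constant section,
which gives its smoothness as a section of the tangent bundle. -/
theorem contMDiffOn_coordVec {e : OpenPartialHomeomorph M R8} (he : e ∈ atlas R8 M) (i : Fin 8) :
    ContMDiffOn 𝓘(ℝ, R8) 𝓘(ℝ, R8).tangent ∞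
      (fun u => (⟨e.symm u, coordVec e i u⟩ : TangentBundle 𝓘(ℝ, R8) M)) e.target := by
  have h1 : ContMDiffOn 𝓘(ℝ, R8) 𝓘(ℝ, R8) ∞ e.symm e.target :=
    contMDiffOn_symm_of_mem_maximalAtlas (IsManifold.subset_maximalAtlas he)
  have h2 := h1.contMDiffOn_tangentMapWithin (m := ∞) le_rfl e.open_target.uniqueMDiffOn
  have h3 : ContMDiffOn 𝓘(ℝ, R8) 𝓘(ℝ, R8).tangent ∞
      (fun u : R8 => (⟨u, (EuclideanSpace.single i 1 : R8)⟩ : TangentBundle 𝓘(ℝ, R8) R8))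
      e.target :=
    contMDiffOn_vectorSpace_iff_contDiffOn.2 contDiffOn_const
  refine (h2.comp h3 fun u hu => hu).congr fun u hu => ?_
  simp only [Function.comp, tangentMapWithin, coordVec]
  rw [mfderivWithin_of_isOpen e.open_target hu]

theorem mfderiv_symm_injective {e : OpenPartialHomeomorph M R8} (he : e ∈ atlas R8 M) {u : R8}
    (hu : u ∈ e.target) : Function.Injective
      (mfderiv 𝓘(ℝ, R8) 𝓘(ℝ, R8) e.symm u : R8 → TangentSpace 𝓘(ℝ, R8) (e.symm u)) := by
  have h := mdifferentiable_of_mem_atlas (I := 𝓘(ℝ, R8)) he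
  exact (h.symm.mfderiv (x := u) hu).injective

/-- The rows of the frame matrix are the coordinate vectors written in the adapted frame. It is
invertible because the differential of the inverse chart is injective. -/
theorem Spin7Structure.localSpin7 (S : Spin7Structure M) {e : OpenPartialHomeomorph M R8}
    (he : e ∈ atlas R8 M) : LocalSpin7 e.target (S.gComp e) (S.ΦComp e) where
  isOpen := e.open_target
  metric_smooth i j := by
    rw [← contMDiffOn_iff_contDiffOn]
    have h1 : ContMDiffOn 𝓘(ℝ, R8) 𝓘(ℝ, R8) ∞ e.symm e.target :=
      contMDiffOn_symm_of_mem_maximalAtlas (IsManifold.subset_maximalAtlas he)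
    intro u hu
    have h : ContMDiffWithinAt 𝓘(ℝ, R8) (𝓘(ℝ, R8).prod 𝓘(ℝ, ℝ)) ∞
        (fun u => Bundle.TotalSpace.mk' ℝ (E := Bundle.Trivial M ℝ) (e.symm u)
          (S.metric.inner (e.symm u) (coordVec e i u) (coordVec e j u))) e.target u := by
      apply ContMDiffWithinAt.clm_bundle_apply₂ (F₁ := R8) (F₂ := R8)
      · exact ContMDiffAt.comp_contMDiffWithinAt u S.metric.contMDiff.contMDiffAt (h1 u hu)
      · exact contMDiffOn_coordVec he i u hu
      · exact contMDiffOn_coordVec he j u hu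
    rw [Bundle.contMDiffWithinAt_totalSpace] at h
    exact h.2
  form_smooth := S.form_smooth e he
  frame u hu := by
    obtain ⟨f, hf, hΦ⟩ := S.adapted (e.symm u)
    set v : Fin 8 → R8 := fun i => f.symm (coordVec e i u) with hv
    have hfv : ∀ i, f (v i) = coordVec e i u := fun i => f.apply_symm_apply _
    refine ⟨Matrix.of fun i a => v i a, ?_, fun i j => ?_, fun i j k l => ?_⟩
    · rw [← Matrix.isUnit_iff_isUnit_det, ← Matrix.vecMul_injective_iff_isUnit]
      have hD : ∀ x : Fin 8 → ℝ, ∀ a, Matrix.vecMul x (Matrix.of fun i a => v i a) a =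
          f.symm (mfderiv 𝓘(ℝ, R8) 𝓘(ℝ, R8) e.symm u (WithLp.toLp 2 x : R8)) a := by
        intro x a
        have hx : mfderiv 𝓘(ℝ, R8) 𝓘(ℝ, R8) e.symm u (WithLp.toLp 2 x : R8) =
            ∑ i, x i • coordVec e i u := by
          conv_lhs => rw [← sum_smul_single (WithLp.toLp 2 x)]
          exact (map_sum (mfderiv 𝓘(ℝ, R8) 𝓘(ℝ, R8) e.symm u) _ _).trans
            (Finset.sum_congr rfl fun i _ => map_smul _ _ _)
        rw [hx, map_sum]
        simp [Matrix.vecMul, dotProduct, hv]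
      intro x y hxy
      have h1 : f.symm (mfderiv 𝓘(ℝ, R8) 𝓘(ℝ, R8) e.symm u (WithLp.toLp 2 x : R8)) =
          f.symm (mfderiv 𝓘(ℝ, R8) 𝓘(ℝ, R8) e.symm u (WithLp.toLp 2 y : R8)) := by
        ext a
        rw [← hD, ← hD]
        exact congrFun hxy a
      exact WithLp.toLp_injective 2 (mfderiv_symm_injective he hu (f.symm.injective h1))
    · simp only [Spin7Structure.gComp, ← hfv, hf]
      simp [PiLp.inner_apply, mul_comm]
    · have := hΦ ![v i, v j, v k, v l]
      rw [modelForm_apply] at this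
      simp only [Matrix.of_apply]
      rw [← this]
      simp only [Spin7Structure.ΦComp, formComp, ← hfv]
      congr 1
      ext r; fin_cases r <;> rfl
end Manifold

/-! ### The triple cross product identity -/

/-- Contraction of the first three slots of an array with three vectors. -/
def contract₃ (T : Fin 8 → Fin 8 → Fin 8 → Fin 8 → ℝ) (x y z : Fin 8 → ℝ) (l : Fin 8) : ℝ :=
  ∑ i, ∑ j, ∑ k, x i * y j * z k * T i j k l

/-- Contraction of an array with four vectors. -/
def contract₄ (T : Fin 8 → Fin 8 → Fin 8 → Fin 8 → ℝ) (x y z w : Fin 8 → ℝ) : ℝ :=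
  ∑ i, ∑ j, ∑ k, ∑ l, x i * y j * z k * w l * T i j k l

theorem contract₄_eq (T : Fin 8 → Fin 8 → Fin 8 → Fin 8 → ℝ) (x y z w : Fin 8 → ℝ) :
    contract₄ T x y z w = ∑ l, w l * contract₃ T x y z l := by
  simp only [contract₄, contract₃, Finset.mul_sum]
  conv_rhs => rw [Finset.sum_comm]
  refine Finset.sum_congr rfl fun i _ => ?_
  conv_rhs => rw [Finset.sum_comm]
  refine Finset.sum_congr rfl fun j _ => ?_
  conv_rhs => rw [Finset.sum_comm]
  refine Finset.sum_congr rfl fun k _ => Finset.sum_congr rfl fun l _ => ?_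
  ring

/-- The bilinear form of the `m`-th Clifford matrix. -/
def cliffordForm (m : Fin 7) (x y : Fin 8 → ℝ) : ℝ := ∑ i, ∑ j, x i * clifford m i j * y j

theorem cayley_eq (i j k l : Fin 8) : (cayley i j k l : ℝ) =
    (if i = k then 1 else 0) * (if j = l then 1 else 0) -
      (if i = l then 1 else 0) * (if j = k then 1 else 0) -
      ∑ m, (clifford m i j : ℝ) * clifford m k l := by
  have := congrArg (Int.cast : ℤ → ℝ) (sum_clifford_mul i j k l)
  push_cast at this
  rw [this]; ring

/-- The triple cross product splits into a part in the plane of `x` and `y` and a Clifford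
multiplication of `z` by the vector with entries `cliffordForm m x y`. -/
theorem contract₃_cayley (x y z : Fin 8 → ℝ) (l : Fin 8) :
    contract₃ (fun i j k l => cayley i j k l) x y z l =
      (x ⬝ᵥ z) * y l - (y ⬝ᵥ z) * x l -
        ∑ m, cliffordForm m x y * ∑ k, z k * clifford m k l := by
  simp only [contract₃, cayley_eq, mul_sub, Finset.sum_sub_distrib]
  congr 1
  · congr 1
    · simp [dotProduct, Finset.sum_mul]
      refine Finset.sum_congr rfl fun i _ => ?_
      ring
    · simp [dotProduct, Finset.sum_mul]
      refine Finset.sum_congr rfl fun i _ => ?_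
      ring
  · simp only [cliffordForm, Finset.sum_mul]
    simp only [Finset.mul_sum]
    conv_rhs => rw [Finset.sum_comm]
    refine Finset.sum_congr rfl fun i _ => ?_
    conv_rhs => rw [Finset.sum_comm]
    refine Finset.sum_congr rfl fun j _ => ?_
    conv_rhs => rw [Finset.sum_comm]
    refine Finset.sum_congr rfl fun k _ => Finset.sum_congr rfl fun l _ => ?_
    ring

theorem contract₄_swap₂₄ {T : Fin 8 → Fin 8 → Fin 8 → Fin 8 → ℝ} (hT : Alt4 T)
    (x y z w : Fin 8 → ℝ) : contract₄ T x y z w = -contract₄ T x w z y := by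
  simp only [contract₄, ← Finset.sum_neg_distrib]
  refine Finset.sum_congr rfl fun i _ => ?_
  have : ∀ f : Fin 8 → Fin 8 → Fin 8 → ℝ,
      ∑ j, ∑ k, ∑ l, f j k l = ∑ l, ∑ k, ∑ j, f j k l := by
    intro f
    rw [Finset.sum_comm]
    conv_rhs => rw [Finset.sum_comm]
    exact Finset.sum_congr rfl fun k _ => Finset.sum_comm
  rw [this]
  refine Finset.sum_congr rfl fun j _ => Finset.sum_congr rfl fun k _ =>
    Finset.sum_congr rfl fun l _ => ?_
  rw [hT.swap₂₄]; ring

theorem contract₄_swap₁ {T : Fin 8 → Fin 8 → Fin 8 → Fin 8 → ℝ} (hT : Alt4 T)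
    (x y z w : Fin 8 → ℝ) : contract₄ T x y z w = -contract₄ T y x z w := by
  simp only [contract₄, ← Finset.sum_neg_distrib]
  rw [Finset.sum_comm]
  refine Finset.sum_congr rfl fun j _ => Finset.sum_congr rfl fun k _ =>
    Finset.sum_congr rfl fun l _ => Finset.sum_congr rfl fun l _ => ?_
  rw [hT.swap₁]; ring

theorem sum_cliffordForm_mul (x y z w : Fin 8 → ℝ) :
    ∑ m, cliffordForm m x y * cliffordForm m z w = (x ⬝ᵥ z) * (y ⬝ᵥ w) -
      (y ⬝ᵥ z) * (x ⬝ᵥ w) - contract₄ (fun i j k l => cayley i j k l) x y z w := by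
  rw [contract₄_eq]
  simp only [contract₃_cayley, mul_sub, Finset.sum_sub_distrib]
  have h1 : ∀ v : Fin 8 → ℝ, ∀ a : ℝ, ∑ l, w l * (a * v l) = a * (v ⬝ᵥ w) := by
    intro v a
    simp only [dotProduct, Finset.mul_sum]
    exact Finset.sum_congr rfl fun l _ => by ring
  rw [h1, h1, sub_sub_cancel]
  simp only [Finset.mul_sum]
  rw [Finset.sum_comm]
  refine Finset.sum_congr rfl fun m _ => ?_
  have : cliffordForm m z w = ∑ l, ∑ k, w l * (z k * clifford m k l) := by
    rw [cliffordForm, Finset.sum_comm]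
    exact Finset.sum_congr rfl fun l _ => Finset.sum_congr rfl fun k _ => by ring
  rw [this]
  simp only [Finset.mul_sum]
  exact Finset.sum_congr rfl fun l _ => Finset.sum_congr rfl fun k _ => by ring

/-- The vectors `z J_m`, with `J_m` the Clifford matrices, satisfy a polarized norm identity. -/
theorem dotProduct_clifford (q : Fin 7 → ℝ) (z w : Fin 8 → ℝ) :
    (fun l => ∑ m, q m * ∑ k, z k * clifford m k l) ⬝ᵥ
      (fun l => ∑ m, q m * ∑ k, w k * clifford m k l) = (∑ m, q m * q m) * (z ⬝ᵥ w) := by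
  have hJ : ∀ m n i j, ∑ k, (((clifford m i k : ℝ) * clifford n j k) +
      (clifford n i k : ℝ) * clifford m j k) =
      2 * ((if m = n then 1 else 0) * if i = j then 1 else 0) := by
    intro m n i j
    have := congrArg (Int.cast : ℤ → ℝ) (clifford_anticomm m n i j)
    push_cast at this
    have h : ∀ m k, (clifford m k j : ℝ) = -clifford m j k := by
      intro m k; rw [clifford_antisymm m k j]; push_cast; rfl
    simp only [h, Finset.sum_add_distrib, mul_neg, Finset.sum_neg_distrib] at this
    rw [Finset.sum_add_distrib]
    linarith
  set S : Fin 7 → Fin 7 → ℝ := fun m n =>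
    ∑ i, ∑ j, z i * w j * ∑ k, (clifford m i k : ℝ) * clifford n j k with hS
  have hSS : ∀ m n, S m n + S n m = 2 * ((if m = n then 1 else 0) * (z ⬝ᵥ w)) := by
    intro m n
    simp only [hS, ← Finset.sum_add_distrib, ← mul_add, hJ]
    simp only [mul_ite, mul_one, mul_zero, dotProduct]
    by_cases h : m = n
    · simp [h, Finset.mul_sum, mul_comm]
    · simp [h]
  have h1 : (fun l => ∑ m, q m * ∑ k, z k * clifford m k l) ⬝ᵥ
      (fun l => ∑ m, q m * ∑ k, w k * clifford m k l) = ∑ m, ∑ n, q m * q n * S m n := by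
    simp only [dotProduct, hS, Finset.sum_mul_sum]
    simp only [Finset.mul_sum, Finset.sum_mul]
    rw [Finset.sum_comm]
    refine Finset.sum_congr rfl fun m _ => ?_
    rw [Finset.sum_comm]
    refine Finset.sum_congr rfl fun n _ => ?_
    rw [Finset.sum_comm]
    conv_rhs => rw [Finset.sum_comm]
    refine Finset.sum_congr rfl fun i _ => ?_
    rw [Finset.sum_comm]
    refine Finset.sum_congr rfl fun j _ => Finset.sum_congr rfl fun k _ => ?_
    ring
  -- The weights `q m * q n` are symmetric, so only the symmetric part of `S` matters, and the
  -- Clifford relations make it diagonal.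
  have h2 : ∑ m, ∑ n, q m * q n * S m n = ∑ m, ∑ n, q m * q n * S n m := by
    rw [Finset.sum_comm]
    exact Finset.sum_congr rfl fun m _ => Finset.sum_congr rfl fun n _ => by ring
  have h3 : ∑ m, ∑ n, q m * q n * (S m n + S n m) = 2 * ((∑ m, q m * q m) * (z ⬝ᵥ w)) := by
    simp only [hSS]
    simp [Finset.mul_sum, Finset.sum_mul]
    exact Finset.sum_congr rfl fun m _ => by ring
  simp only [mul_add, Finset.sum_add_distrib] at h3
  rw [h1]
  linarith

/-- The triple cross product of the model form has the norm of a triple vector product. -/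
theorem contract₃_dotProduct (x y z w : Fin 8 → ℝ) :
    contract₃ (fun i j k l => cayley i j k l) x y z ⬝ᵥ
      contract₃ (fun i j k l => cayley i j k l) x y w =
    ((x ⬝ᵥ x) * (y ⬝ᵥ y) - (x ⬝ᵥ y) ^ 2) * (z ⬝ᵥ w) - (y ⬝ᵥ y) * (x ⬝ᵥ z) * (x ⬝ᵥ w) -
      (x ⬝ᵥ x) * (y ⬝ᵥ z) * (y ⬝ᵥ w) +
      (x ⬝ᵥ y) * ((x ⬝ᵥ z) * (y ⬝ᵥ w) + (y ⬝ᵥ z) * (x ⬝ᵥ w)) := by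
  set q : Fin 7 → ℝ := fun m => cliffordForm m x y with hq
  set U : (Fin 8 → ℝ) → Fin 8 → ℝ := fun z l => ∑ m, q m * ∑ k, z k * clifford m k l with hU
  have hc : ∀ z, contract₃ (fun i j k l => cayley i j k l) x y z =
      (x ⬝ᵥ z) • y - (y ⬝ᵥ z) • x - U z := by
    intro z; ext l; simp [contract₃_cayley, hU, hq]
  have hUv : ∀ z v, U z ⬝ᵥ v = ∑ m, q m * cliffordForm m z v := by
    intro z v
    simp only [dotProduct, hU, cliffordForm, Finset.sum_mul, Finset.mul_sum]
    rw [Finset.sum_comm]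
    refine Finset.sum_congr rfl fun m _ => ?_
    rw [Finset.sum_comm]
    exact Finset.sum_congr rfl fun l _ => Finset.sum_congr rfl fun k _ => by ring
  have hφ := alt4_cayley
  have h24 : ∀ z, contract₄ (fun i j k l => cayley i j k l) x y z y = 0 := fun z => by
    linarith [contract₄_swap₂₄ hφ x y z y]
  have h14 : ∀ z, contract₄ (fun i j k l => cayley i j k l) x y z x = 0 := fun z => by
    linarith [contract₄_swap₂₄ hφ y x z x, contract₄_swap₁ hφ x y z x]
  have hUy : ∀ z, U z ⬝ᵥ y = (x ⬝ᵥ z) * (y ⬝ᵥ y) - (y ⬝ᵥ z) * (x ⬝ᵥ y) := fun z => by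
    rw [hUv, hq, sum_cliffordForm_mul, h24, sub_zero]
  have hUx : ∀ z, U z ⬝ᵥ x = (x ⬝ᵥ z) * (x ⬝ᵥ y) - (y ⬝ᵥ z) * (x ⬝ᵥ x) := fun z => by
    rw [hUv, hq, sum_cliffordForm_mul, h14, sub_zero, dotProduct_comm y x]
  -- The squared length of `q` is the Gram determinant of `x` and `y`; the term with the model form
  -- drops out because two of its arguments coincide.
  have hUU : U z ⬝ᵥ U w = ((x ⬝ᵥ x) * (y ⬝ᵥ y) - (x ⬝ᵥ y) ^ 2) * (z ⬝ᵥ w) := by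
    rw [hU, dotProduct_clifford, hq, sum_cliffordForm_mul, h24, dotProduct_comm y x]
    ring
  rw [dotProduct_comm] at hUU
  rw [hc, hc]
  simp only [sub_dotProduct, dotProduct_sub, smul_dotProduct, dotProduct_smul, smul_eq_mul, hUU,
    hUx, hUy, dotProduct_comm _ (U w), dotProduct_comm y x]
  ring

/-! ### The tangent space of the orbit of the model form -/

/-- A quadruple in the support of the `m`-th basis element of `Λ⁴₇`. -/
def baseQuad (m : Fin 7) : Fin 4 → Fin 8 :=
  (![![0, 2, 3, 4], ![0, 1, 3, 4], ![0, 1, 2, 4], ![0, 1, 2, 3], ![0, 1, 2, 6], ![0, 1, 2, 5],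
    ![0, 1, 3, 6]] : Fin 7 → Fin 4 → Fin 8) m

/-- All four indices lie in the `m`-th base quadruple. -/
def InBase (m : Fin 7) (i j k l : Fin 8) : Prop :=
  (∃ r, baseQuad m r = i) ∧ (∃ r, baseQuad m r = j) ∧ (∃ r, baseQuad m r = k) ∧
    ∃ r, baseQuad m r = l

instance (m : Fin 7) (i j k l : Fin 8) : Decidable (InBase m i j k l) := by
  unfold InBase; infer_instance

/-- Exchanging the partners of `k` and `l` brings the indices into the base quadruple. -/
def FlipInBase (m : Fin 7) (i j k l : Fin 8) : Prop :=
  cayleySign i j (fourth i j l) ≠ 0 ∧ InBase m i j (fourth i j l) (fourth i j k)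

instance (m : Fin 7) (i j k l : Fin 8) : Decidable (FlipInBase m i j k l) := by
  unfold FlipInBase; infer_instance

/-- Each base quadruple lies in the support of exactly one basis element, with entry `±1` there.
Evaluation on it therefore reads off one coefficient, up to this sign. -/
theorem lambda_baseQuad : ∀ m n, lambda n (baseQuad m 0) (baseQuad m 1) (baseQuad m 2)
    (baseQuad m 3) * lambda m (baseQuad m 0) (baseQuad m 1) (baseQuad m 2)
    (baseQuad m 3) = if n = m then 1 else 0 := by
  decide +kernel

/-- Elements of `Λ⁴₇` satisfy the linearized cross product identity. The sum over the contracted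
index reduces to one term in each product, because the model form has one nonzero entry per triple.
-/
theorem lambda_cayley : ∀ m i j k l, lambda m i j k (fourth i j l) * cayleySign i j l +
    cayleySign i j k * lambda m i j l (fourth i j k) = 0 := by
  decide +kernel

theorem fourth_fourth : ∀ i j l, fourth i j (fourth i j l) = l := by decide +kernel

theorem eq_baseQuad : ∀ m i j k l, (i < j ∧ j < k ∧ k < l) ∧ InBase m i j k l →
    (baseQuad m 0 = i ∧ baseQuad m 1 = j) ∧ baseQuad m 2 = k ∧ baseQuad m 3 = l := by
  decide +kernel

/-- The combinatorial certificate that the linearized identity has no solutions beyond `Λ⁴₇`: off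
the affine planes, at most two uses of the identity bring a quadruple into a base quadruple. The
first six flips differ in the pair of indices that is kept; the last alternative needs two
successive flips. -/
theorem exists_flip : ∀ i j k l, i < j → j < k → k < l → l ≠ fourth i j k →
    ∃ m, InBase m i j k l ∨ FlipInBase m i j k l ∨ FlipInBase m i k j l ∨ FlipInBase m i l j k ∨
      FlipInBase m j k i l ∨ FlipInBase m j l i k ∨ FlipInBase m k l i j ∨
      (cayleySign i j (fourth i j l) ≠ 0 ∧ FlipInBase m (fourth i j l) (fourth i j k) i j) := by
  decide +kernel

/-- The linearization of the triple cross product identity at the model form. -/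
def CrossTangent (D : Fin 8 → Fin 8 → Fin 8 → Fin 8 → ℝ) : Prop :=
  ∀ i j k l, D i j k (fourth i j l) * cayleySign i j l +
    cayleySign i j k * D i j l (fourth i j k) = 0

namespace CrossTangent

variable {D : Fin 8 → Fin 8 → Fin 8 → Fin 8 → ℝ}

theorem eq_zero_of_flip (h : CrossTangent D) {i j k l : Fin 8}
    (hs : cayleySign i j (fourth i j l) ≠ 0) (hD : D i j (fourth i j l) (fourth i j k) = 0) :
    D i j k l = 0 := by
  have := h i j k (fourth i j l)
  rw [hD, mul_zero, add_zero, fourth_fourth] at this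
  exact (mul_eq_zero.1 this).resolve_right (by exact_mod_cast hs)

/-- A solution of the linearized identity vanishes if it vanishes on the base quadruples. -/
theorem eq_zero (h : CrossTangent D) (hD : Alt4 D)
    (hb : ∀ m, D (baseQuad m 0) (baseQuad m 1) (baseQuad m 2) (baseQuad m 3) = 0)
    (i j k l : Fin 8) : D i j k l = 0 := by
  have hin : ∀ {m i j k l}, InBase m i j k l → D i j k l = 0 := by
    intro m i j k l hm
    -- Setting the entries outside the base quadruple to zero keeps the array alternating, so the
    -- single increasing entry, which is zero, decides all of them.
    have hE : Alt4 fun i j k l => if InBase m i j k l then D i j k l else 0 := by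
      refine ⟨fun i j k l => ?_, fun i j k l => ?_, fun i j k l => ?_⟩
      · have : InBase m i j k l ↔ InBase m j i k l := by unfold InBase; tauto
        simp only [this, hD.swap₁ i j k l]; split_ifs <;> simp
      · have : InBase m i j k l ↔ InBase m i k j l := by unfold InBase; tauto
        simp only [this, hD.swap₂ i j k l]; split_ifs <;> simp
      · have : InBase m i j k l ↔ InBase m i j l k := by unfold InBase; tauto
        simp only [this, hD.swap₃ i j k l]; split_ifs <;> simp
    have := hE.eq_zero_of_lt (fun i j k l hij hjk hkl => by
      split_ifs with hI
      · obtain ⟨⟨rfl, rfl⟩, rfl, rfl⟩ := eq_baseQuad m i j k l ⟨⟨hij, hjk, hkl⟩, hI⟩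
        exact hb m
      · rfl) i j k l
    simpa [hm] using this
  have hfl : ∀ {m i j k l}, FlipInBase m i j k l → D i j k l = 0 :=
    fun hm => h.eq_zero_of_flip hm.1 (hin hm.2)
  refine hD.eq_zero_of_lt (fun i j k l hij hjk hkl => ?_) i j k l
  by_cases hl : l = fourth i j k
  · have h1 := h i j k k
    have h2 : (cayleySign i j k : ℝ) ≠ 0 := by
      have : ∀ i j k, i < j → j < k → cayleySign i j k ≠ 0 := by decide +kernel
      exact_mod_cast this i j k hij hjk
    rw [hl]
    exact (mul_eq_zero.1 (show (cayleySign i j k : ℝ) * D i j k (fourth i j k) = 0 by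
      linarith)).resolve_left h2
  obtain ⟨m, h1 | h1 | h1 | h1 | h1 | h1 | h1 | h1⟩ := exists_flip i j k l hij hjk hkl hl
  · exact hin h1
  · exact hfl h1
  · rw [hD.swap₂, hfl h1, neg_zero]
  · rw [hD.swap₃, hD.swap₂, hfl h1]; simp
  · rw [hD.swap₁, hD.swap₂, hfl h1]; simp
  · rw [hD.swap₃, hD.swap₁, hD.swap₂, hfl h1]; simp
  · rw [hD.swap₂, hD.swap₁, hD.swap₃, hD.swap₂, hfl h1]; simp
  · refine h.eq_zero_of_flip h1.1 ?_
    rw [hD.swap₂, hD.swap₁, hD.swap₃, hD.swap₂, neg_neg, neg_neg]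
    exact hfl h1.2

/-- The solutions of the linearized identity are the elements of `Λ⁴₇`. -/
theorem exists_eq_sum (h : CrossTangent D) (hD : Alt4 D) :
    ∃ c : Fin 7 → ℝ, ∀ i j k l, D i j k l = ∑ m, c m * lambda m i j k l := by
  set b : Fin 7 → (Fin 8 → Fin 8 → Fin 8 → Fin 8 → ℝ) → ℝ := fun m T =>
    T (baseQuad m 0) (baseQuad m 1) (baseQuad m 2) (baseQuad m 3) with hb
  -- The entry of `lambda m` on its base quadruple is `±1` and hence its own inverse, so this
  -- product is the coefficient of `lambda m`.
  set c : Fin 7 → ℝ := fun m => b m (fun i j k l => lambda m i j k l) * b m D with hc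
  refine ⟨c, fun i j k l => sub_eq_zero.1 ?_⟩
  refine eq_zero (D := fun i j k l => D i j k l - ∑ m, c m * lambda m i j k l) ?_
    (hD.sub ⟨fun i j k l => ?_, fun i j k l => ?_, fun i j k l => ?_⟩) ?_ i j k l
  · intro i j k l
    have h1 : ∀ m, (lambda m i j k (fourth i j l) : ℝ) * cayleySign i j l =
        -(cayleySign i j k * lambda m i j l (fourth i j k)) := by
      intro m
      have := lambda_cayley m i j k l
      rw [eq_neg_iff_add_eq_zero]
      exact_mod_cast this
    have h2 := h i j k l
    have h3 : (∑ m, c m * lambda m i j k (fourth i j l)) * (cayleySign i j l : ℝ) =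
        -(cayleySign i j k * ∑ m, c m * lambda m i j l (fourth i j k)) := by
      rw [Finset.sum_mul, Finset.mul_sum, ← Finset.sum_neg_distrib]
      refine Finset.sum_congr rfl fun m _ => ?_
      rw [mul_assoc, h1]; ring
    rw [sub_mul, mul_sub, h3]
    linarith
  · simp only [(alt4_lambda _).swap₁ i j k l, mul_neg, Finset.sum_neg_distrib]
  · simp only [(alt4_lambda _).swap₂ i j k l, mul_neg, Finset.sum_neg_distrib]
  · simp only [(alt4_lambda _).swap₃ i j k l, mul_neg, Finset.sum_neg_distrib]
  · intro m
    have h1 : ∀ n, (lambda n (baseQuad m 0) (baseQuad m 1) (baseQuad m 2) (baseQuad m 3) : ℝ) *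
        b m (fun i j k l => lambda m i j k l) = if n = m then 1 else 0 := by
      intro n
      have := lambda_baseQuad m n
      simp only [hb]
      exact_mod_cast this
    have h2 : ∀ n, c n * (lambda n (baseQuad m 0) (baseQuad m 1) (baseQuad m 2)
        (baseQuad m 3) : ℝ) = if n = m then b m D else 0 := by
      intro n
      have hn := h1 n
      have hm := h1 m
      by_cases hnm : n = m
      · subst hnm
        simp only [if_true] at hn ⊢
        simp only [hc]
        linear_combination b n D * hn
      · simp only [if_true, if_neg hnm] at hn hm ⊢
        have : b m (fun i j k l => lambda m i j k l) ≠ 0 := right_ne_zero_of_mul (hm ▸ one_ne_zero)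
        rw [(mul_eq_zero.1 hn).resolve_right this, mul_zero]
    simp [h2, hb]

end CrossTangent

/-! ### Quadratic identities in an adapted frame -/

/-- Triples of indices. -/
abbrev Triple : Type := Fin 8 × Fin 8 × Fin 8

/-- An array with four indices, as a matrix with rows indexed by the first index. -/
def toMat (T : Fin 8 → Fin 8 → Fin 8 → Fin 8 → ℝ) : Matrix (Fin 8) Triple ℝ :=
  Matrix.of fun i I => T i I.1 I.2.1 I.2.2

@[simp] theorem toMat_apply (T : Fin 8 → Fin 8 → Fin 8 → Fin 8 → ℝ) (i : Fin 8) (I : Triple) :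
    toMat T i I = T i I.1 I.2.1 I.2.2 := rfl

/-- The model form as a matrix. -/
def cayleyMat : Matrix (Fin 8) Triple ℝ := toMat fun i j k l => cayley i j k l

/-- The basis of `Λ⁴₇` as matrices. -/
def lambdaMat (m : Fin 7) : Matrix (Fin 8) Triple ℝ := toMat fun i j k l => lambda m i j k l

/-- The Clifford matrices. -/
def cliffordMat (m : Fin 7) : Matrix (Fin 8) (Fin 8) ℝ := Matrix.of fun i j => (clifford m i j : ℝ)

theorem cliffordMat_transpose (m : Fin 7) : (cliffordMat m).transpose = -cliffordMat m := by
  ext i j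
  have := clifford_antisymm m j i
  simp only [cliffordMat, Matrix.transpose_apply, Matrix.of_apply, Matrix.neg_apply]
  rw [this]; push_cast; rfl

theorem cliffordMat_mul_add (m n : Fin 7) : cliffordMat m * cliffordMat n +
    cliffordMat n * cliffordMat m = if m = n then (-2 : ℝ) • (1 : Matrix (Fin 8) (Fin 8) ℝ) else 0 := by
  ext i j
  have := congrArg (Int.cast : ℤ → ℝ) (clifford_anticomm m n i j)
  push_cast at this
  rw [Matrix.add_apply, Matrix.mul_apply, Matrix.mul_apply, ← Finset.sum_add_distrib]
  refine this.trans ?_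
  split_ifs with h1 h2 <;> simp [*]

theorem lambdaMat_mul_cayleyMat (m : Fin 7) :
    lambdaMat m * cayleyMat.transpose = (24 : ℝ) • cliffordMat m := by
  ext i j
  have := congrArg (Int.cast : ℤ → ℝ) (sum_lambda_mul_cayley m i j)
  push_cast at this
  simpa [Matrix.mul_apply, Fintype.sum_prod_type, lambdaMat, cayleyMat, cliffordMat] using this

theorem lambdaMat_mul_lambdaMat (m n : Fin 7) : lambdaMat m * (lambdaMat n).transpose =
    (if m = n then (24 : ℝ) • (1 : Matrix (Fin 8) (Fin 8) ℝ) else 0) -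
      (6 : ℝ) • (cliffordMat m * cliffordMat n - cliffordMat n * cliffordMat m) := by
  ext i j
  have := congrArg (Int.cast : ℤ → ℝ) (sum_lambda_mul_lambda m n i j)
  push_cast at this
  rw [Finset.sum_sub_distrib] at this
  simp only [Matrix.mul_apply, Fintype.sum_prod_type, lambdaMat, toMat_apply, Matrix.sub_apply,
    Matrix.smul_apply, cliffordMat, Matrix.of_apply, Matrix.transpose_apply, smul_eq_mul]
  rw [this]
  split_ifs with h1 h2 <;> simp [*]

/-- A covector with values in `Λ⁴₇`, given by its coefficients. -/
def ofCoeff (c : Fin 8 → Fin 7 → ℝ) (a : Fin 8) : Matrix (Fin 8) Triple ℝ :=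
  ∑ m, c a m • lambdaMat m

section OfCoeff

variable (c : Fin 8 → Fin 7 → ℝ)

theorem ofCoeff_mul_cayleyMat (a p q : Fin 8) : (ofCoeff c a * cayleyMat.transpose) p q =
    24 * ∑ m, c a m * cliffordMat m p q := by
  simp [ofCoeff, Matrix.sum_mul, lambdaMat_mul_cayleyMat, Matrix.sum_apply, Finset.mul_sum]
  exact Finset.sum_congr rfl fun m _ => by ring

/-- Contracting the model form gives multiples of the skew matrices `J_m`. One balanced condition
therefore yields the vanishing of both contractions needed in `weitzenboeck`. -/
theorem sum_ofCoeff_mul_cayleyMat_swap (p : Fin 8) :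
    ∑ a, (ofCoeff c a * cayleyMat.transpose) p a =
      -∑ a, (ofCoeff c a * cayleyMat.transpose) a p := by
  simp only [ofCoeff_mul_cayleyMat, ← Finset.sum_neg_distrib, ← mul_neg]
  refine Finset.sum_congr rfl fun a _ => congrArg _ (Finset.sum_congr rfl fun m _ => ?_)
  have := congrFun (congrFun (cliffordMat_transpose m) a) p
  rw [Matrix.transpose_apply, Matrix.neg_apply] at this
  rw [this]

theorem ofCoeff_mul_ofCoeff (a b p q : Fin 8) : (ofCoeff c a * (ofCoeff c b).transpose) p q =
    (if p = q then 24 * ∑ m, c a m * c b m else 0) - 6 * ∑ m, ∑ n, c a m * c b n *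
      ((cliffordMat m * cliffordMat n) p q - (cliffordMat n * cliffordMat m) p q) := by
  simp only [ofCoeff, Matrix.transpose_sum, Matrix.sum_mul, Matrix.mul_sum, Matrix.transpose_smul,
    Matrix.smul_mul, Matrix.mul_smul, lambdaMat_mul_lambdaMat, Matrix.sum_apply, Matrix.smul_apply,
    Matrix.sub_apply, smul_eq_mul, mul_sub, Finset.sum_sub_distrib, Finset.mul_sum]
  congr 1
  · rw [Finset.sum_comm]
    by_cases hpq : p = q
    · simp only [Matrix.ite_apply, hpq, Matrix.smul_apply, Matrix.one_apply_eq, Matrix.zero_apply,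
        mul_ite, mul_zero, Finset.sum_ite_eq, Finset.mem_univ, if_true]
      exact Finset.sum_congr rfl fun m _ => by simp; ring
    · simp [Matrix.ite_apply, hpq]
  · congr 1
    all_goals
      rw [Finset.sum_comm]
      exact Finset.sum_congr rfl fun m _ => Finset.sum_congr rfl fun n _ => by ring

variable {c} (hc : ∀ p, ∑ a, (ofCoeff c a * cayleyMat.transpose) a p = 0)

include hc

/-- The balanced condition in its usable form: the coefficient array lies in the kernel of Clifford
multiplication `ℝ⁸ ⊗ ℝ⁷ → ℝ⁸`. -/
theorem sum_coeff_mul_cliffordMat (p : Fin 8) : ∑ a, ∑ m, c a m * cliffordMat m a p = 0 := by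
  have := hc p
  simp only [ofCoeff_mul_cayleyMat, ← Finset.mul_sum] at this
  simpa using this

/-- Summing over `p` and `m` first meets only `c` and the left factor, and this sum is zero by the
balanced condition. -/
theorem sum_mul_cliffordMat_mul (f : Fin 8 → Fin 7 → ℝ) : ∑ p, ∑ a, ∑ m, ∑ n, c p m * f a n *
    (cliffordMat m * cliffordMat n) p a = 0 := by
  have : ∀ a n, ∑ p, ∑ m, c p m * f a n * (cliffordMat m * cliffordMat n) p a = 0 := by
    intro a n
    have h : ∀ p m, c p m * f a n * (cliffordMat m * cliffordMat n) p a =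
        ∑ s, f a n * cliffordMat n s a * (c p m * cliffordMat m p s) := by
      intro p m
      rw [Matrix.mul_apply, Finset.mul_sum]
      exact Finset.sum_congr rfl fun s _ => by ring
    simp only [h]
    have h' : ∀ p, ∑ m, ∑ s, f a n * cliffordMat n s a * (c p m * cliffordMat m p s) =
        ∑ s, f a n * cliffordMat n s a * ∑ m, (c p m * cliffordMat m p s) := by
      intro p
      rw [Finset.sum_comm]
      simp only [Finset.mul_sum]
    simp only [h']
    rw [Finset.sum_comm]
    simp only [← Finset.mul_sum, sum_coeff_mul_cliffordMat hc, mul_zero, Finset.sum_const_zero]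
  rw [Finset.sum_comm]
  refine Finset.sum_eq_zero fun a _ => ?_
  have h2 : ∀ p, ∑ m, ∑ n, c p m * f a n * (cliffordMat m * cliffordMat n) p a =
      ∑ n, ∑ m, c p m * f a n * (cliffordMat m * cliffordMat n) p a := fun p => Finset.sum_comm
  simp only [h2]
  rw [Finset.sum_comm]
  exact Finset.sum_eq_zero fun n _ => this a n

omit hc in
-- Anticommuting the two Clifford matrices costs only the diagonal term.
theorem sum_mul_cliffordMat_mul_swap (f : Fin 8 → Fin 7 → ℝ) :
    ∑ p, ∑ a, ∑ m, ∑ n, c p m * f a n * (cliffordMat n * cliffordMat m) p a =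
      -(∑ p, ∑ a, ∑ m, ∑ n, c p m * f a n * (cliffordMat m * cliffordMat n) p a) -
        2 * ∑ p, ∑ m, c p m * f p m := by
  have h : ∀ p a m n, c p m * f a n * (cliffordMat n * cliffordMat m) p a =
      -(c p m * f a n * (cliffordMat m * cliffordMat n) p a) -
        (if m = n then if p = a then 2 * (c p m * f a n) else 0 else 0) := by
    intro p a m n
    have := congrFun (congrFun (cliffordMat_mul_add m n) p) a
    rw [Matrix.add_apply] at this
    rw [eq_sub_of_add_eq' this]
    split_ifs with h1 h2 <;> simp [*]; ring
  simp only [h, Finset.sum_sub_distrib, Finset.sum_neg_distrib]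
  congr 1
  simp [Finset.mul_sum]

/-- The square norm of the torsion in terms of the coefficients. -/
theorem sum_divergence_sq : ∑ p, ∑ a, (ofCoeff c p * (ofCoeff c a).transpose) p a =
    12 * ∑ p, ∑ m, c p m * c p m := by
  -- The diagonal part contributes `24 |c|²` and the commutator part `-12 |c|²`.
  have h1 := sum_mul_cliffordMat_mul hc c
  have h2 := sum_mul_cliffordMat_mul_swap (c := c) c
  simp only [ofCoeff_mul_ofCoeff, mul_sub, Finset.sum_sub_distrib, ← Finset.mul_sum]
  rw [h1, h2, h1]
  simp [← Finset.mul_sum]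
  ring

/-- The second quadratic invariant of the covariant derivative. -/
theorem sum_crossed_sq : ∑ p, ∑ a, (ofCoeff c a * (ofCoeff c p).transpose) p a =
    36 * ∑ p, ∑ m, c p m * c p m := by
  have h1 := sum_mul_cliffordMat_mul hc c
  have h2 := sum_mul_cliffordMat_mul_swap (c := c) c
  -- Exchanging `a` and `p` reverses the commutator, so its contribution is now `+12 |c|²` and the
  -- total is `36 |c|²`.
  have h3 : ∀ p a, ∑ m, ∑ n, c a m * c p n * (cliffordMat m * cliffordMat n) p a =
      ∑ m, ∑ n, c p m * c a n * (cliffordMat n * cliffordMat m) p a := by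
    intro p a
    rw [Finset.sum_comm]
    exact Finset.sum_congr rfl fun m _ => Finset.sum_congr rfl fun n _ => by ring
  have h4 : ∀ p a, ∑ m, ∑ n, c a m * c p n * (cliffordMat n * cliffordMat m) p a =
      ∑ m, ∑ n, c p m * c a n * (cliffordMat m * cliffordMat n) p a := by
    intro p a
    rw [Finset.sum_comm]
    exact Finset.sum_congr rfl fun m _ => Finset.sum_congr rfl fun n _ => by ring
  simp only [ofCoeff_mul_ofCoeff, mul_sub, Finset.sum_sub_distrib, ← Finset.mul_sum, h3, h4]
  rw [h1, h2, h1]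
  simp [← Finset.mul_sum]
  ring

end OfCoeff

/-! ### Partial derivatives of functions and of matrices of functions -/

section Pd

variable {U : Set R8} {u : R8}

theorem differentiableAt_of_contDiffOn {f : R8 → ℝ} (hU : IsOpen U) (hf : ContDiffOn ℝ ∞ f U)
    (hu : u ∈ U) : DifferentiableAt ℝ f u :=
  (hf.contDiffAt (hU.mem_nhds hu)).differentiableAt (by simp)

theorem contDiffOn_pd {f : R8 → ℝ} (hU : IsOpen U) (hf : ContDiffOn ℝ ∞ f U) (p : Fin 8) :
    ContDiffOn ℝ ∞ (pd p f) U :=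
  (hf.fderiv_of_isOpen hU le_rfl).clm_apply contDiffOn_const

theorem pd_congr {f f' : R8 → ℝ} (hU : IsOpen U) (h : ∀ v ∈ U, f v = f' v) (hu : u ∈ U)
    (p : Fin 8) : pd p f u = pd p f' u := by
  have : f =ᶠ[nhds u] f' := by
    filter_upwards [hU.mem_nhds hu] with v hv using h v hv
  rw [pd, pd, this.fderiv_eq]

theorem pd_const (p : Fin 8) (c : ℝ) : pd p (fun _ => c) u = 0 := by
  simp [pd]

theorem pd_eq_zero {f : R8 → ℝ} (hU : IsOpen U) (h : ∀ v ∈ U, f v = 0) (hu : u ∈ U)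
    (p : Fin 8) : pd p f u = 0 := by
  rw [pd_congr hU h hu, pd_const]

theorem pd_add {f f' : R8 → ℝ} (hf : DifferentiableAt ℝ f u) (hf' : DifferentiableAt ℝ f' u)
    (p : Fin 8) : pd p (fun v => f v + f' v) u = pd p f u + pd p f' u := by
  simp [pd, fderiv_fun_add hf hf']

theorem pd_sub {f f' : R8 → ℝ} (hf : DifferentiableAt ℝ f u) (hf' : DifferentiableAt ℝ f' u)
    (p : Fin 8) : pd p (fun v => f v - f' v) u = pd p f u - pd p f' u := by
  simp [pd, fderiv_fun_sub hf hf']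

theorem pd_neg {f : R8 → ℝ} (p : Fin 8) : pd p (fun v => -f v) u = -pd p f u := by
  simp [pd, fderiv_fun_neg]

theorem pd_mul {f f' : R8 → ℝ} (hf : DifferentiableAt ℝ f u) (hf' : DifferentiableAt ℝ f' u)
    (p : Fin 8) : pd p (fun v => f v * f' v) u = pd p f u * f' u + f u * pd p f' u := by
  simp [pd, fderiv_fun_mul hf hf']
  ring

theorem pd_sum {ι : Type*} [Fintype ι] {f : ι → R8 → ℝ} (hf : ∀ i, DifferentiableAt ℝ (f i) u)
    (p : Fin 8) : pd p (fun v => ∑ i, f i v) u = ∑ i, pd p (f i) u := by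
  simp [pd, fderiv_fun_sum fun i _ => hf i]

theorem pd_comm {f : R8 → ℝ} (hU : IsOpen U) (hf : ContDiffOn ℝ ∞ f U) (hu : u ∈ U)
    (p q : Fin 8) : pd p (pd q f) u = pd q (pd p f) u := by
  have hf' := hf.contDiffAt (hU.mem_nhds hu)
  have hd : DifferentiableAt ℝ (fderiv ℝ f) u :=
    (hf'.fderiv_right (m := ∞) le_rfl).differentiableAt (by simp)
  have h : ∀ p q : Fin 8, pd p (pd q f) u =
      fderiv ℝ (fderiv ℝ f) u (EuclideanSpace.single p 1) (EuclideanSpace.single q 1) := by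
    intro p q
    change fderiv ℝ (fun v => fderiv ℝ f v (EuclideanSpace.single q 1)) u _ = _
    rw [fderiv_clm_apply hd (differentiableAt_const _)]
    simp
  rw [h, h]
  exact hf'.isSymmSndFDerivAt (by simpa using ENat.LEInfty.out) _ _

end Pd

section PdMat

variable {l m n m' n' : Type*}

/-- The entries of a matrix of functions are smooth on `U`. -/
def MatSmooth (U : Set R8) (A : R8 → Matrix m n ℝ) : Prop :=
  ∀ i j, ContDiffOn ℝ ∞ (fun u => A u i j) U

/-- The partial derivative of a matrix of functions. -/
def pdMat (p : Fin 8) (A : R8 → Matrix m n ℝ) (u : R8) : Matrix m n ℝ :=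
  Matrix.of fun i j => pd p (fun v => A v i j) u

@[simp] theorem pdMat_apply (p : Fin 8) (A : R8 → Matrix m n ℝ) (u : R8) (i : m) (j : n) :
    pdMat p A u i j = pd p (fun v => A v i j) u := rfl

variable {U : Set R8} {u : R8} {A B : R8 → Matrix m n ℝ}

theorem MatSmooth.differentiableAt (hA : MatSmooth U A) (hU : IsOpen U) (hu : u ∈ U) (i : m)
    (j : n) : DifferentiableAt ℝ (fun u => A u i j) u :=
  differentiableAt_of_contDiffOn hU (hA i j) hu

theorem MatSmooth.transpose (hA : MatSmooth U A) : MatSmooth U fun u => (A u).transpose :=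
  fun i j => hA j i

theorem MatSmooth.const (A : Matrix m n ℝ) : MatSmooth U fun _ => A := fun _ _ => contDiffOn_const

theorem MatSmooth.add (hA : MatSmooth U A) (hB : MatSmooth U B) :
    MatSmooth U fun u => A u + B u := fun i j => (hA i j).add (hB i j)

theorem MatSmooth.sub (hA : MatSmooth U A) (hB : MatSmooth U B) :
    MatSmooth U fun u => A u - B u := fun i j => (hA i j).sub (hB i j)

theorem MatSmooth.mul [Fintype n] {B : R8 → Matrix n l ℝ} (hA : MatSmooth U A)
    (hB : MatSmooth U B) : MatSmooth U fun u => A u * B u := fun i j => by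
  simp only [Matrix.mul_apply]
  exact ContDiffOn.sum fun k _ => (hA i k).mul (hB k j)

theorem MatSmooth.kronecker {B : R8 → Matrix m' n' ℝ} (hA : MatSmooth U A) (hB : MatSmooth U B) :
    MatSmooth U fun u => Matrix.kronecker (A u) (B u) := fun i j =>
  (hA i.1 j.1).mul (hB i.2 j.2)

theorem MatSmooth.pdMat (hU : IsOpen U) (hA : MatSmooth U A) (p : Fin 8) :
    MatSmooth U (pdMat p A) := fun i j => contDiffOn_pd hU (hA i j) p

theorem MatSmooth.det [Fintype m] [DecidableEq m] {A : R8 → Matrix m m ℝ} (hA : MatSmooth U A) :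
    ContDiffOn ℝ ∞ (fun u => (A u).det) U := by
  simp only [Matrix.det_apply']
  exact ContDiffOn.sum fun σ _ => contDiffOn_const.mul (contDiffOn_prod fun i _ => hA _ _)

theorem MatSmooth.inv [Fintype m] [DecidableEq m] {A : R8 → Matrix m m ℝ} (hA : MatSmooth U A)
    (hdet : ∀ u ∈ U, IsUnit (A u).det) : MatSmooth U fun u => (A u)⁻¹ := by
  intro i j
  simp only [Matrix.inv_def, Matrix.smul_apply, Ring.inverse_eq_inv', smul_eq_mul]
  refine (hA.det.inv fun u hu => (hdet u hu).ne_zero).mul ?_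
  simp only [Matrix.adjugate_apply]
  refine MatSmooth.det fun k l => ?_
  simp only [Matrix.updateRow_apply]
  split_ifs
  · exact contDiffOn_const
  · exact hA k l

theorem pdMat_add (hU : IsOpen U) (hu : u ∈ U) (hA : MatSmooth U A) (hB : MatSmooth U B)
    (p : Fin 8) : pdMat p (fun u => A u + B u) u = pdMat p A u + pdMat p B u := by
  ext i j
  exact pd_add (hA.differentiableAt hU hu i j) (hB.differentiableAt hU hu i j) p

theorem pdMat_sub (hU : IsOpen U) (hu : u ∈ U) (hA : MatSmooth U A) (hB : MatSmooth U B)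
    (p : Fin 8) : pdMat p (fun u => A u - B u) u = pdMat p A u - pdMat p B u := by
  ext i j
  exact pd_sub (hA.differentiableAt hU hu i j) (hB.differentiableAt hU hu i j) p

theorem pdMat_transpose (p : Fin 8) :
    pdMat p (fun u => (A u).transpose) u = (pdMat p A u).transpose := rfl

theorem pdMat_const (p : Fin 8) (A : Matrix m n ℝ) : pdMat p (fun _ => A) u = 0 := by
  ext i j; simp [pd_const]

theorem pdMat_congr (hU : IsOpen U) (hu : u ∈ U) (h : ∀ v ∈ U, A v = B v) (p : Fin 8) :
    pdMat p A u = pdMat p B u := by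
  ext i j; exact pd_congr hU (fun v hv => by rw [h v hv]) hu p

theorem pdMat_mul [Fintype n] {B : R8 → Matrix n l ℝ} (hU : IsOpen U) (hu : u ∈ U)
    (hA : MatSmooth U A) (hB : MatSmooth U B) (p : Fin 8) :
    pdMat p (fun u => A u * B u) u = pdMat p A u * B u + A u * pdMat p B u := by
  ext i j
  simp only [pdMat_apply, Matrix.mul_apply, Matrix.add_apply]
  rw [pd_sum (f := fun k v => A v i k * B v k j) fun k =>
      (hA.differentiableAt hU hu i k).mul (hB.differentiableAt hU hu k j),
    ← Finset.sum_add_distrib]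
  exact Finset.sum_congr rfl fun k _ =>
    pd_mul (hA.differentiableAt hU hu i k) (hB.differentiableAt hU hu k j) p

theorem pdMat_kronecker {B : R8 → Matrix m' n' ℝ} (hU : IsOpen U) (hu : u ∈ U)
    (hA : MatSmooth U A) (hB : MatSmooth U B) (p : Fin 8) :
    pdMat p (fun u => Matrix.kronecker (A u) (B u)) u =
      Matrix.kronecker (pdMat p A u) (B u) + Matrix.kronecker (A u) (pdMat p B u) := by
  ext i j
  exact pd_mul (hA.differentiableAt hU hu i.1 j.1) (hB.differentiableAt hU hu i.2 j.2) p

theorem pdMat_comm (hU : IsOpen U) (hu : u ∈ U) (hA : MatSmooth U A) (p q : Fin 8) :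
    pdMat p (pdMat q A) u = pdMat q (pdMat p A) u := by
  ext i j; exact pd_comm hU (hA i j) hu p q

end PdMat

/-! ### Connections on bundles of tensors -/

section Connection

variable {m n : Type*} [Fintype m] [Fintype n] [DecidableEq m] [DecidableEq n]

/-- The connection induced on a tensor product. -/
def tensorConn (A : Matrix m m ℝ) (B : Matrix n n ℝ) : Matrix (m × n) (m × n) ℝ :=
  Matrix.kronecker A 1 + Matrix.kronecker 1 B

/-- The curvature of a matrix-valued connection. -/
def curvMat (A : Fin 8 → R8 → Matrix m m ℝ) (p q : Fin 8) (u : R8) : Matrix m m ℝ :=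
  pdMat p (A q) u - pdMat q (A p) u - (A p u * A q u - A q u * A p u)

/-- The inverse metric `H` is parallel for the connection `A`. -/
def IsMetricConn (U : Set R8) (H : R8 → Matrix m m ℝ) (A : Fin 8 → R8 → Matrix m m ℝ) : Prop :=
  ∀ u ∈ U, ∀ p, pdMat p H u = -((A p u).transpose * H u + H u * A p u)

variable {U : Set R8} {u : R8}

omit [Fintype m] [Fintype n] in
theorem MatSmooth.tensorConn {A : R8 → Matrix m m ℝ} {B : R8 → Matrix n n ℝ}
    (hA : MatSmooth U A) (hB : MatSmooth U B) : MatSmooth U fun u => tensorConn (A u) (B u) :=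
  (hA.kronecker (MatSmooth.const 1)).add ((MatSmooth.const 1).kronecker hB)

/-- The connections on the two factors commute, so no cross terms survive and curvature acts as a
derivation. -/
theorem curvMat_tensorConn {A : Fin 8 → R8 → Matrix m m ℝ} {B : Fin 8 → R8 → Matrix n n ℝ}
    (hU : IsOpen U) (hu : u ∈ U) (hA : ∀ p, MatSmooth U (A p)) (hB : ∀ p, MatSmooth U (B p))
    (p q : Fin 8) : curvMat (fun p u => tensorConn (A p u) (B p u)) p q u =
      tensorConn (curvMat A p q u) (curvMat B p q u) := by
  have h1 := fun p => (hA p).kronecker (MatSmooth.const (U := U) (1 : Matrix n n ℝ))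
  have h2 := fun p => (MatSmooth.const (U := U) (1 : Matrix m m ℝ)).kronecker (hB p)
  have hd : ∀ p q, pdMat p (fun u => tensorConn (A q u) (B q u)) u =
      tensorConn (pdMat p (A q) u) (pdMat p (B q) u) := by
    intro p q
    simp only [Spin7.tensorConn]
    rw [pdMat_add hU hu (h1 q) (h2 q), pdMat_kronecker hU hu (hA q) (MatSmooth.const _),
      pdMat_kronecker hU hu (MatSmooth.const _) (hB q), pdMat_const, pdMat_const]
    simp [Matrix.kronecker]
  simp only [curvMat, hd]
  simp only [Spin7.tensorConn, add_mul, mul_add, Matrix.kronecker, ← Matrix.mul_kronecker_mul,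
    one_mul, mul_one]
  ext i j
  simp [Matrix.kroneckerMap_apply, sub_mul, mul_sub]
  ring

theorem IsMetricConn.tensor {A : Fin 8 → R8 → Matrix m m ℝ} {B : Fin 8 → R8 → Matrix n n ℝ}
    {H : R8 → Matrix m m ℝ} {L : R8 → Matrix n n ℝ} (hU : IsOpen U) (hH : MatSmooth U H)
    (hL : MatSmooth U L) (hA : IsMetricConn U H A) (hB : IsMetricConn U L B) :
    IsMetricConn U (fun u => Matrix.kronecker (H u) (L u))
      fun p u => tensorConn (A p u) (B p u) := by
  intro u hu p
  rw [pdMat_kronecker hU hu hH hL, hA u hu p, hB u hu p]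
  simp only [Spin7.tensorConn, Matrix.transpose_add, add_mul, mul_add, Matrix.kronecker,
    ← Matrix.kroneckerMap_transpose, Matrix.transpose_one, ← Matrix.mul_kronecker_mul, one_mul,
    mul_one]
  ext i j
  simp [Matrix.kroneckerMap_apply, add_mul, mul_add]
  ring

end Connection

/-! ### A Weitzenböck formula -/

section Weitzenboeck

variable {n : Type*} [Fintype n]

/-- The covariant derivative of a covariant tensor, seen as a matrix. -/
def covDeriv (A : Fin 8 → R8 → Matrix (Fin 8) (Fin 8) ℝ) (C : Fin 8 → R8 → Matrix n n ℝ)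
    (Φ : R8 → Matrix (Fin 8) n ℝ) (p : Fin 8) (u : R8) : Matrix (Fin 8) n ℝ :=
  pdMat p Φ u - A p u * Φ u - Φ u * (C p u).transpose

variable {U : Set R8} {u : R8} {A : Fin 8 → R8 → Matrix (Fin 8) (Fin 8) ℝ}
  {C : Fin 8 → R8 → Matrix n n ℝ} {H : R8 → Matrix (Fin 8) (Fin 8) ℝ} {L : R8 → Matrix n n ℝ}
  {Φ : R8 → Matrix (Fin 8) n ℝ}

theorem pdMat_eq_covDeriv (p : Fin 8) : pdMat p Φ u =
    covDeriv A C Φ p u + A p u * Φ u + Φ u * (C p u).transpose := by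
  rw [covDeriv]; abel

theorem MatSmooth.covDeriv (hU : IsOpen U) (hA : ∀ p, MatSmooth U (A p))
    (hC : ∀ p, MatSmooth U (C p)) (hΦ : MatSmooth U Φ) (p : Fin 8) :
    MatSmooth U (covDeriv A C Φ p) :=
  ((hΦ.pdMat hU p).sub ((hA p).mul hΦ)).sub (hΦ.mul (hC p).transpose)

/-- The derivative of the tensor with raised indices. -/
theorem pdMat_raise (hU : IsOpen U) (hu : u ∈ U) (hH : MatSmooth U H) (hL : MatSmooth U L)
    (hΦ : MatSmooth U Φ) (hHA : IsMetricConn U H A) (hLC : IsMetricConn U L C) (p : Fin 8) :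
    pdMat p (fun u => H u * Φ u * L u) u = H u * covDeriv A C Φ p u * L u -
      (A p u).transpose * (H u * Φ u * L u) - H u * Φ u * L u * C p u := by
  rw [pdMat_mul hU hu (hH.mul hΦ) hL, pdMat_mul hU hu hH hΦ, hHA u hu p, hLC u hu p,
    pdMat_eq_covDeriv (A := A) (C := C)]
  simp only [Matrix.mul_add, Matrix.add_mul, Matrix.neg_mul, Matrix.mul_neg, Matrix.mul_assoc]
  abel

/-- The Ricci identity. -/
theorem pdMat_covDeriv_sub (hU : IsOpen U) (hu : u ∈ U) (hA : ∀ p, MatSmooth U (A p))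
    (hC : ∀ p, MatSmooth U (C p)) (hΦ : MatSmooth U Φ) (p q : Fin 8) :
    (pdMat p (covDeriv A C Φ q) u - A p u * covDeriv A C Φ q u -
        covDeriv A C Φ q u * (C p u).transpose) -
      (pdMat q (covDeriv A C Φ p) u - A q u * covDeriv A C Φ p u -
        covDeriv A C Φ p u * (C q u).transpose) =
    -(curvMat A p q u * Φ u + Φ u * (curvMat C p q u).transpose) := by
  have h : ∀ p q, pdMat p (covDeriv A C Φ q) u = pdMat p (pdMat q Φ) u -
      (pdMat p (A q) u * Φ u + A q u * pdMat p Φ u) -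
      (pdMat p Φ u * (C q u).transpose + Φ u * (pdMat p (C q) u).transpose) := by
    intro p q
    have h1 := hΦ.pdMat hU q
    have h2 := (hA q).mul hΦ
    have h3 := hΦ.mul (hC q).transpose
    change pdMat p (fun u => pdMat q Φ u - A q u * Φ u - Φ u * (C q u).transpose) u = _
    rw [pdMat_sub hU hu (h1.sub h2) h3, pdMat_sub hU hu h1 h2, pdMat_mul hU hu (hA q) hΦ,
      pdMat_mul hU hu hΦ (hC q).transpose, pdMat_transpose]
  rw [h, h, pdMat_comm hU hu hΦ p q]
  simp only [covDeriv, curvMat, Matrix.mul_sub, Matrix.sub_mul, Matrix.transpose_sub,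
    Matrix.transpose_mul, Matrix.mul_assoc]
  abel

/-- The matrices `Z a` are contractions of `Φ` with `∇_a Φ`. By hypothesis `∑ a, Z a p a` and `∑ a,
Z a a p` vanish on all of `U`, hence so do their divergences. Each divergence consists of a product
of first derivatives and of `Φ` times a second derivative; in the difference the second derivatives
form a commutator, which is curvature. The identity is pointwise, with no integration by parts. -/
theorem weitzenboeck (hU : IsOpen U) (hu : u ∈ U) (hA : ∀ p, MatSmooth U (A p))
    (hC : ∀ p, MatSmooth U (C p)) (hH : MatSmooth U H) (hL : MatSmooth U L)
    (hΦ : MatSmooth U Φ) (hHA : IsMetricConn U H A) (hLC : IsMetricConn U L C)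
    (hsymm : ∀ p i j, A p u i j = A i u p j)
    (hV : ∀ v ∈ U, ∀ p, ∑ a, (H v * Φ v * L v * (covDeriv A C Φ a v).transpose * H v) p a = 0)
    (hW : ∀ v ∈ U, ∀ p, ∑ a, (H v * Φ v * L v * (covDeriv A C Φ a v).transpose * H v) a p = 0) :
    ∑ p, ∑ a, (H u * covDeriv A C Φ p u * L u * (covDeriv A C Φ a u).transpose * H u) p a -
      ∑ p, ∑ a, (H u * covDeriv A C Φ p u * L u * (covDeriv A C Φ a u).transpose * H u) a p =
    ∑ p, ∑ a, (H u * Φ u * L u *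
      (curvMat A p a u * Φ u + Φ u * (curvMat C p a u).transpose).transpose * H u) p a := by
  set N := covDeriv A C Φ with hN
  set Ψ : R8 → Matrix (Fin 8) n ℝ := fun v => H v * Φ v * L v with hΨ
  set Z : Fin 8 → R8 → Matrix (Fin 8) (Fin 8) ℝ := fun a v => Ψ v * (N a v).transpose * H v with hZ
  -- The connection term for the derivative index `a` is omitted here; it is symmetric in `p` and
  -- `a` for a torsion-free connection and would cancel in `Y p a - Y a p`.
  set Y : Fin 8 → Fin 8 → Matrix (Fin 8) n ℝ := fun p a =>
    pdMat p (N a) u - A p u * N a u - N a u * (C p u).transpose with hY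
  have sN : ∀ a, MatSmooth U (N a) := fun a => MatSmooth.covDeriv hU hA hC hΦ a
  have sΨ : MatSmooth U Ψ := (hH.mul hΦ).mul hL
  have sZ : ∀ a, MatSmooth U (Z a) := fun a => (sΨ.mul (sN a).transpose).mul hH
  have dZ : ∀ p a, pdMat p (Z a) u = H u * N p u * L u * (N a u).transpose * H u -
      (A p u).transpose * Z a u - Z a u * A p u + Ψ u * (Y p a).transpose * H u := by
    intro p a
    simp only [hZ]
    rw [pdMat_mul hU hu (sΨ.mul (sN a).transpose) hH, pdMat_mul hU hu sΨ (sN a).transpose,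
      pdMat_raise hU hu hH hL hΦ hHA hLC, hHA u hu p, pdMat_transpose]
    simp only [hY, hΨ, Matrix.mul_add, Matrix.add_mul, Matrix.mul_sub, Matrix.sub_mul,
      Matrix.mul_neg, Matrix.mul_assoc, Matrix.transpose_sub, Matrix.transpose_mul,
      Matrix.transpose_transpose, ← hN]
    abel
  have e1 : ∑ p, ∑ a, pdMat p (Z a) u p a = 0 := Finset.sum_eq_zero fun p _ => by
    simp only [pdMat_apply]
    rw [← pd_sum fun a => (sZ a).differentiableAt hU hu p a]
    exact pd_eq_zero hU (fun v hv => hV v hv p) hu p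
  have e2 : ∑ p, ∑ a, pdMat p (Z a) u a p = 0 := Finset.sum_eq_zero fun p _ => by
    simp only [pdMat_apply]
    rw [← pd_sum fun a => (sZ a).differentiableAt hU hu a p]
    exact pd_eq_zero hU (fun v hv => hW v hv p) hu p
  have t1 : ∑ p, ∑ a, ((A p u).transpose * Z a u) p a = 0 := Finset.sum_eq_zero fun p _ => by
    simp only [Matrix.mul_apply (M := (A p u).transpose)]
    rw [Finset.sum_comm]
    refine Finset.sum_eq_zero fun s _ => ?_
    rw [← Finset.mul_sum]
    simp only [hZ, hΨ]
    rw [hV u hu s, mul_zero]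
  have t2 : ∑ p, ∑ a, (Z a u * A p u) a p = 0 := Finset.sum_eq_zero fun p _ => by
    simp only [Matrix.mul_apply (N := A p u)]
    rw [Finset.sum_comm]
    refine Finset.sum_eq_zero fun s _ => ?_
    rw [← Finset.sum_mul]
    simp only [hZ, hΨ]
    rw [hW u hu s, zero_mul]
  -- Of the four connection terms, two vanish by `hV` and `hW`; the other two agree because the
  -- connection is torsion-free.
  have t3 : ∑ p, ∑ a, (Z a u * A p u) p a = ∑ p, ∑ a, ((A p u).transpose * Z a u) a p := by
    simp only [Matrix.mul_apply (N := A _ u), Matrix.mul_apply (M := (A _ u).transpose)]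
    rw [Finset.sum_comm]
    conv_rhs => rw [Finset.sum_comm]
    refine Finset.sum_congr rfl fun a _ => ?_
    rw [Finset.sum_comm]
    refine Finset.sum_congr rfl fun s _ => Finset.sum_congr rfl fun p _ => ?_
    rw [Matrix.transpose_apply, hsymm, mul_comm]
  have t4 : ∑ p, ∑ a, (Ψ u * (Y p a).transpose * H u) p a -
      ∑ p, ∑ a, (Ψ u * (Y p a).transpose * H u) a p = -∑ p, ∑ a, (Ψ u *
      (curvMat A p a u * Φ u + Φ u * (curvMat C p a u).transpose).transpose * H u) p a := by
    have hswap : ∑ p, ∑ a, (Ψ u * (Y p a).transpose * H u) a p =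
      ∑ p, ∑ a, (Ψ u * (Y a p).transpose * H u) p a := Finset.sum_comm
    rw [hswap]
    simp only [← Finset.sum_sub_distrib, ← Finset.sum_neg_distrib]
    refine Finset.sum_congr rfl fun p _ => Finset.sum_congr rfl fun a _ => ?_
    have h : Y p a - Y a p = _ := pdMat_covDeriv_sub hU hu hA hC hΦ p a
    rw [← Matrix.sub_apply, ← Matrix.sub_mul, ← Matrix.mul_sub, ← Matrix.transpose_sub, h,
      Matrix.transpose_neg, Matrix.mul_neg, Matrix.neg_mul, Matrix.neg_apply]
  simp only [dZ, Matrix.add_apply, Matrix.sub_apply, Finset.sum_add_distrib,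
    Finset.sum_sub_distrib] at e1 e2
  linarith

end Weitzenboeck

/-! ### Change of frame -/

section Pull

variable {T : Fin 8 → Fin 8 → Fin 8 → Fin 8 → ℝ}

/-- The third tensor power of a matrix. -/
def cube (P : Matrix (Fin 8) (Fin 8) ℝ) : Matrix Triple Triple ℝ :=
  Matrix.kronecker P (Matrix.kronecker P P)

theorem cube_mul (P Q : Matrix (Fin 8) (Fin 8) ℝ) : cube (P * Q) = cube P * cube Q := by
  simp [cube, Matrix.kronecker, Matrix.mul_kronecker_mul]

theorem cube_one : cube 1 = 1 := by
  simp [cube, Matrix.kronecker]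

theorem cube_transpose (P : Matrix (Fin 8) (Fin 8) ℝ) : cube P.transpose = (cube P).transpose := rfl

/-- The array `T` in the frame given by the rows of `P`. -/
def pull (P : Matrix (Fin 8) (Fin 8) ℝ) (T : Fin 8 → Fin 8 → Fin 8 → Fin 8 → ℝ)
    (i j k l : Fin 8) : ℝ := contract₄ T (P i) (P j) (P k) (P l)

/-- An array with four indices, as a matrix with rows and columns indexed by pairs. -/
def toMat₂ (T : Fin 8 → Fin 8 → Fin 8 → Fin 8 → ℝ) :
    Matrix (Fin 8 × Fin 8) (Fin 8 × Fin 8) ℝ := Matrix.of fun I J => T I.1 I.2 J.1 J.2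

@[simp] theorem toMat₂_apply (T : Fin 8 → Fin 8 → Fin 8 → Fin 8 → ℝ) (I J : Fin 8 × Fin 8) :
    toMat₂ T I J = T I.1 I.2 J.1 J.2 := rfl

theorem toMat_pull (P : Matrix (Fin 8) (Fin 8) ℝ) :
    toMat (pull P T) = P * toMat T * (cube P).transpose := by
  ext i ⟨j, k, l⟩
  simp only [toMat_apply, pull, contract₄, Matrix.mul_apply, Fintype.sum_prod_type, cube,
    Matrix.transpose_apply, Matrix.kronecker, Matrix.kroneckerMap_apply, Finset.sum_mul]
  rw [Finset.sum_comm]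
  refine Finset.sum_congr rfl fun b _ => ?_
  rw [Finset.sum_comm]
  refine Finset.sum_congr rfl fun c _ => ?_
  rw [Finset.sum_comm]
  refine Finset.sum_congr rfl fun d _ => Finset.sum_congr rfl fun a _ => ?_
  ring

theorem toMat₂_pull (P : Matrix (Fin 8) (Fin 8) ℝ) : toMat₂ (pull P T) =
    Matrix.kronecker P P * toMat₂ T * (Matrix.kronecker P P).transpose := by
  ext ⟨i, j⟩ ⟨k, l⟩
  simp only [toMat₂_apply, pull, contract₄, Matrix.mul_apply, Fintype.sum_prod_type,
    Matrix.transpose_apply, Matrix.kronecker, Matrix.kroneckerMap_apply, Finset.sum_mul]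
  have : ∀ f : Fin 8 → Fin 8 → Fin 8 → Fin 8 → ℝ, ∑ a, ∑ b, ∑ c, ∑ d, f a b c d =
      ∑ c, ∑ d, ∑ a, ∑ b, f a b c d := by
    intro f
    have h1 : ∀ a, ∑ b, ∑ c, ∑ d, f a b c d = ∑ c, ∑ d, ∑ b, f a b c d := fun a => by
      rw [Finset.sum_comm]
      exact Finset.sum_congr rfl fun c _ => Finset.sum_comm
    simp only [h1]
    rw [Finset.sum_comm]
    exact Finset.sum_congr rfl fun c _ => Finset.sum_comm
  rw [this]
  refine Finset.sum_congr rfl fun c _ => Finset.sum_congr rfl fun d _ =>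
    Finset.sum_congr rfl fun a _ => Finset.sum_congr rfl fun b _ => ?_
  ring

theorem Alt4.pull (hT : Alt4 T) (P : Matrix (Fin 8) (Fin 8) ℝ) : Alt4 (pull P T) where
  swap₁ i j k l := contract₄_swap₁ hT _ _ _ _
  swap₂ i j k l := by
    simp only [Spin7.pull, contract₄, ← Finset.sum_neg_distrib]
    refine Finset.sum_congr rfl fun a _ => ?_
    rw [Finset.sum_comm]
    refine Finset.sum_congr rfl fun b _ => Finset.sum_congr rfl fun c _ =>
      Finset.sum_congr rfl fun d _ => ?_
    rw [hT.swap₂]; ring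
  swap₃ i j k l := by
    simp only [Spin7.pull, contract₄, ← Finset.sum_neg_distrib]
    refine Finset.sum_congr rfl fun a _ => Finset.sum_congr rfl fun b _ => ?_
    rw [Finset.sum_comm]
    refine Finset.sum_congr rfl fun c _ => Finset.sum_congr rfl fun d _ => ?_
    rw [hT.swap₃]; ring

end Pull

/-! ### Contractions of the model form with itself, in matrix form. -/

theorem cayleyMat_mul_transpose :
    cayleyMat * cayleyMat.transpose = (42 : ℝ) • (1 : Matrix (Fin 8) (Fin 8) ℝ) := by
  ext a b
  simp only [Matrix.mul_apply, Fintype.sum_prod_type, cayleyMat, toMat_apply,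
    Matrix.transpose_apply]
  -- One further trace of `sum_cayley_mul`; the resulting constant is `42 = 6 * (8 - 1)`.
  have h : ∀ x, ∑ y, ∑ z, (cayley a x y z : ℝ) * cayley b x y z =
      6 * ((if a = b then 1 else 0) - (if a = x then 1 else 0) * (if x = b then 1 else 0)) := by
    intro x
    have h1 := congrArg (Int.cast : ℤ → ℝ) (sum_cayley_mul a x b x)
    have h2 : (cayley a x b x : ℝ) = 0 := by
      linarith [alt4_cayley.swap₂₄ a x b x]
    push_cast at h1
    rw [h1, h2]; simp
  simp only [h]
  by_cases hab : a = b
  · subst hab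
    simp [Finset.sum_sub_distrib, ← Finset.mul_sum]
    norm_num
  · have : ∀ x, ¬ (a = x ∧ x = b) := fun x hx => hab (hx.1.trans hx.2)
    simp [hab]

/-- Exchange of the two indices of a pair. -/
def swapMat : Matrix (Fin 8 × Fin 8) (Fin 8 × Fin 8) ℝ :=
  Matrix.of fun I J => if I.1 = J.2 ∧ I.2 = J.1 then 1 else 0

theorem toMat₂_cayley_mul_transpose :
    toMat₂ (fun i j k l => (cayley i j k l : ℝ)) *
      (toMat₂ fun i j k l => (cayley i j k l : ℝ)).transpose =
    (6 : ℝ) • (1 - swapMat) - (4 : ℝ) • toMat₂ fun i j k l => (cayley i j k l : ℝ) := by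
  ext ⟨i, j⟩ ⟨k, l⟩
  have := congrArg (Int.cast : ℤ → ℝ) (sum_cayley_mul i j k l)
  push_cast at this
  simp only [Matrix.mul_apply, Fintype.sum_prod_type, toMat₂_apply, Matrix.transpose_apply,
    this, swapMat, Matrix.sub_apply, Matrix.smul_apply, Matrix.of_apply, Matrix.one_apply,
    Prod.mk.injEq, smul_eq_mul, ite_and]
  split_ifs <;> simp

theorem swapMat_mul_kronecker (P : Matrix (Fin 8) (Fin 8) ℝ) :
    swapMat * Matrix.kronecker P P = Matrix.kronecker P P * swapMat := by
  ext ⟨i, j⟩ ⟨k, l⟩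
  simp [Matrix.mul_apply, Fintype.sum_prod_type, swapMat, ite_and, Matrix.kronecker,
    Matrix.kroneckerMap_apply, mul_comm]

/-! ### Metric, connection and fundamental form as matrices -/

/-- The Gram matrix of a metric. -/
def gMat (g : Comp2) (u : R8) : Matrix (Fin 8) (Fin 8) ℝ := Matrix.of fun i j => g i j u

/-- The inverse Gram matrix. -/
def hMat (g : Comp2) (u : R8) : Matrix (Fin 8) (Fin 8) ℝ := (gMat g u)⁻¹

/-- A linear connection on the cotangent bundle. -/
def connMat (A : Comp3) (p : Fin 8) (u : R8) : Matrix (Fin 8) (Fin 8) ℝ :=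
  Matrix.of fun b s => A s p b u

/-- The third tensor power of a connection. -/
def cubeConn (A : Matrix (Fin 8) (Fin 8) ℝ) : Matrix Triple Triple ℝ :=
  tensorConn A (tensorConn A A)

/-- A 4-tensor as a matrix. -/
def fMat (φ : Comp4) (u : R8) : Matrix (Fin 8) Triple ℝ := toMat fun i j k l => φ i j k l u

/-- The Levi-Civita covariant derivative of a 4-tensor as a matrix. -/
def nMat (g : Comp2) (φ : Comp4) (p : Fin 8) (u : R8) : Matrix (Fin 8) Triple ℝ :=
  toMat fun i j k l => nablaForm g φ p i j k l u

/-- The four connection terms of `nablaForm` become one left and one right multiplication, to which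
the matrix form of the Weitzenböck formula applies. -/
theorem nMat_eq_covDeriv (g : Comp2) (φ : Comp4) :
    nMat g φ = covDeriv (connMat (christoffel g)) (fun p u => cubeConn (connMat (christoffel g) p u))
      (fMat φ) := by
  funext p u
  ext i ⟨j, k, l⟩
  simp only [nMat, toMat_apply, nablaForm, covDeriv, Matrix.sub_apply, pdMat_apply, fMat,
    Matrix.mul_apply, connMat, cubeConn, tensorConn, Matrix.transpose_apply, Matrix.of_apply,
    Matrix.add_apply, Matrix.kronecker, Matrix.kroneckerMap_apply, Fintype.sum_prod_type,
    Matrix.one_apply, mul_add, Finset.sum_add_distrib, mul_ite, ite_mul, mul_one,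
    mul_zero, one_mul, zero_mul, Finset.sum_ite_eq, Finset.mem_univ, if_true, Finset.sum_const_zero,
    Finset.sum_ite_irrel]
  simp only [mul_comm (φ _ _ _ _ _)]
  ring

/-- `connMat` transposes the connection coefficients, which reverses commutators; this accounts for
the minus sign in `curvMat`. -/
theorem curvMat_connMat (A : Comp3) (p a b s : Fin 8) (u : R8) :
    curvMat (connMat A) p a u b s = curvature A s p a b u := by
  simp only [curvMat, curvature, connMat, Matrix.sub_apply, pdMat_apply, Matrix.of_apply,
    Matrix.mul_apply, Finset.sum_sub_distrib]
  ring

theorem MatSmooth.cubeConn {U : Set R8} {A : R8 → Matrix (Fin 8) (Fin 8) ℝ} (hA : MatSmooth U A) :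
    MatSmooth U fun u => cubeConn (A u) := hA.tensorConn (hA.tensorConn hA)

theorem MatSmooth.cube {U : Set R8} {A : R8 → Matrix (Fin 8) (Fin 8) ℝ} (hA : MatSmooth U A) :
    MatSmooth U fun u => cube (A u) := hA.kronecker (hA.kronecker hA)

namespace LocalSpin7

variable {U : Set R8} {g : Comp2} {φ : Comp4} {u : R8}

theorem exists_frame (h : LocalSpin7 U g φ) (hu : u ∈ U) : ∃ P E : Matrix (Fin 8) (Fin 8) ℝ,
    P * E = 1 ∧ E * P = 1 ∧ gMat g u = P * P.transpose ∧ hMat g u = E.transpose * E ∧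
    (fun i j k l => φ i j k l u) = pull P (fun i j k l => (cayley i j k l : ℝ)) := by
  obtain ⟨P, hP, hg, hφ⟩ := h.frame u hu
  have h1 := Matrix.mul_nonsing_inv P hP
  have h2 := Matrix.nonsing_inv_mul P hP
  have hG : gMat g u = P * P.transpose := by
    ext i j
    simp [gMat, hg, Matrix.mul_apply]
  refine ⟨P, P⁻¹, h1, h2, hG, ?_, ?_⟩
  · rw [hMat, hG]
    apply Matrix.inv_eq_right_inv
    rw [Matrix.mul_assoc, ← Matrix.mul_assoc P.transpose, ← Matrix.transpose_mul, h2,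
      Matrix.transpose_one, Matrix.one_mul, h1]
  · funext i j k l
    rw [hφ]; rfl

theorem alt4 (h : LocalSpin7 U g φ) (hu : u ∈ U) : Alt4 fun i j k l => φ i j k l u := by
  obtain ⟨P, E, -, -, -, -, hφ⟩ := h.exists_frame hu
  rw [hφ]
  exact alt4_cayley.pull P

theorem fMat_eq {P : Matrix (Fin 8) (Fin 8) ℝ}
    (hφ : (fun i j k l => φ i j k l u) = pull P (fun i j k l => (cayley i j k l : ℝ))) :
    fMat φ u = P * cayleyMat * (cube P).transpose := by
  rw [fMat, hφ, toMat_pull, cayleyMat]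

theorem metric_symm (h : LocalSpin7 U g φ) (hu : u ∈ U) (i j : Fin 8) : g i j u = g j i u := by
  obtain ⟨P, -, hg, -⟩ := h.frame u hu
  rw [hg, hg]
  exact Finset.sum_congr rfl fun a _ => mul_comm _ _

theorem gMat_mul_hMat (h : LocalSpin7 U g φ) (hu : u ∈ U) : gMat g u * hMat g u = 1 := by
  obtain ⟨P, E, hPE, hEP, hG, hH, -⟩ := h.exists_frame hu
  rw [hG, hH, Matrix.mul_assoc, ← Matrix.mul_assoc P.transpose, ← Matrix.transpose_mul, hEP,
    Matrix.transpose_one, Matrix.one_mul, hPE]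

theorem hMat_mul_gMat (h : LocalSpin7 U g φ) (hu : u ∈ U) : hMat g u * gMat g u = 1 :=
  mul_eq_one_comm.1 (h.gMat_mul_hMat hu)

theorem gMat_transpose (h : LocalSpin7 U g φ) (hu : u ∈ U) :
    (gMat g u).transpose = gMat g u := by
  ext i j; exact h.metric_symm hu j i

theorem hMat_transpose (h : LocalSpin7 U g φ) (hu : u ∈ U) :
    (hMat g u).transpose = hMat g u := by
  obtain ⟨P, E, -, -, -, hH, -⟩ := h.exists_frame hu
  rw [hH, Matrix.transpose_mul, Matrix.transpose_transpose]

theorem smooth_gMat (h : LocalSpin7 U g φ) : MatSmooth U (gMat g) := h.metric_smooth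

theorem smooth_hMat (h : LocalSpin7 U g φ) : MatSmooth U (hMat g) :=
  h.smooth_gMat.inv fun _ hu => (Matrix.isUnit_iff_isUnit_det _).1
    (IsUnit.of_mul_eq_one _ (h.gMat_mul_hMat hu))

theorem smooth_fMat (h : LocalSpin7 U g φ) : MatSmooth U (fMat φ) :=
  fun _ _ => h.form_smooth _ _ _ _

theorem smooth_connMat (h : LocalSpin7 U g φ) (p : Fin 8) :
    MatSmooth U (connMat (christoffel g) p) := fun i j => by
  have hp := fun p i j => contDiffOn_pd h.isOpen (h.metric_smooth i j) p
  exact contDiffOn_const.mul (ContDiffOn.sum fun l _ =>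
    (h.smooth_hMat j l).mul (((hp p i l).add (hp i p l)).sub (hp l p i)))

theorem smooth_nMat (h : LocalSpin7 U g φ) (p : Fin 8) : MatSmooth U (nMat g φ p) := by
  rw [nMat_eq_covDeriv]
  exact MatSmooth.covDeriv h.isOpen h.smooth_connMat (fun p => (h.smooth_connMat p).cubeConn)
    h.smooth_fMat p

theorem pd_metric_symm (h : LocalSpin7 U g φ) (hu : u ∈ U) (p i j : Fin 8) :
    pd p (g i j) u = pd p (g j i) u :=
  pd_congr h.isOpen (fun _ hv => h.metric_symm hv i j) hu p

theorem christoffel_symm (h : LocalSpin7 U g φ) (hu : u ∈ U) (k i j : Fin 8) :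
    christoffel g k i j u = christoffel g k j i u := by
  simp only [christoffel]
  congr 1
  refine Finset.sum_congr rfl fun l _ => ?_
  rw [h.pd_metric_symm hu l i j]
  ring

/-- In the Christoffel symbols with lowered index, the part symmetric in the last two indices is
half the derivative of the metric. -/
theorem pdMat_gMat (h : LocalSpin7 U g φ) (hu : u ∈ U) (p : Fin 8) : pdMat p (gMat g) u =
    connMat (christoffel g) p u * gMat g u +
      gMat g u * (connMat (christoffel g) p u).transpose := by
  have key : connMat (christoffel g) p u = (Matrix.of fun i l => (1 / 2 : ℝ) *
      (pd p (g i l) u + pd i (g p l) u - pd l (g p i) u)) * hMat g u := by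
    ext i k
    simp only [connMat, christoffel, Matrix.of_apply, Matrix.mul_apply, Finset.mul_sum]
    refine Finset.sum_congr rfl fun l _ => ?_
    have h1 : invMetric g k l u = hMat g u l k := by
      rw [← Matrix.transpose_apply (hMat g u), h.hMat_transpose hu]; rfl
    rw [h1]; ring
  have h2 : gMat g u * (connMat (christoffel g) p u).transpose =
      (connMat (christoffel g) p u * gMat g u).transpose := by
    rw [Matrix.transpose_mul, h.gMat_transpose hu]
  rw [h2, key, Matrix.mul_assoc, h.hMat_mul_gMat hu, Matrix.mul_one]
  ext i j
  simp only [pdMat_apply, gMat, Matrix.of_apply, Matrix.add_apply, Matrix.transpose_apply]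
  rw [h.pd_metric_symm hu p j i]
  change pd p (g i j) u = _
  ring

/-- Obtained by differentiating `hMat g * gMat g = 1` and inserting the compatibility with the
metric. -/
theorem isMetricConn (h : LocalSpin7 U g φ) :
    IsMetricConn U (hMat g) (connMat (christoffel g)) := by
  intro u hu p
  have h1 : pdMat p (fun v => hMat g v * gMat g v) u = 0 := by
    rw [pdMat_congr h.isOpen hu (B := fun _ => 1) (fun v hv => h.hMat_mul_gMat hv), pdMat_const]
  rw [pdMat_mul h.isOpen hu h.smooth_hMat h.smooth_gMat, h.pdMat_gMat hu] at h1
  have h2 := congrArg (· * hMat g u) h1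
  simp only [Matrix.add_mul, Matrix.mul_add, Matrix.mul_assoc, h.gMat_mul_hMat hu, Matrix.mul_one,
    Matrix.zero_mul] at h2
  rw [← Matrix.mul_assoc (hMat g u) (gMat g u), h.hMat_mul_gMat hu, Matrix.one_mul] at h2
  rw [eq_neg_of_add_eq_zero_left h2, add_comm]

theorem isMetricConn_cube (h : LocalSpin7 U g φ) : IsMetricConn U (fun u => cube (hMat g u))
    fun p u => cubeConn (connMat (christoffel g) p u) :=
  h.isMetricConn.tensor h.isOpen h.smooth_hMat (h.smooth_hMat.kronecker h.smooth_hMat)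
    (h.isMetricConn.tensor h.isOpen h.smooth_hMat h.smooth_hMat h.isMetricConn)

theorem nablaForm_alt4 (h : LocalSpin7 U g φ) (hu : u ∈ U) (p : Fin 8) :
    Alt4 fun i j k l => nablaForm g φ p i j k l u := by
  have hφ := fun v hv => h.alt4 (u := v) hv
  refine ⟨fun i j k l => ?_, fun i j k l => ?_, fun i j k l => ?_⟩
  · have := pd_congr h.isOpen (fun v hv => (hφ v hv).swap₁ i j k l) hu p
    simp only [nablaForm, this, pd_neg, Finset.sum_add_distrib]
    simp only [(hφ u hu).swap₁ j i, (hφ u hu).swap₁ j _, (hφ u hu).swap₁ _ i,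
      mul_neg, Finset.sum_neg_distrib]
    ring
  · have := pd_congr h.isOpen (fun v hv => (hφ v hv).swap₂ i j k l) hu p
    simp only [nablaForm, this, pd_neg, Finset.sum_add_distrib]
    simp only [(hφ u hu).swap₂ _ k j, (hφ u hu).swap₂ _ k _, (hφ u hu).swap₂ _ _ j,
      mul_neg, Finset.sum_neg_distrib]
    ring
  · have := pd_congr h.isOpen (fun v hv => (hφ v hv).swap₃ i j k l) hu p
    simp only [nablaForm, this, pd_neg, Finset.sum_add_distrib]
    simp only [(hφ u hu).swap₃ _ _ l k, (hφ u hu).swap₃ _ _ l _, (hφ u hu).swap₃ _ _ _ k,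
      mul_neg, Finset.sum_neg_distrib]
    ring

/-- The codifferential as a row of components. -/
theorem codiff_eq (k l m : Fin 8) :
    codiff g φ k l m u = -∑ p, (hMat g u * nMat g φ p u) p (k, l, m) := by
  simp only [codiff, Matrix.mul_apply]; rfl

end LocalSpin7

/-! ### The covariant derivative of the fundamental form lies in `Λ⁴₇` -/

/-- The function `f` is stationary at `u` in the direction of the `p`-th coordinate. -/
def Stationary (p : Fin 8) (u : R8) (f : R8 → ℝ) : Prop :=
  DifferentiableAt ℝ f u ∧ pd p f u = 0

namespace Stationary

variable {p : Fin 8} {u : R8} {f f' : R8 → ℝ}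

theorem add (hf : Stationary p u f) (hf' : Stationary p u f') :
    Stationary p u fun v => f v + f' v :=
  ⟨hf.1.add hf'.1, by rw [pd_add hf.1 hf'.1, hf.2, hf'.2, add_zero]⟩

theorem sub (hf : Stationary p u f) (hf' : Stationary p u f') :
    Stationary p u fun v => f v - f' v :=
  ⟨hf.1.sub hf'.1, by rw [pd_sub hf.1 hf'.1, hf.2, hf'.2, sub_zero]⟩

theorem mul (hf : Stationary p u f) (hf' : Stationary p u f') :
    Stationary p u fun v => f v * f' v :=
  ⟨hf.1.mul hf'.1, by rw [pd_mul hf.1 hf'.1, hf.2, hf'.2]; simp⟩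

end Stationary

theorem contract₃_cayley_eq (Q : Matrix (Fin 8) (Fin 8) ℝ) (s i j k : Fin 8) :
    (cayleyMat * (cube Q).transpose) s (i, j, k) =
      -contract₃ (fun i j k l => (cayley i j k l : ℝ)) (Q i) (Q j) (Q k) s := by
  simp only [Matrix.mul_apply, Fintype.sum_prod_type, contract₃, cayleyMat, toMat_apply, cube,
    Matrix.transpose_apply, Matrix.kronecker, Matrix.kroneckerMap_apply, ← Finset.sum_neg_distrib]
  refine Finset.sum_congr rfl fun a _ => Finset.sum_congr rfl fun b _ =>
    Finset.sum_congr rfl fun c _ => ?_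
  have h : (cayley s a b c : ℝ) = - cayley a b c s := by
    rw [alt4_cayley.swap₁ s a b c, alt4_cayley.swap₂ a s b c, alt4_cayley.swap₃ a b s c]
    ring
  rw [h]; ring

/-- The point is that the right side depends on the frame `Q` only through its Gram matrix, so it is
stationary wherever that Gram matrix is. -/
theorem cayleyMat_gram (Q : Matrix (Fin 8) (Fin 8) ℝ) (i j k l : Fin 8) :
    ((cayleyMat * (cube Q).transpose).transpose * (cayleyMat * (cube Q).transpose))
      (i, j, k) (i, j, l) =
    (fun G : Matrix (Fin 8) (Fin 8) ℝ => (G i i * G j j - G i j * G i j) * G k l -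
      G j j * G i k * G i l - G i i * G j k * G j l +
      G i j * (G i k * G j l + G j k * G i l)) (Q * Q.transpose) := by
  have h := contract₃_dotProduct (Q i) (Q j) (Q k) (Q l)
  rw [Matrix.mul_apply]
  simp only [Matrix.transpose_apply, contract₃_cayley_eq, neg_mul_neg]
  refine h.trans ?_
  have hd : ∀ a b, Q a ⬝ᵥ Q b = (Q * Q.transpose) a b := fun a b => rfl
  simp only [hd]
  ring

/-! ### Frames that are parallel to first order in one coordinate direction. -/

section Shift

variable {U : Set R8} {u : R8}

/-- A matrix depending linearly on the `p`-th coordinate. -/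
def shift (p : Fin 8) (u : R8) (E B : Matrix (Fin 8) (Fin 8) ℝ) (v : R8) :
    Matrix (Fin 8) (Fin 8) ℝ := E + (v p - u p) • B

theorem shift_self (p : Fin 8) (E B : Matrix (Fin 8) (Fin 8) ℝ) : shift p u E B u = E := by
  simp [shift]

theorem smooth_shift (p : Fin 8) (E B : Matrix (Fin 8) (Fin 8) ℝ) :
    MatSmooth U (shift p u E B) := fun i j =>
  (contDiffOn_const.add ((((EuclideanSpace.proj (𝕜 := ℝ) p).contDiff.contDiffOn).sub
    contDiffOn_const).mul contDiffOn_const) : ContDiffOn ℝ ∞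
      (fun v : R8 => E i j + (EuclideanSpace.proj (𝕜 := ℝ) p v - u p) * B i j) U)

theorem pdMat_shift (p : Fin 8) (E B : Matrix (Fin 8) (Fin 8) ℝ) :
    pdMat p (shift p u E B) u = B := by
  ext i j
  have h : HasFDerivAt (fun v : R8 => E i j + (EuclideanSpace.proj (𝕜 := ℝ) p v - u p) * B i j)
      (B i j • (EuclideanSpace.proj (𝕜 := ℝ) p : R8 →L[ℝ] ℝ)) u :=
    (((EuclideanSpace.proj (𝕜 := ℝ) p).hasFDerivAt.sub_const _).mul_const _).const_add _
  change fderiv ℝ (fun v : R8 => E i j + (EuclideanSpace.proj (𝕜 := ℝ) p v - u p) * B i j) u _ = _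
  rw [h.fderiv]
  simp

theorem pdMat_cube {E : R8 → Matrix (Fin 8) (Fin 8) ℝ} {A : Matrix (Fin 8) (Fin 8) ℝ}
    (hU : IsOpen U) (hu : u ∈ U) (hE : MatSmooth U E) {p : Fin 8} (h : pdMat p E u = -(E u * A)) :
    pdMat p (fun v => cube (E v)) u = -(cube (E u) * cubeConn A) := by
  simp only [cube]
  rw [pdMat_kronecker hU hu hE (hE.kronecker hE), pdMat_kronecker hU hu hE hE, h]
  simp only [cubeConn, tensorConn, Matrix.mul_add, Matrix.kronecker, ← Matrix.mul_kronecker_mul,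
    Matrix.mul_one]
  ext i j
  simp [Matrix.kroneckerMap_apply, mul_add]
  ring

end Shift

namespace LocalSpin7

variable {U : Set R8} {g : Comp2} {φ : Comp4} {u : R8}

/-- Extend the adapted frame at `u` so that it is parallel to first order in direction `p`. The Gram
matrix of the cross products is a polynomial in the Gram matrix of the frame, which is stationary at
`u`. The product rule turns this into the linearized identity for `∇_p Φ` in the frame. -/
theorem crossTangent (h : LocalSpin7 U g φ) (hu : u ∈ U) {P E : Matrix (Fin 8) (Fin 8) ℝ}
    (hEP : E * P = 1) (hH : hMat g u = E.transpose * E)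
    (hφ : (fun i j k l => φ i j k l u) = pull P (fun i j k l => (cayley i j k l : ℝ)))
    (p : Fin 8) : CrossTangent (pull E fun i j k l => nablaForm g φ p i j k l u) := by
  set A := connMat (christoffel g) p u with hA
  -- The slope `-(E * A)` makes the frame parallel in direction `p` at `u`. It need not be adapted
  -- to `Φ` at other points.
  set F := shift p u E (-(E * A)) with hF
  have hU := h.isOpen
  have sF : MatSmooth U F := smooth_shift p E _
  have dF : pdMat p F u = -(F u * A) := by rw [hF, pdMat_shift, shift_self]
  have Fu : F u = E := shift_self _ _ _
  set Gh : R8 → Matrix (Fin 8) (Fin 8) ℝ := fun v => F v * gMat g v * (F v).transpose with hGh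
  have dG : pdMat p Gh u = 0 := by
    simp only [hGh]
    rw [pdMat_mul hU hu (sF.mul h.smooth_gMat) sF.transpose, pdMat_mul hU hu sF h.smooth_gMat,
      pdMat_transpose, dF, h.pdMat_gMat hu, ← hA]
    simp only [Matrix.transpose_neg, Matrix.transpose_mul, Matrix.mul_add, Matrix.add_mul,
      Matrix.neg_mul, Matrix.mul_neg, Matrix.mul_assoc]
    abel
  have sG : MatSmooth U Gh := (sF.mul h.smooth_gMat).mul sF.transpose
  have zG : ∀ i j, Stationary p u fun v => Gh v i j := fun i j =>
    ⟨sG.differentiableAt hU hu i j, congrFun (congrFun dG i) j⟩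
  set M : R8 → Matrix (Fin 8) Triple ℝ := fun v => fMat φ v * (cube (F v)).transpose with hM
  have sM : MatSmooth U M := h.smooth_fMat.mul sF.cube.transpose
  -- At each nearby `v` another adapted frame `P'` exists, with no smoothness in `v` needed; the
  -- cross product identity for the rows of `F v * P'` no longer mentions `P'`.
  have hMgram : ∀ i j k l, ∀ v ∈ U, ((M v).transpose * hMat g v * M v) (i, j, k) (i, j, l) =
      (fun G : Matrix (Fin 8) (Fin 8) ℝ => (G i i * G j j - G i j * G i j) * G k l -
        G j j * G i k * G i l - G i i * G j k * G j l +
        G i j * (G i k * G j l + G j k * G i l)) (Gh v) := by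
    intro i j k l v hv
    obtain ⟨P', E', -, hEP', hG', hH', hφ'⟩ := h.exists_frame hv
    have h1 : M v = P' * (cayleyMat * (cube (F v * P')).transpose) := by
      simp only [hM]
      rw [fMat_eq hφ', cube_mul, Matrix.transpose_mul]
      simp only [Matrix.mul_assoc]
    have h2 : Gh v = (F v * P') * (F v * P').transpose := by
      simp only [hGh]
      rw [hG', Matrix.transpose_mul]
      simp only [Matrix.mul_assoc]
    rw [h2, ← cayleyMat_gram, h1, hH']
    refine congrFun (congrFun ?_ _) _
    rw [Matrix.transpose_mul]
    have h3 : P'.transpose * (E'.transpose * E') * P' = 1 := by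
      rw [← Matrix.mul_assoc, ← Matrix.transpose_mul, hEP', Matrix.transpose_one, Matrix.one_mul,
        hEP']
    calc _ = (cayleyMat * (cube (F v * P')).transpose).transpose *
          (P'.transpose * (E'.transpose * E') * P') *
          (cayleyMat * (cube (F v * P')).transpose) := by simp only [Matrix.mul_assoc]
      _ = _ := by rw [h3, Matrix.mul_one]
  have dM : pdMat p M u = nMat g φ p u * (cube E).transpose + A * M u := by
    simp only [hM]
    rw [pdMat_mul hU hu h.smooth_fMat sF.cube.transpose, pdMat_transpose,
      pdMat_cube hU hu sF dF, Fu, nMat_eq_covDeriv]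
    rw [pdMat_eq_covDeriv (A := connMat (christoffel g))
      (C := fun p u => cubeConn (connMat (christoffel g) p u)) (Φ := fMat φ)]
    simp only [Matrix.transpose_neg, Matrix.transpose_mul, Matrix.add_mul, Matrix.mul_neg,
      Matrix.mul_assoc, ← hA]
    abel
  have Mu : M u = P * cayleyMat := by
    simp only [hM]
    rw [fMat_eq hφ, Fu, Matrix.mul_assoc, ← Matrix.transpose_mul, ← cube_mul, hEP, cube_one,
      Matrix.transpose_one, Matrix.mul_one]
  have dMM : pdMat p (fun v => (M v).transpose * hMat g v * M v) u =
      (toMat (pull E fun i j k l => nablaForm g φ p i j k l u)).transpose * cayleyMat +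
        cayleyMat.transpose * toMat (pull E fun i j k l => nablaForm g φ p i j k l u) := by
    rw [pdMat_mul hU hu (sM.transpose.mul h.smooth_hMat) sM,
      pdMat_mul hU hu sM.transpose h.smooth_hMat, pdMat_transpose, dM, h.isMetricConn u hu p, ← hA]
    have e1 : hMat g u * M u = E.transpose * cayleyMat := by
      rw [Mu, hH, Matrix.mul_assoc, ← Matrix.mul_assoc E, hEP, Matrix.one_mul]
    have e2 : (M u).transpose * hMat g u = cayleyMat.transpose * E := by
      rw [← h.hMat_transpose hu, ← Matrix.transpose_mul, e1, Matrix.transpose_mul,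
        Matrix.transpose_transpose]
    rw [toMat_pull]
    change _ = (E * nMat g φ p u * (cube E).transpose).transpose * cayleyMat +
      cayleyMat.transpose * (E * nMat g φ p u * (cube E).transpose)
    simp only [Matrix.transpose_add, Matrix.transpose_mul, Matrix.add_mul, Matrix.mul_add,
      Matrix.mul_neg, Matrix.neg_mul, Matrix.mul_assoc, Matrix.transpose_transpose, e1]
    simp only [← Matrix.mul_assoc, e2]
    abel
  intro i j k l
  have z : pd p (fun v => ((M v).transpose * hMat g v * M v) (i, j, k) (i, j, l)) u = 0 := by
    rw [pd_congr hU (hMgram i j k l) hu]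
    exact ((((((zG i i).mul (zG j j)).sub ((zG i j).mul (zG i j))).mul (zG k l)).sub
      (((zG j j).mul (zG i k)).mul (zG i l))).sub (((zG i i).mul (zG j k)).mul (zG j l))).add
      ((zG i j).mul (((zG i k).mul (zG j l)).add ((zG j k).mul (zG i l)))) |>.2
  have z' := (congrFun (congrFun dMM (i, j, k)) (i, j, l)).symm.trans z
  have hD := (h.nablaForm_alt4 hu p).pull E
  set D := pull E fun i j k l => nablaForm g φ p i j k l u
  -- The contracted index sits in the first slot and has to move to the last; the signs from the two
  -- factors cancel.
  have rot : ∀ {T : Fin 8 → Fin 8 → Fin 8 → Fin 8 → ℝ}, Alt4 T → ∀ s a b c,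
      T s a b c = - T a b c s := by
    intro T hT s a b c
    rw [hT.swap₁ s a b c, hT.swap₂ a s b c, hT.swap₃ a b s c]
    ring
  have rc : ∀ s a b c, (cayley s a b c : ℝ) = -(cayley a b c s : ℝ) := rot alt4_cayley
  simp only [Matrix.add_apply, Matrix.mul_apply, Matrix.transpose_apply, toMat_apply,
    cayleyMat] at z'
  simp only [rot hD _ i j k, rot hD _ i j l, rc _ i j k, rc _ i j l, neg_mul_neg] at z'
  simp only [cayley] at z'
  simpa using z'

/-- The covariant derivative of the fundamental form in an adapted frame. -/
theorem exists_coeff (h : LocalSpin7 U g φ) (hu : u ∈ U) {P E : Matrix (Fin 8) (Fin 8) ℝ}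
    (hEP : E * P = 1) (hH : hMat g u = E.transpose * E)
    (hφ : (fun i j k l => φ i j k l u) = pull P (fun i j k l => (cayley i j k l : ℝ))) :
    ∃ c : Fin 8 → Fin 7 → ℝ, ∀ b, ∑ a, E b a • (E * nMat g φ a u * (cube E).transpose) =
      ofCoeff c b := by
  have h1 := fun p => (h.crossTangent hu hEP hH hφ p).exists_eq_sum
    ((h.nablaForm_alt4 hu p).pull E)
  choose c hc using h1
  have h2 : ∀ a, E * nMat g φ a u * (cube E).transpose = ofCoeff c a := by
    intro a
    rw [nMat, ← toMat_pull]
    ext i I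
    simp [hc, ofCoeff, lambdaMat, Matrix.sum_apply]
  -- The multiplication by `E` turns the coordinate derivative index `a` into the frame index `b`.
  refine ⟨fun b m => ∑ a, E b a * c a m, fun b => ?_⟩
  simp only [h2, ofCoeff, Finset.smul_sum, Finset.sum_smul, smul_smul]
  exact Finset.sum_comm

end LocalSpin7

/-! ### Balanced structures -/

/-- Contraction of the derivative index with a matrix index commutes with the change from
coordinates to the frame. -/
theorem sum_conj_apply (E : Matrix (Fin 8) (Fin 8) ℝ) (K : Fin 8 → Matrix (Fin 8) (Fin 8) ℝ)
    (p : Fin 8) : ∑ a, (E.transpose * K a * E) p a =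
      ∑ b, E b p * ∑ c, (∑ a, E c a • K a) b c := by
  simp only [Matrix.mul_apply, Matrix.transpose_apply, Matrix.sum_apply, Matrix.smul_apply,
    smul_eq_mul, Finset.mul_sum, Finset.sum_mul]
  rw [Finset.sum_comm]
  conv_rhs => rw [Finset.sum_comm]
  refine Finset.sum_congr rfl fun c _ => ?_
  rw [Finset.sum_comm]
  exact Finset.sum_congr rfl fun b _ => Finset.sum_congr rfl fun a _ => by ring

theorem sum_sum_conj_apply (E : Matrix (Fin 8) (Fin 8) ℝ)
    (K : Fin 8 → Fin 8 → Matrix (Fin 8) (Fin 8) ℝ) :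
    ∑ p, ∑ a, (E.transpose * K p a * E) p a =
      ∑ b, ∑ c, (∑ p, ∑ a, (E b p * E c a) • K p a) b c := by
  simp only [sum_conj_apply]
  rw [Finset.sum_comm]
  refine Finset.sum_congr rfl fun b _ => ?_
  simp only [Finset.mul_sum]
  rw [Finset.sum_comm]
  refine Finset.sum_congr rfl fun c _ => ?_
  simp only [Matrix.sum_apply, Matrix.smul_apply, smul_eq_mul, Finset.mul_sum, mul_assoc]

/-- The squared norm of the codifferential of the fundamental form (up to a factor `6`). -/
def divSq (g : Comp2) (φ : Comp4) (u : R8) : ℝ :=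
  ∑ p, ∑ a, (hMat g u * nMat g φ p u * cube (hMat g u) * (nMat g φ a u).transpose * hMat g u) p a

/-- The fundamental form with raised indices. -/
def rMat (g : Comp2) (φ : Comp4) (u : R8) : Matrix (Fin 8) Triple ℝ :=
  hMat g u * fMat φ u * cube (hMat g u)

/-- The minus sign of the codifferential cancels the sign from moving the free index of the
alternating form from the last slot to the first. -/
theorem lee_eq {g : Comp2} {φ : Comp4} {u : R8} (hφ : Alt4 fun i j k l => φ i j k l u)
    (a : Fin 8) : lee g φ a u = (1 / 42) *
      ∑ p, (hMat g u * nMat g φ p u * cube (hMat g u) * (fMat φ u).transpose) p a := by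
  have rot : ∀ b c d, φ b c d a u = -φ a b c d u := by
    intro b c d
    rw [hφ.swap₃ b c d a, hφ.swap₂ b c a d, hφ.swap₁ b a c d]
    ring
  have key : ∀ i j k i' j' k', invMetric g i i' u * invMetric g j j' u * invMetric g k k' u
      * codiff g φ i j k u * φ i' j' k' a u =
      ∑ p, (hMat g u * nMat g φ p u) p (i, j, k) * cube (hMat g u) (i, j, k) (i', j', k') *
        fMat φ u a (i', j', k') := by
    intro i j k i' j' k'
    rw [LocalSpin7.codiff_eq, rot, ← Finset.sum_mul, ← Finset.sum_mul]
    simp only [cube, Matrix.kronecker, Matrix.kroneckerMap_apply, fMat, toMat_apply]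
    change hMat g u i i' * hMat g u j j' * hMat g u k k' * _ * _ = _
    ring
  simp only [lee, key]
  congr 1
  have h2 : ∀ p, (hMat g u * nMat g φ p u * cube (hMat g u) * (fMat φ u).transpose) p a =
      ∑ I, ∑ J, (hMat g u * nMat g φ p u) p I * cube (hMat g u) I J * fMat φ u a J := by
    intro p
    rw [Matrix.mul_apply]
    simp only [Matrix.mul_apply (N := cube _), Matrix.transpose_apply, Finset.sum_mul]
    rw [Finset.sum_comm]
  have h3 : ∀ f : Fin 8 → Triple → Triple → ℝ,
      ∑ p, ∑ I, ∑ J, f p I J = ∑ I, ∑ J, ∑ p, f p I J := fun f => by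
    rw [Finset.sum_comm]
    exact Finset.sum_congr rfl fun I _ => Finset.sum_comm
  simp only [h2]
  rw [h3]
  simp only [Fintype.sum_prod_type]

namespace LocalSpin7

variable {U : Set R8} {g : Comp2} {φ : Comp4} {u : R8}

/-- The normal form at a point: an adapted frame, the coefficients `c` of `∇^g Φ` in `Λ⁴₇`, and the
balanced condition as a linear equation on `c`. -/
theorem exists_adapted (h : LocalSpin7 U g φ) (hu : u ∈ U) (hθ : ∀ a, lee g φ a u = 0) :
    ∃ (P E : Matrix (Fin 8) (Fin 8) ℝ) (c : Fin 8 → Fin 7 → ℝ), P * E = 1 ∧ E * P = 1 ∧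
      hMat g u = E.transpose * E ∧ fMat φ u = P * cayleyMat * (cube P).transpose ∧
      (∀ b, ∑ a, E b a • (E * nMat g φ a u * (cube E).transpose) = ofCoeff c b) ∧
      ∀ p, ∑ a, (ofCoeff c a * cayleyMat.transpose) a p = 0 := by
  obtain ⟨P, E, hPE, hEP, hG, hH, hφ⟩ := h.exists_frame hu
  obtain ⟨c, hc⟩ := h.exists_coeff hu hEP hH hφ
  refine ⟨P, E, c, hPE, hEP, hH, fMat_eq hφ, hc, ?_⟩
  have h1 : ∀ p, hMat g u * nMat g φ p u * cube (hMat g u) * (fMat φ u).transpose =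
      E.transpose * (E * nMat g φ p u * (cube E).transpose * cayleyMat.transpose) *
        P.transpose := by
    intro p
    have : cube E * cube P = 1 := by rw [← cube_mul, hEP, cube_one]
    rw [fMat_eq hφ, hH, cube_mul, cube_transpose]
    simp only [Matrix.transpose_mul, Matrix.transpose_transpose, Matrix.mul_assoc]
    rw [← Matrix.mul_assoc (cube E) (cube P), this, Matrix.one_mul]
  have h2 : ∀ a, ∑ d, (∑ b, (ofCoeff c b * cayleyMat.transpose) b d) * P a d = 0 := by
    intro a
    have := hθ a
    rw [lee_eq (h.alt4 hu)] at this
    have := (mul_eq_zero.1 this).resolve_left (by norm_num)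
    simp only [h1] at this
    rw [← this]
    simp only [Matrix.mul_apply (N := P.transpose), Matrix.transpose_apply P]
    rw [Finset.sum_comm]
    refine Finset.sum_congr rfl fun d _ => ?_
    rw [← Finset.sum_mul]
    congr 1
    simp only [← hc, Matrix.sum_mul, Matrix.smul_mul, Matrix.sum_apply, Matrix.smul_apply,
      Matrix.mul_apply (M := E.transpose), Matrix.transpose_apply E, smul_eq_mul]
    exact Finset.sum_comm
  intro p
  -- The vanishing of the Lee form in coordinates is this vector multiplied by the invertible matrix
  -- `P`.
  have h3 : (E * P) *ᵥ (fun d => ∑ b, (ofCoeff c b * cayleyMat.transpose) b d) = 0 := by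
    rw [← Matrix.mulVec_mulVec]
    have : P *ᵥ (fun d => ∑ b, (ofCoeff c b * cayleyMat.transpose) b d) = 0 := by
      funext a
      rw [Pi.zero_apply, ← h2 a]
      simp only [Matrix.mulVec, dotProduct, mul_comm (P a _)]
    rw [this, Matrix.mulVec_zero]
  rw [hEP, Matrix.one_mulVec] at h3
  exact congrFun h3 p

theorem rMat_eq {P E : Matrix (Fin 8) (Fin 8) ℝ} (hEP : E * P = 1)
    (hH : hMat g u = E.transpose * E) (hφ : fMat φ u = P * cayleyMat * (cube P).transpose) :
    rMat g φ u = E.transpose * cayleyMat * cube E := by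
  have : (cube P).transpose * (cube E).transpose = 1 := by
    rw [← Matrix.transpose_mul, ← cube_mul, hEP, cube_one, Matrix.transpose_one]
  rw [rMat, hH, hφ, cube_mul, cube_transpose]
  simp only [Matrix.mul_assoc]
  rw [← Matrix.mul_assoc (cube P).transpose, this, Matrix.one_mul, ← Matrix.mul_assoc E P, hEP,
    Matrix.one_mul]

/-- The two hypotheses of `weitzenboeck`. In the frame, the first is the transposed balanced
condition and the second follows from it by skewness of the Clifford matrices. -/
theorem sum_raise_mul (h : LocalSpin7 U g φ) (hu : u ∈ U) (hθ : ∀ a, lee g φ a u = 0)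
    (p : Fin 8) : ∑ a, (rMat g φ u * (nMat g φ a u).transpose * hMat g u) p a = 0 ∧
      ∑ a, (rMat g φ u * (nMat g φ a u).transpose * hMat g u) a p = 0 := by
  obtain ⟨P, E, c, hPE, hEP, hH, hφ, hX, hc⟩ := h.exists_adapted hu hθ
  have h1 : ∀ a, rMat g φ u * (nMat g φ a u).transpose * hMat g u = E.transpose *
      (E * nMat g φ a u * (cube E).transpose * cayleyMat.transpose).transpose * E := by
    intro a
    rw [rMat_eq hEP hH hφ, hH]
    simp only [Matrix.transpose_mul, Matrix.transpose_transpose, Matrix.mul_assoc]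
  have h2 : ∀ a, (rMat g φ u * (nMat g φ a u).transpose * hMat g u).transpose = E.transpose *
      (E * nMat g φ a u * (cube E).transpose * cayleyMat.transpose) * E := by
    intro a
    rw [h1]
    simp only [Matrix.transpose_mul, Matrix.transpose_transpose, Matrix.mul_assoc]
  have h3 : ∀ b, ∑ a, E b a • (E * nMat g φ a u * (cube E).transpose * cayleyMat.transpose) =
      ofCoeff c b * cayleyMat.transpose := by
    intro b
    rw [← hX, Matrix.sum_mul]
    simp only [Matrix.smul_mul]
  constructor
  · simp only [h1]
    rw [sum_conj_apply]
    refine Finset.sum_eq_zero fun b _ => ?_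
    simp only [← Matrix.transpose_smul, ← Matrix.transpose_sum, h3, Matrix.transpose_apply, hc,
      mul_zero]
  · have : ∀ a, (rMat g φ u * (nMat g φ a u).transpose * hMat g u) a p = (E.transpose *
      (E * nMat g φ a u * (cube E).transpose * cayleyMat.transpose) * E) p a := by
      intro a; rw [← h2]; rfl
    simp only [this]
    rw [sum_conj_apply]
    refine Finset.sum_eq_zero fun b _ => ?_
    simp only [h3]
    rw [sum_ofCoeff_mul_cayleyMat_swap, hc, neg_zero, mul_zero]

/-- Both full contractions are independent of the frame, so they may be evaluated on the
coefficients `c`. -/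
theorem divSq_eq {E : Matrix (Fin 8) (Fin 8) ℝ} {c : Fin 8 → Fin 7 → ℝ}
    (hH : hMat g u = E.transpose * E)
    (hX : ∀ b, ∑ a, E b a • (E * nMat g φ a u * (cube E).transpose) = ofCoeff c b)
    (hc : ∀ p, ∑ a, (ofCoeff c a * cayleyMat.transpose) a p = 0) :
    divSq g φ u = 12 * ∑ p, ∑ m, c p m * c p m ∧
    ∑ p, ∑ a, (hMat g u * nMat g φ p u * cube (hMat g u) * (nMat g φ a u).transpose *
      hMat g u) a p = 36 * ∑ p, ∑ m, c p m * c p m := by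
  have h1 : ∀ p a, hMat g u * nMat g φ p u * cube (hMat g u) * (nMat g φ a u).transpose *
      hMat g u = E.transpose * ((E * nMat g φ p u * (cube E).transpose) *
        (E * nMat g φ a u * (cube E).transpose).transpose) * E := by
    intro p a
    rw [hH, cube_mul, cube_transpose]
    simp only [Matrix.transpose_mul, Matrix.transpose_transpose, Matrix.mul_assoc]
  have h2 : ∀ p a, hMat g u * nMat g φ p u * cube (hMat g u) * (nMat g φ a u).transpose *
      hMat g u = (E.transpose * ((E * nMat g φ a u * (cube E).transpose) *
        (E * nMat g φ p u * (cube E).transpose).transpose) * E).transpose := by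
    intro p a
    rw [h1]
    simp only [Matrix.transpose_mul, Matrix.transpose_transpose, Matrix.mul_assoc]
  constructor
  · simp only [divSq, h1]
    rw [sum_sum_conj_apply, ← sum_divergence_sq hc]
    simp only [← hX, Matrix.transpose_sum, Matrix.transpose_smul, Matrix.sum_mul, Matrix.mul_sum,
      Matrix.smul_mul, Matrix.mul_smul, smul_smul, Finset.smul_sum]
    refine Finset.sum_congr rfl fun b _ => Finset.sum_congr rfl fun d _ => ?_
    rw [Finset.sum_comm]
    simp only [mul_comm (E b _)]
  · simp only [h2, Matrix.transpose_apply]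
    rw [sum_sum_conj_apply, ← sum_crossed_sq hc]
    refine Finset.sum_congr rfl fun b _ => Finset.sum_congr rfl fun d _ => ?_
    simp only [← hX, Matrix.transpose_sum, Matrix.transpose_smul, Matrix.sum_mul, Matrix.mul_sum,
      Matrix.smul_mul, Matrix.mul_smul, smul_smul, Finset.smul_sum]

/-- The two quadratic invariants of the covariant derivative are proportional. -/
theorem crossed_eq (h : LocalSpin7 U g φ) (hu : u ∈ U) (hθ : ∀ a, lee g φ a u = 0) :
    ∑ p, ∑ a, (hMat g u * nMat g φ p u * cube (hMat g u) * (nMat g φ a u).transpose *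
      hMat g u) a p = 3 * divSq g φ u := by
  obtain ⟨P, E, c, hPE, hEP, hH, hφ, hX, hc⟩ := h.exists_adapted hu hθ
  obtain ⟨h1, h2⟩ := divSq_eq hH hX hc
  rw [h1, h2]; ring

/-- For a balanced structure `divSq` is `12` times a sum of squares of all coefficients of `∇^g Φ`,
so the codifferential determines whether the whole derivative vanishes. -/
theorem nablaForm_eq_zero (h : LocalSpin7 U g φ) (hu : u ∈ U) (hθ : ∀ a, lee g φ a u = 0)
    (h0 : divSq g φ u = 0) (p i j k l : Fin 8) : nablaForm g φ p i j k l u = 0 := by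
  obtain ⟨P, E, c, hPE, hEP, hH, hφ, hX, hc⟩ := h.exists_adapted hu hθ
  have h1 := (divSq_eq hH hX hc).1
  rw [h0] at h1
  have h2 : ∑ p, ∑ m, c p m * c p m = 0 := by linarith
  have h3 : ∀ p m, c p m = 0 := by
    intro p m
    have e1 := (Finset.sum_eq_zero_iff_of_nonneg fun p _ =>
      Finset.sum_nonneg fun m _ => mul_self_nonneg (c p m)).1 h2 p (Finset.mem_univ p)
    have e2 := (Finset.sum_eq_zero_iff_of_nonneg fun m _ => mul_self_nonneg (c p m)).1 e1 m
      (Finset.mem_univ m)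
    exact mul_self_eq_zero.1 e2
  have h4 : ∀ b, ∑ a, E b a • (E * nMat g φ a u * (cube E).transpose) = 0 := by
    intro b
    rw [hX]
    simp [ofCoeff, h3]
  have h5 : E * nMat g φ p u * (cube E).transpose = 0 := by
    have e : ∑ b, P p b • ∑ a, E b a • (E * nMat g φ a u * (cube E).transpose) =
        ∑ a, (P * E) p a • (E * nMat g φ a u * (cube E).transpose) := by
      simp only [Finset.smul_sum, smul_smul, Matrix.mul_apply, Finset.sum_smul]
      exact Finset.sum_comm
    simp only [h4, smul_zero, Finset.sum_const_zero, hPE] at e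
    simpa [Matrix.one_apply] using e.symm
  have h6 : nMat g φ p u = 0 := by
    have e := congrArg (fun X => P * X * (cube P).transpose) h5
    have : (cube E).transpose * (cube P).transpose = 1 := by
      rw [← Matrix.transpose_mul, ← cube_mul, hPE, cube_one, Matrix.transpose_one]
    simp only [Matrix.mul_assoc, this, Matrix.mul_one, Matrix.mul_zero] at e
    rw [← Matrix.mul_assoc, hPE, Matrix.one_mul] at e
    simpa using e
  exact congrFun (congrFun h6 i) (j, k, l)

end LocalSpin7

/-! ### The scalar curvature of a balanced structure -/

section Contractions

variable {S T : Fin 8 → Fin 8 → Fin 8 → Fin 8 → ℝ}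

theorem cubeConn_mul_transpose_apply (F : Matrix (Fin 8) (Fin 8) ℝ) (i j k b : Fin 8) :
    (cubeConn F * (toMat T).transpose) (i, j, k) b =
      ∑ s, (F i s * T b s j k + F j s * T b i s k + F k s * T b i j s) := by
  simp only [toMat_apply, Matrix.mul_apply, cubeConn, tensorConn, Matrix.transpose_apply,
    Matrix.add_apply, Matrix.kronecker, Matrix.kroneckerMap_apply, Fintype.sum_prod_type,
    Matrix.one_apply, mul_add, add_mul, Finset.sum_add_distrib, mul_ite, ite_mul, mul_one,
    mul_zero, one_mul, zero_mul, Finset.sum_ite_eq, Finset.mem_univ, if_true,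
    Finset.sum_const_zero, Finset.sum_ite_irrel]
  ring

/-- Alternation makes the last three slots contribute equally, hence the factor `3`. -/
theorem toMat_mul_cubeConn_mul (hS : Alt4 S) (hT : Alt4 T) (F : Matrix (Fin 8) (Fin 8) ℝ)
    (p b : Fin 8) : (toMat S * (cubeConn F * (toMat T).transpose)) p b =
      3 * ∑ i, ∑ s, F i s * (toMat₂ S * (toMat₂ T).transpose) (p, i) (b, s) := by
  have h1 : ∀ i s, F i s * (toMat₂ S * (toMat₂ T).transpose) (p, i) (b, s) =
      ∑ j, ∑ k, S p i j k * (F i s * T b s j k) := by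
    intro i s
    simp only [Matrix.mul_apply, Fintype.sum_prod_type, toMat₂_apply, Matrix.transpose_apply,
      Finset.mul_sum]
    exact Finset.sum_congr rfl fun j _ => Finset.sum_congr rfl fun k _ => by ring
  have h2 : ∀ i, ∑ s, ∑ j, ∑ k, S p i j k * (F i s * T b s j k) =
      ∑ j, ∑ k, ∑ s, S p i j k * (F i s * T b s j k) := by
    intro i
    rw [Finset.sum_comm]
    exact Finset.sum_congr rfl fun j _ => Finset.sum_comm
  have h3 : ∑ i, ∑ j, ∑ k, ∑ s, S p i j k * (F j s * T b i s k) =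
      ∑ i, ∑ j, ∑ k, ∑ s, S p i j k * (F i s * T b s j k) := by
    rw [Finset.sum_comm]
    refine Finset.sum_congr rfl fun i _ => Finset.sum_congr rfl fun j _ =>
      Finset.sum_congr rfl fun k _ => Finset.sum_congr rfl fun s _ => ?_
    rw [hS.swap₂ p j i k, hT.swap₂ b j s k]; ring
  have h4 : ∑ i, ∑ j, ∑ k, ∑ s, S p i j k * (F k s * T b i j s) =
      ∑ i, ∑ j, ∑ k, ∑ s, S p i j k * (F j s * T b i s k) := by
    refine Finset.sum_congr rfl fun i _ => ?_
    rw [Finset.sum_comm]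
    refine Finset.sum_congr rfl fun j _ =>
      Finset.sum_congr rfl fun k _ => Finset.sum_congr rfl fun s _ => ?_
    rw [hS.swap₃ p i k j, hT.swap₃ b i k s]; ring
  simp only [h1, h2]
  rw [Matrix.mul_apply]
  simp only [Fintype.sum_prod_type, cubeConn_mul_transpose_apply, toMat_apply, Finset.mul_sum,
    mul_add, Finset.sum_add_distrib]
  simp only [← Finset.mul_sum]
  simp only [Finset.mul_sum] at h3 h4 ⊢
  rw [h4, h3]
  simp only [← Finset.mul_sum]
  ring

end Contractions

theorem curvature_bianchi {U : Set R8} {A : Comp3} {u : R8} (hU : IsOpen U) (hu : u ∈ U)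
    (hA : ∀ v ∈ U, ∀ k i j, A k i j v = A k j i v) (s p a b : Fin 8) :
    curvature A s p a b u + curvature A s a b p u + curvature A s b p a u = 0 := by
  have hd : ∀ p k i j, pd p (A k i j) u = pd p (A k j i) u := fun p k i j =>
    pd_congr hU (fun v hv => hA v hv k i j) hu p
  simp only [curvature, Finset.sum_sub_distrib]
  rw [hd p s a b, hd a s p b, hd b s p a]
  simp only [hA u hu _ a b, hA u hu _ p b, hA u hu _ p a]
  ring

theorem curvature_antisymm (A : Comp3) (s p a b : Fin 8) (u : R8) :
    curvature A s p a b u = -curvature A s a p b u := by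
  simp only [curvature, Finset.sum_sub_distrib]
  ring

namespace LocalSpin7

variable {U : Set R8} {g : Comp2} {φ : Comp4} {u : R8}

/-- The fundamental form with raised indices, as an array. -/
theorem exists_raised (h : LocalSpin7 U g φ) (hu : u ∈ U) :
    ∃ R : Fin 8 → Fin 8 → Fin 8 → Fin 8 → ℝ, Alt4 R ∧ rMat g φ u = toMat R ∧
      rMat g φ u * (fMat φ u).transpose = (42 : ℝ) • (1 : Matrix (Fin 8) (Fin 8) ℝ) ∧
      toMat₂ R * (toMat₂ fun i j k l => φ i j k l u).transpose = (6 : ℝ) • (1 - swapMat) -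
        (4 : ℝ) • (toMat₂ R * Matrix.kronecker (gMat g u) (gMat g u)) := by
  obtain ⟨P, E, hPE, hEP, hG, hH, hφ⟩ := h.exists_frame hu
  refine ⟨pull E.transpose fun i j k l => (cayley i j k l : ℝ), alt4_cayley.pull _, ?_, ?_, ?_⟩
  · rw [rMat_eq hEP hH (fMat_eq hφ), toMat_pull, cube_transpose, Matrix.transpose_transpose]
    rfl
  · have : cube E * cube P = 1 := by rw [← cube_mul, hEP, cube_one]
    rw [rMat_eq hEP hH (fMat_eq hφ), fMat_eq hφ]
    simp only [Matrix.transpose_mul, Matrix.transpose_transpose, Matrix.mul_assoc]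
    rw [← Matrix.mul_assoc (cube E), this, Matrix.one_mul, ← Matrix.mul_assoc cayleyMat,
      cayleyMat_mul_transpose, Matrix.smul_mul, Matrix.mul_smul, Matrix.one_mul,
      ← Matrix.transpose_mul, hPE, Matrix.transpose_one]
  · have hk : Matrix.kronecker E E * Matrix.kronecker P P = 1 := by
      simp only [Matrix.kronecker]
      rw [← Matrix.mul_kronecker_mul, hEP, Matrix.one_kronecker_one]
    have hk' : Matrix.kronecker P P * Matrix.kronecker E E = 1 := mul_eq_one_comm.1 hk
    have hs := swapMat_mul_kronecker E.transpose
    rw [hφ, toMat₂_pull, toMat₂_pull, hG]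
    have e1 : (Matrix.kronecker E.transpose E.transpose) = (Matrix.kronecker E E).transpose := rfl
    have e2 : Matrix.kronecker (P * P.transpose) (P * P.transpose) =
        Matrix.kronecker P P * (Matrix.kronecker P P).transpose := by
      simp only [Matrix.kronecker]
      rw [Matrix.mul_kronecker_mul]; rfl
    rw [e1] at hs ⊢
    rw [e2]
    have e3 : (Matrix.kronecker E E).transpose * (Matrix.kronecker P P).transpose = 1 := by
      rw [← Matrix.transpose_mul, hk', Matrix.transpose_one]
    simp only [Matrix.transpose_mul, Matrix.transpose_transpose, Matrix.mul_assoc]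
    rw [← Matrix.mul_assoc (Matrix.kronecker E E) (Matrix.kronecker P P), hk, Matrix.one_mul,
      ← Matrix.mul_assoc (toMat₂ _), toMat₂_cayley_mul_transpose]
    simp only [Matrix.sub_mul, Matrix.mul_sub, Matrix.smul_mul, Matrix.mul_smul, Matrix.one_mul,
      e3]
    rw [← Matrix.mul_assoc _ swapMat, ← hs, Matrix.mul_assoc, e3, Matrix.mul_one,
      ← Matrix.mul_assoc (Matrix.kronecker E E) (Matrix.kronecker P P), hk, Matrix.one_mul]

theorem curvMat_cubeConn (h : LocalSpin7 U g φ) (hu : u ∈ U) (p a : Fin 8) :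
    curvMat (fun p u => cubeConn (connMat (christoffel g) p u)) p a u =
      cubeConn (curvMat (connMat (christoffel g)) p a u) := by
  have hA := h.smooth_connMat
  exact (curvMat_tensorConn h.isOpen hu hA (fun p => (hA p).tensorConn (hA p)) p a).trans
    (by rw [curvMat_tensorConn h.isOpen hu hA hA, cubeConn])

theorem scal_eq (h : LocalSpin7 U g φ) (hu : u ∈ U) : scal g (christoffel g) u =
    ∑ p, ∑ a, ∑ s, curvMat (connMat (christoffel g)) p a u s p * hMat g u s a := by
  simp only [scal, ricci, curvMat_connMat, Finset.mul_sum]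
  conv_rhs => rw [Finset.sum_comm]
  refine Finset.sum_congr rfl fun a _ => ?_
  rw [Finset.sum_comm]
  refine Finset.sum_congr rfl fun p _ => Finset.sum_congr rfl fun s _ => ?_
  rw [← h.hMat_transpose hu, mul_comm]
  rfl

/-- Curvature in the first slot of `Φ` meets the full contraction `42 δ` and gives `42 Scal^g`. In
the other three slots, `sum_cayley_mul` gives `-3 * 6 Scal^g`, a trace term killed by symmetry of
the metric, and a contraction of `Φ` with the curvature killed by the first Bianchi identity. Thus
`24 = 42 - 18`. -/
theorem sum_curvature_contraction (h : LocalSpin7 U g φ) (hu : u ∈ U) :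
    ∑ p, ∑ a, (rMat g φ u * (curvMat (connMat (christoffel g)) p a u * fMat φ u +
      fMat φ u * (curvMat (fun p u => cubeConn (connMat (christoffel g) p u)) p a u).transpose).transpose
        * hMat g u) p a = 24 * scal g (christoffel g) u := by
  obtain ⟨R, hR, hRm, h42, h2⟩ := h.exists_raised hu
  set F := fun p a => curvMat (connMat (christoffel g)) p a u with hF
  change ∑ p, ∑ a, (rMat g φ u * (F p a * fMat φ u + fMat φ u * (curvMat (fun p u =>
      cubeConn (connMat (christoffel g) p u)) p a u).transpose).transpose * hMat g u) p a = _
  have hanti : ∀ p a i s, F p a i s = -F a p i s := fun p a i s => by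
    simp only [hF, curvMat_connMat]
    exact curvature_antisymm _ _ _ _ _ _
  have hb : ∀ s p a i, F p a i s + F a i p s + F i p a s = 0 := fun s p a i => by
    simp only [hF, curvMat_connMat]
    exact curvature_bianchi h.isOpen hu (fun v hv => h.christoffel_symm hv) s p a i
  have t1 : ∀ p a, (rMat g φ u * (F p a * fMat φ u).transpose * hMat g u) p a =
      42 * ∑ s, F p a s p * hMat g u s a := by
    intro p a
    rw [Matrix.transpose_mul, ← Matrix.mul_assoc, h42, Matrix.smul_mul, Matrix.smul_mul,
      Matrix.one_mul, Matrix.smul_apply, Matrix.mul_apply]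
    rfl
  have t2 : ∀ p a, (rMat g φ u * (fMat φ u * (cubeConn (F p a)).transpose).transpose *
      hMat g u) p a = 18 * (hMat g u p a * ∑ i, F p a i i) -
        18 * ∑ i, F p a i p * hMat g u i a -
        12 * ∑ s, ∑ l, gMat g u l s * ∑ i, R p i a l * F p a i s := by
    intro p a
    have hk : ∀ i s, ∑ b, (toMat₂ R * (toMat₂ fun i j k l => φ i j k l u).transpose) (p, i) (b, s) *
        hMat g u b a = 6 * ((if i = s then hMat g u p a else 0) -
          (if s = p then hMat g u i a else 0)) - 4 * ∑ l, R p i a l * gMat g u l s := by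
      intro i s
      have hGH : ∀ k, ∑ b, gMat g u k b * hMat g u b a = if k = a then 1 else 0 := fun k => by
        rw [← Matrix.mul_apply, h.gMat_mul_hMat hu, Matrix.one_apply]
      have h3 : ∑ b, (toMat₂ R * Matrix.kronecker (gMat g u) (gMat g u)) (p, i) (b, s) *
          hMat g u b a = ∑ l, R p i a l * gMat g u l s := by
        simp only [Matrix.mul_apply, Fintype.sum_prod_type, toMat₂_apply, Matrix.kronecker,
          Matrix.kroneckerMap_apply, Finset.sum_mul]
        rw [Finset.sum_comm]
        have : ∀ k, ∑ b, ∑ l, R p i k l * (gMat g u k b * gMat g u l s) * hMat g u b a =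
            ∑ l, R p i k l * gMat g u l s * ∑ b, gMat g u k b * hMat g u b a := by
          intro k
          rw [Finset.sum_comm]
          refine Finset.sum_congr rfl fun l _ => ?_
          rw [Finset.mul_sum]
          exact Finset.sum_congr rfl fun b _ => by ring
        simp only [this, hGH]
        simp
      rw [h2]
      simp only [Matrix.sub_apply, Matrix.smul_apply, smul_eq_mul, sub_mul, mul_assoc,
        Finset.sum_sub_distrib, ← Finset.mul_sum]
      simp only [h3]
      simp only [Matrix.one_apply, swapMat, Matrix.of_apply, Prod.mk.injEq, ite_and]
      by_cases his : i = s <;> by_cases hsp : p = s <;> simp [his, hsp, eq_comm]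
    rw [Matrix.transpose_mul, Matrix.transpose_transpose, Matrix.mul_apply]
    simp only [hRm]
    have : ∀ b, (toMat R * (cubeConn (F p a) * (fMat φ u).transpose)) p b = _ := fun b =>
      toMat_mul_cubeConn_mul hR (h.alt4 hu) (F p a) p b
    simp only [this]
    have e : ∑ b, 3 * (∑ i, ∑ s, F p a i s *
        (toMat₂ R * (toMat₂ fun i j k l => φ i j k l u).transpose) (p, i) (b, s)) * hMat g u b a =
      3 * ∑ i, ∑ s, F p a i s * ∑ b, (toMat₂ R * (toMat₂ fun i j k l => φ i j k l u).transpose)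
        (p, i) (b, s) * hMat g u b a := by
      simp only [Finset.mul_sum, Finset.sum_mul]
      rw [Finset.sum_comm]
      refine Finset.sum_congr rfl fun i _ => ?_
      rw [Finset.sum_comm]
      exact Finset.sum_congr rfl fun s _ => Finset.sum_congr rfl fun b _ => by ring
    rw [e]
    simp only [hk]
    have e' : ∑ i, ∑ s, F p a i s * ∑ l, R p i a l * gMat g u l s =
        ∑ s, ∑ l, gMat g u l s * ∑ i, R p i a l * F p a i s := by
      simp only [Finset.mul_sum]
      rw [Finset.sum_comm]
      refine Finset.sum_congr rfl fun s _ => ?_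
      rw [Finset.sum_comm]
      exact Finset.sum_congr rfl fun l _ => Finset.sum_congr rfl fun i _ => by ring
    have e1 : ∑ i, ∑ s, F p a i s * (if i = s then hMat g u p a else 0) =
        hMat g u p a * ∑ i, F p a i i := by
      simp [Finset.mul_sum, mul_comm]
    have e2 : ∑ i, ∑ s, F p a i s * (if s = p then hMat g u i a else 0) =
        ∑ i, F p a i p * hMat g u i a := by
      simp
    rw [← e', ← e1, ← e2]
    simp only [mul_sub, Finset.sum_sub_distrib, mul_left_comm (F p a _ _), ← Finset.mul_sum]
    ring
  have z1 : ∑ p, ∑ a, hMat g u p a * ∑ i, F p a i i = 0 := by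
    have e1 : ∑ p, ∑ a, hMat g u p a * ∑ i, F p a i i =
        -∑ p, ∑ a, hMat g u p a * ∑ i, F p a i i := by
      conv_lhs => rw [Finset.sum_comm]
      simp only [← Finset.sum_neg_distrib, ← mul_neg]
      refine Finset.sum_congr rfl fun p _ => Finset.sum_congr rfl fun a _ => ?_
      congr 1
      · exact congrFun (congrFun (h.hMat_transpose hu) p) a
      · exact Finset.sum_congr rfl fun i _ => hanti _ _ _ _
    linarith
  -- `R` is invariant under cyclic permutation of `p`, `a`, `i`, so three times the sum is a
  -- contraction with the cyclic sum of the curvature, zero by Bianchi.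
  have z2 : ∀ s l, ∑ p, ∑ a, ∑ i, R p i a l * F p a i s = 0 := by
    intro s l
    have cyc : ∀ f : Fin 8 → Fin 8 → Fin 8 → ℝ,
        ∑ p, ∑ a, ∑ i, f p a i = ∑ p, ∑ a, ∑ i, f a i p := by
      intro f
      rw [Finset.sum_comm]
      conv_lhs => enter [2, a]; rw [Finset.sum_comm]
      rw [Finset.sum_comm]
      conv_lhs => enter [2, a]; rw [Finset.sum_comm]
    have hRc : ∀ p a i, R a p i l = R p i a l := fun p a i => by
      rw [hR.swap₁, hR.swap₂]; ring
    have e1 := cyc fun p a i => R p i a l * F p a i s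
    have e2 := cyc fun p a i => R a p i l * F a i p s
    simp only [hRc] at e1 e2
    have e3 : ∑ p, ∑ a, ∑ i, (R p i a l * F p a i s + R p i a l * F a i p s +
        R p i a l * F i p a s) = 0 := by
      simp only [← mul_add, hb, mul_zero, Finset.sum_const_zero]
    simp only [Finset.sum_add_distrib] at e3
    linarith
  have z3 : ∑ p, ∑ a, ∑ s, ∑ l, gMat g u l s * ∑ i, R p i a l * F p a i s = 0 := by
    have : ∑ p, ∑ a, ∑ s, ∑ l, gMat g u l s * ∑ i, R p i a l * F p a i s =
        ∑ s, ∑ l, gMat g u l s * ∑ p, ∑ a, ∑ i, R p i a l * F p a i s := by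
      have h3 : ∀ f : Fin 8 → Fin 8 → Fin 8 → Fin 8 → ℝ, ∑ p, ∑ a, ∑ s, ∑ l, f p a s l =
          ∑ s, ∑ l, ∑ p, ∑ a, f p a s l := fun f => by
        simpa only [Fintype.sum_prod_type] using Finset.sum_comm (s := Finset.univ)
          (t := Finset.univ) (f := fun x y : Fin 8 × Fin 8 => f x.1 x.2 y.1 y.2)
      rw [h3]
      simp only [← Finset.mul_sum]
    rw [this]
    simp only [z2, mul_zero, Finset.sum_const_zero]
  have e : ∀ p a, (rMat g φ u * (F p a * fMat φ u + fMat φ u * (curvMat (fun p u =>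
      cubeConn (connMat (christoffel g) p u)) p a u).transpose).transpose * hMat g u) p a =
      24 * (∑ s, F p a s p * hMat g u s a) + 18 * (hMat g u p a * ∑ i, F p a i i) -
        12 * ∑ s, ∑ l, gMat g u l s * ∑ i, R p i a l * F p a i s := by
    intro p a
    rw [Matrix.transpose_add, Matrix.mul_add, Matrix.add_mul, Matrix.add_apply, t1,
      h.curvMat_cubeConn hu]
    change _ + (rMat g φ u * (fMat φ u * (cubeConn (F p a)).transpose).transpose *
      hMat g u) p a = _
    rw [t2]; ring
  simp only [e, Finset.sum_add_distrib, Finset.sum_sub_distrib, ← Finset.mul_sum] at z1 z3 ⊢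
  rw [h.scal_eq hu]
  linarith

/-- The scalar curvature of a balanced structure. -/
theorem scal_balanced (h : LocalSpin7 U g φ) (hu : u ∈ U) (hθ : ∀ v ∈ U, ∀ a, lee g φ a v = 0) :
    12 * scal g (christoffel g) u = -divSq g φ u := by
  have key := weitzenboeck h.isOpen hu h.smooth_connMat (fun p => (h.smooth_connMat p).cubeConn)
    h.smooth_hMat h.smooth_hMat.cube h.smooth_fMat h.isMetricConn h.isMetricConn_cube
    (fun p i j => h.christoffel_symm hu j p i)
    (fun v hv p => by
      rw [← nMat_eq_covDeriv]
      exact (h.sum_raise_mul hv (hθ v hv) p).1)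
    (fun v hv p => by
      rw [← nMat_eq_covDeriv]
      exact (h.sum_raise_mul hv (hθ v hv) p).2)
  -- With the crossed term equal to `3 * divSq`, the formula reads `-2 * divSq = 24 * scal`.
  rw [← nMat_eq_covDeriv, h.crossed_eq hu (hθ u hu)] at key
  have e := key.trans (h.sum_curvature_contraction hu)
  change divSq g φ u - _ = _ at e
  linarith

end LocalSpin7

/-! ### The torsion of a balanced structure -/

/-- The scalar curvature of a connection that differs from a symmetric connection by a
trace-free, skew-symmetric tensor. -/
theorem scal_add {U : Set R8} {g : Comp2} {A S B : Comp3} {u : R8} (hU : IsOpen U) (hu : u ∈ U)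
    (hH : (hMat g u).transpose = hMat g u)
    (hA : ∀ k i j, ContDiffOn ℝ ∞ (A k i j) U) (hS : ∀ k i j, ContDiffOn ℝ ∞ (S k i j) U)
    (hB : ∀ v ∈ U, ∀ k i j, B k i j v = A k i j v + S k i j v)
    (hAsymm : ∀ k i j, A k i j u = A k j i u)
    (hSanti : ∀ v ∈ U, ∀ k i j, S k i j v = -S k j i v) (hStr : ∀ v ∈ U, ∀ k, ∑ i, S i i k v = 0) :
    scal g B u = scal g A u -
      ∑ j, ∑ k, hMat g u j k * ∑ i, ∑ m, S m i k u * S i j m u := by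
  have hH' : ∀ j k, hMat g u j k = hMat g u k j := fun j k => congrFun (congrFun hH k) j
  have dA := fun k i j => differentiableAt_of_contDiffOn hU (hA k i j) hu
  have dS := fun k i j => differentiableAt_of_contDiffOn hU (hS k i j) hu
  have hpd : ∀ p k i j, pd p (B k i j) u = pd p (A k i j) u + pd p (S k i j) u := by
    intro p k i j
    rw [pd_congr hU (fun v hv => hB v hv k i j) hu, pd_add (dA k i j) (dS k i j)]
  have hpdS : ∀ p k i j, pd p (S k i j) u = -pd p (S k j i) u := by
    intro p k i j
    rw [pd_congr hU (fun v hv => hSanti v hv k i j) hu, pd_neg]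
  have hpdtr : ∀ p k, ∑ i, pd p (S i i k) u = 0 := by
    intro p k
    rw [← pd_sum fun i => dS i i k]
    exact pd_eq_zero hU (fun v hv => hStr v hv k) hu p
  have hric : ∀ j k, ricci B j k u = ricci A j k u + ∑ i, pd i (S i j k) u +
      ∑ m, S m j k u * ∑ i, A i i m u - ∑ i, ∑ m, S m i k u * A i j m u -
      ∑ i, ∑ m, A m i k u * S i j m u - ∑ i, ∑ m, S m i k u * S i j m u := by
    intro j k
    have z1 : ∀ m, ∑ i, S i i m u = 0 := hStr u hu
    have z2 : ∑ i, ∑ m, (A m j k u + S m j k u) * S i i m u = 0 := by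
      rw [Finset.sum_comm]
      simp only [← Finset.mul_sum, z1, mul_zero, Finset.sum_const_zero]
    have z3 : ∑ i, ∑ m, S m j k u * A i i m u = ∑ m, S m j k u * ∑ i, A i i m u := by
      rw [Finset.sum_comm]
      simp only [← Finset.mul_sum]
    rw [← z3]
    have z4 := hpdtr j k
    simp only [ricci, curvature, hpd, hB u hu, Finset.sum_add_distrib, Finset.sum_sub_distrib,
      add_mul, mul_add] at z2 ⊢
    linarith
  -- The scalar curvature sees only the symmetric part of the Ricci tensor. This removes the terms
  -- linear in `S`.
  have anti : ∀ X : Fin 8 → Fin 8 → ℝ, (∀ j k, X j k = -X k j) →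
      ∑ j, ∑ k, hMat g u j k * X j k = 0 := by
    intro X hX
    have : ∑ j, ∑ k, hMat g u j k * X j k = -∑ j, ∑ k, hMat g u j k * X j k := by
      conv_lhs => rw [Finset.sum_comm]
      simp only [← Finset.sum_neg_distrib]
      refine Finset.sum_congr rfl fun j _ => Finset.sum_congr rfl fun k _ => ?_
      rw [hH', hX]; ring
    linarith
  have e1 := anti (fun j k => ∑ i, pd i (S i j k) u) fun j k => by
    rw [← Finset.sum_neg_distrib]
    exact Finset.sum_congr rfl fun i _ => hpdS i i j k
  have e2 := anti (fun j k => ∑ m, S m j k u * ∑ i, A i i m u) fun j k => by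
    rw [← Finset.sum_neg_distrib]
    exact Finset.sum_congr rfl fun m _ => by rw [hSanti u hu m j k]; ring
  -- Neither mixed term is skew in `j` and `k` by itself; their sum is, by symmetry of `A` and
  -- antisymmetry of `S`.
  have e3 := anti (fun j k => ∑ i, ∑ m, S m i k u * A i j m u + ∑ i, ∑ m, A m i k u * S i j m u)
    fun j k => by
      rw [neg_add, add_comm]
      have : ∀ j k, ∑ i, ∑ m, A m i k u * S i j m u = -∑ i, ∑ m, S m i j u * A i k m u := by
        intro j k
        rw [Finset.sum_comm]
        simp only [← Finset.sum_neg_distrib]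
        refine Finset.sum_congr rfl fun i _ => Finset.sum_congr rfl fun m _ => ?_
        rw [hSanti u hu m j i, hAsymm i m k]; ring
      rw [this, this]; ring
  have hs : ∀ C : Comp3, scal g C u = ∑ j, ∑ k, hMat g u j k * ricci C j k u := fun C => rfl
  rw [hs, hs]
  simp only [hric, mul_add, mul_sub, Finset.sum_add_distrib, Finset.sum_sub_distrib] at e3 ⊢
  linarith

namespace LocalSpin7

variable {U : Set R8} {g : Comp2} {φ : Comp4} {u : R8}

theorem codiff_swap₁ (h : LocalSpin7 U g φ) (hu : u ∈ U) (i j k : Fin 8) :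
    codiff g φ i j k u = -codiff g φ j i k u := by
  simp only [codiff, ← Finset.sum_neg_distrib, ← mul_neg]
  exact Finset.sum_congr rfl fun p _ => Finset.sum_congr rfl fun q _ =>
    congrArg _ (congrArg _ ((h.nablaForm_alt4 hu p).swap₂ q i j k))

theorem codiff_swap₂ (h : LocalSpin7 U g φ) (hu : u ∈ U) (i j k : Fin 8) :
    codiff g φ i j k u = -codiff g φ i k j u := by
  simp only [codiff, ← Finset.sum_neg_distrib, ← mul_neg]
  exact Finset.sum_congr rfl fun p _ => Finset.sum_congr rfl fun q _ =>
    congrArg _ (congrArg _ ((h.nablaForm_alt4 hu p).swap₃ q i j k))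

theorem smooth_codiff (h : LocalSpin7 U g φ) (i j k : Fin 8) :
    ContDiffOn ℝ ∞ (codiff g φ i j k) U :=
  (ContDiffOn.sum fun p _ => ContDiffOn.sum fun q _ =>
    (h.smooth_hMat p q).mul (h.smooth_nMat p q (i, j, k))).neg

theorem torsion_eq_codiff (hθ : ∀ a, lee g φ a u = 0) (i j k : Fin 8) :
    torsion g φ i j k u = codiff g φ i j k u := by
  simp [torsion, hθ]

theorem divSq_eq_sum (h : LocalSpin7 U g φ) (hu : u ∈ U) : divSq g φ u =
    ∑ I : Triple, ∑ J : Triple, codiff g φ I.1 I.2.1 I.2.2 u * cube (hMat g u) I J *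
      codiff g φ J.1 J.2.1 J.2.2 u := by
  have h1 : ∀ p a, (hMat g u * nMat g φ p u * cube (hMat g u) * (nMat g φ a u).transpose *
      hMat g u) p a = ∑ I, ∑ J, (hMat g u * nMat g φ p u) p I * cube (hMat g u) I J *
        (hMat g u * nMat g φ a u) a J := by
    intro p a
    have : (nMat g φ a u).transpose * hMat g u = (hMat g u * nMat g φ a u).transpose := by
      rw [Matrix.transpose_mul, h.hMat_transpose hu]
    rw [Matrix.mul_assoc, this, Matrix.mul_apply]
    simp only [Matrix.mul_apply (N := cube _), Matrix.transpose_apply, Finset.sum_mul]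
    exact Finset.sum_comm
  simp only [divSq, h1, codiff_eq, neg_mul, mul_neg, neg_neg,
    Finset.sum_mul]
  simp only [Finset.mul_sum]
  have h3 : ∀ f : Fin 8 → Fin 8 → Triple → Triple → ℝ, ∑ p, ∑ a, ∑ s, ∑ l, f p a s l =
      ∑ s, ∑ l, ∑ p, ∑ a, f p a s l := fun f => by
    have := Finset.sum_comm (s := Finset.univ)
      (t := Finset.univ) (f := fun (x : Fin 8 × Fin 8) (y : Triple × Triple) => f x.1 x.2 y.1 y.2)
    rw [Fintype.sum_prod_type] at this
    conv_rhs at this => rw [Fintype.sum_prod_type]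
    simpa only [Fintype.sum_prod_type (α₁ := Triple) (α₂ := Triple),
      Fintype.sum_prod_type (α₁ := Fin 8) (α₂ := Fin 8)] using this
  rw [h3]

/-- The scalar curvature of the torsion connection of a balanced structure. -/
theorem scal_torsionConn (h : LocalSpin7 U g φ) (hu : u ∈ U)
    (hθ : ∀ v ∈ U, ∀ a, lee g φ a v = 0) :
    scal g (torsionConn g φ) u = scal g (christoffel g) u - 1 / 4 * divSq g φ u := by
  rw [scal_add (S := fun k i j v => 1 / 2 * ∑ l, hMat g v k l * codiff g φ i j l v) h.isOpen hu
    (h.hMat_transpose hu) (fun k i j => h.smooth_connMat i j k)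
    (fun k i j => contDiffOn_const.mul (ContDiffOn.sum fun l _ =>
      (h.smooth_hMat k l).mul (h.smooth_codiff i j l)))
    (fun v hv k i j => ?_) (h.christoffel_symm hu) (fun v hv k i j => ?_) (fun v hv k => ?_)]
  · have h6 : ∀ f : Fin 8 → Fin 8 → Fin 8 → Fin 8 → Fin 8 → Fin 8 → ℝ,
        ∑ j, ∑ k, ∑ i, ∑ m, ∑ b, ∑ a, f j k i m b a =
          ∑ i, ∑ k, ∑ a, ∑ b, ∑ j, ∑ m, f j k i m b a := by
      intro f
      let e : Triple × Triple ≃ Triple × Triple :=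
        { toFun := fun x => ((x.2.2.1, x.1.2.1, x.1.1), x.2.2.2, x.2.1, x.1.2.2)
          invFun := fun x => ((x.1.2.2, x.1.2.1, x.2.2.2), x.2.2.1, x.1.1, x.2.1)
          left_inv := fun _ => rfl
          right_inv := fun _ => rfl }
      have := e.sum_comp fun x => f x.1.1 x.1.2.1 x.1.2.2 x.2.1 x.2.2.1 x.2.2.2
      simp only [Fintype.sum_prod_type] at this
      exact this.symm
    have hH : ∀ i j, hMat g u i j = hMat g u j i := fun i j =>
      congrFun (congrFun (h.hMat_transpose hu) j) i
    rw [h.divSq_eq_sum hu]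
    congr 1
    simp only [Fintype.sum_prod_type, Finset.mul_sum, Finset.sum_mul]
    rw [h6]
    refine Finset.sum_congr rfl fun i _ => Finset.sum_congr rfl fun k _ =>
      Finset.sum_congr rfl fun a _ => Finset.sum_congr rfl fun b _ =>
      Finset.sum_congr rfl fun j _ => Finset.sum_congr rfl fun m _ => ?_
    -- Two transpositions align the indices of the second torsion factor, so the signs cancel; the
    -- two factors `1 / 2` give `1 / 4`.
    rw [h.codiff_swap₂ hu j m b, h.codiff_swap₁ hu j b m, hH j k, hH m a]
    simp only [cube, Matrix.kronecker, Matrix.kroneckerMap_apply]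
    ring
  · simp only [torsionConn, torsion_eq_codiff (hθ v hv)]
    rfl
  · simp only [h.codiff_swap₁ hv i j, mul_neg, Finset.sum_neg_distrib]
  · rw [← Finset.mul_sum]
    have : ∑ i, ∑ l, hMat g v i l * codiff g φ i k l v =
        -∑ i, ∑ l, hMat g v i l * codiff g φ i k l v := by
      conv_lhs => rw [Finset.sum_comm]
      simp only [← Finset.sum_neg_distrib]
      refine Finset.sum_congr rfl fun i _ => Finset.sum_congr rfl fun l _ => ?_
      rw [h.codiff_swap₁ hv l k i, h.codiff_swap₂ hv k l i, h.codiff_swap₁ hv k i l,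
        ← congrFun (congrFun (h.hMat_transpose hv) i) l]
      simp
    linarith

/-- The balanced condition as `Φ^{aI} (δΦ)_I = 0`, the identity whose divergence is taken for closed
torsion. -/
theorem sum_rMat_mul_codiff (h : LocalSpin7 U g φ) (hu : u ∈ U) (hθ : ∀ a, lee g φ a u = 0)
    (a : Fin 8) : ∑ I : Triple, rMat g φ u a I * codiff g φ I.1 I.2.1 I.2.2 u = 0 := by
  have h1 := (h.sum_raise_mul hu hθ a).1
  have h2 : ∀ p, (rMat g φ u * (nMat g φ p u).transpose * hMat g u) a p =
      ∑ I, rMat g φ u a I * (hMat g u * nMat g φ p u) p I := by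
    intro p
    have : (nMat g φ p u).transpose * hMat g u = (hMat g u * nMat g φ p u).transpose := by
      rw [Matrix.transpose_mul, h.hMat_transpose hu]
    rw [Matrix.mul_assoc, this, Matrix.mul_apply]
    rfl
  simp only [h2] at h1
  rw [Finset.sum_comm] at h1
  simp only [codiff_eq, mul_neg, Finset.sum_neg_distrib, Finset.mul_sum]
  rw [h1, neg_zero]

/-- A connection symmetric in its lower indices contracts to zero with an alternating array, so
these connection terms drop out of the divergence. -/
theorem sum_mul_cubeConn_apply {R : Fin 8 → Fin 8 → Fin 8 → Fin 8 → ℝ} (hR : Alt4 R)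
    {A : Fin 8 → Matrix (Fin 8) (Fin 8) ℝ} (hA : ∀ p i j, A p i j = A i p j) (I : Triple) :
    ∑ a, (toMat R * cubeConn (A a)) a I = 0 := by
  obtain ⟨i, j, k⟩ := I
  have h1 : ∀ a, (toMat R * cubeConn (A a)) a (i, j, k) =
      ∑ s, (R a s j k * A a s i + R a i s k * A a s j + R a i j s * A a s k) := by
    intro a
    simp only [toMat_apply, Matrix.mul_apply, cubeConn, tensorConn,
      Matrix.add_apply, Matrix.kronecker, Matrix.kroneckerMap_apply, Fintype.sum_prod_type,
      Matrix.one_apply, mul_add, Finset.sum_add_distrib, mul_ite, ite_mul, mul_one,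
      mul_zero, one_mul, zero_mul, Finset.sum_ite_eq', Finset.mem_univ, if_true,
      Finset.sum_const_zero, Finset.sum_ite_irrel]
    ring
  have anti : ∀ (X : Fin 8 → Fin 8 → ℝ) (i : Fin 8), (∀ a s, X a s = -X s a) →
      ∑ a, ∑ s, X a s * A a s i = 0 := by
    intro X i hX
    have : ∑ a, ∑ s, X a s * A a s i = -∑ a, ∑ s, X a s * A a s i := by
      conv_lhs => rw [Finset.sum_comm]
      simp only [← Finset.sum_neg_distrib]
      refine Finset.sum_congr rfl fun j _ => Finset.sum_congr rfl fun k _ => ?_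
      rw [hA, hX]; ring
    linarith
  simp only [h1, Finset.sum_add_distrib]
  rw [anti (fun a s => R a s j k) i fun a s => hR.swap₁ a s j k,
    anti (fun a s => R a i s k) j fun a s => hR.swap₁₃ a i s k,
    anti (fun a s => R a i j s) k fun a s => hR.swap₁₄ a i j s]
  simp

/-- The contraction of an alternating array with `∂T` is a quarter of its contraction with the
exterior derivative, since the four terms of the latter contribute equally. -/
theorem sum_mul_pd_eq_zero {R : Fin 8 → Fin 8 → Fin 8 → Fin 8 → ℝ} (hR : Alt4 R) {T : Comp3}
    (hT : ∀ i j k l, extDeriv3 T i j k l u = 0) :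
    ∑ a, ∑ I : Triple, R a I.1 I.2.1 I.2.2 * pd a (T I.1 I.2.1 I.2.2) u = 0 := by
  simp only [Fintype.sum_prod_type]
  set D := fun a i j k => pd a (T i j k) u with hD
  have e2 : ∑ a, ∑ i, ∑ j, ∑ k, R a i j k * D i a j k =
      -∑ a, ∑ i, ∑ j, ∑ k, R a i j k * D a i j k := by
    rw [Finset.sum_comm]
    simp only [← Finset.sum_neg_distrib]
    refine Finset.sum_congr rfl fun a _ => Finset.sum_congr rfl fun i _ =>
      Finset.sum_congr rfl fun j _ => Finset.sum_congr rfl fun k _ => ?_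
    rw [hR.swap₁ i a]; ring
  have e3 : ∑ a, ∑ i, ∑ j, ∑ k, R a i j k * D j a i k =
      -∑ a, ∑ i, ∑ j, ∑ k, R a i j k * D i a j k := by
    simp only [← Finset.sum_neg_distrib]
    refine Finset.sum_congr rfl fun a _ => ?_
    rw [Finset.sum_comm]
    refine Finset.sum_congr rfl fun i _ =>
      Finset.sum_congr rfl fun j _ => Finset.sum_congr rfl fun k _ => ?_
    rw [hR.swap₂ a j i k]; ring
  have e4 : ∑ a, ∑ i, ∑ j, ∑ k, R a i j k * D k a i j =
      -∑ a, ∑ i, ∑ j, ∑ k, R a i j k * D j a i k := by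
    simp only [← Finset.sum_neg_distrib]
    refine Finset.sum_congr rfl fun a _ => Finset.sum_congr rfl fun i _ => ?_
    rw [Finset.sum_comm]
    refine Finset.sum_congr rfl fun j _ => Finset.sum_congr rfl fun k _ => ?_
    rw [hR.swap₃ a i k j]; ring
  have e : ∑ a, ∑ i, ∑ j, ∑ k, R a i j k * (D a i j k - D i a j k + D j a i k - D k a i j) = 0 :=
    Finset.sum_eq_zero fun a _ => Finset.sum_eq_zero fun i _ => Finset.sum_eq_zero fun j _ =>
      Finset.sum_eq_zero fun k _ => mul_eq_zero_of_right _ (hT a i j k)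
  simp only [mul_sub, mul_add, Finset.sum_add_distrib, Finset.sum_sub_distrib] at e
  change ∑ a, ∑ i, ∑ j, ∑ k, R a i j k * D a i j k = 0
  linarith

/-- A balanced structure with closed torsion has vanishing torsion. -/
theorem divSq_eq_zero_of_closed (h : LocalSpin7 U g φ) (hu : u ∈ U)
    (hθ : ∀ v ∈ U, ∀ a, lee g φ a v = 0)
    (hT : ∀ i j k l, extDeriv3 (torsion g φ) i j k l u = 0) : divSq g φ u = 0 := by
  obtain ⟨R, hR, hRm, -, -⟩ := h.exists_raised hu
  have hU := h.isOpen
  have sR : MatSmooth U (rMat g φ) := (h.smooth_hMat.mul h.smooth_fMat).mul h.smooth_hMat.cube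
  have hF := fun v hv => h.sum_rMat_mul_codiff (u := v) hv (hθ v hv)
  have hT' : ∀ i j k l, extDeriv3 (codiff g φ) i j k l u = 0 := by
    intro i j k l
    rw [← hT i j k l]
    have : ∀ p i j k, pd p (codiff g φ i j k) u = pd p (torsion g φ i j k) u := fun p i j k =>
      pd_congr hU (fun v hv => (torsion_eq_codiff (hθ v hv) i j k).symm) hu p
    simp only [extDeriv3, this]
  have h1 : ∀ a, ∑ I : Triple, (pdMat a (rMat g φ) u a I * codiff g φ I.1 I.2.1 I.2.2 u +
      R a I.1 I.2.1 I.2.2 * pd a (codiff g φ I.1 I.2.1 I.2.2) u) = 0 := by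
    intro a
    rw [← pd_eq_zero hU (fun v hv => hF v hv a) hu a,
      pd_sum (f := fun (I : Triple) v => rMat g φ v a I * codiff g φ I.1 I.2.1 I.2.2 v) fun I =>
      (sR.differentiableAt hU hu a I).mul
        (differentiableAt_of_contDiffOn hU (h.smooth_codiff I.1 I.2.1 I.2.2) hu)]
    refine Finset.sum_congr rfl fun I _ => ?_
    rw [pd_mul (sR.differentiableAt hU hu a I)
      (differentiableAt_of_contDiffOn hU (h.smooth_codiff I.1 I.2.1 I.2.2) hu), hRm]
    rfl
  -- The divergence of `Φ^{aI} T_I = 0` with the term containing derivatives of `T` removed by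
  -- closedness; what remains is `(∂_a Φ^{aI}) T_I`.
  have h2 : ∑ a, ∑ I : Triple, pdMat a (rMat g φ) u a I * codiff g φ I.1 I.2.1 I.2.2 u = 0 := by
    have e := Finset.sum_eq_zero (s := Finset.univ) fun a _ => h1 a
    simp only [Finset.sum_add_distrib] at e
    rwa [sum_mul_pd_eq_zero hR hT', add_zero] at e
  have h3 : ∀ a, pdMat a (rMat g φ) u = hMat g u * nMat g φ a u * cube (hMat g u) -
      (connMat (christoffel g) a u).transpose * rMat g φ u -
      rMat g φ u * cubeConn (connMat (christoffel g) a u) := by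
    intro a
    rw [nMat_eq_covDeriv]
    exact pdMat_raise hU hu h.smooth_hMat h.smooth_hMat.cube h.smooth_fMat h.isMetricConn
      h.isMetricConn_cube a
  have z1 : ∑ a, ∑ I : Triple, ((connMat (christoffel g) a u).transpose * rMat g φ u) a I *
      codiff g φ I.1 I.2.1 I.2.2 u = 0 := by
    refine Finset.sum_eq_zero fun a _ => ?_
    simp only [Matrix.mul_apply, Finset.sum_mul]
    rw [Finset.sum_comm]
    refine Finset.sum_eq_zero fun s _ => ?_
    simp only [mul_assoc, ← Finset.mul_sum, hF u hu, mul_zero]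
  have z2 : ∑ a, ∑ I : Triple, (rMat g φ u * cubeConn (connMat (christoffel g) a u)) a I *
      codiff g φ I.1 I.2.1 I.2.2 u = 0 := by
    rw [Finset.sum_comm]
    refine Finset.sum_eq_zero fun I _ => ?_
    rw [← Finset.sum_mul, hRm, sum_mul_cubeConn_apply hR
      (A := fun p => connMat (christoffel g) p u) (fun p i j => h.christoffel_symm hu j p i), zero_mul]
  -- The divergence of `Φ` is minus the codifferential, so this term is minus the squared norm of
  -- the torsion.
  have z3 : ∑ a, ∑ I : Triple, (hMat g u * nMat g φ a u * cube (hMat g u)) a I *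
      codiff g φ I.1 I.2.1 I.2.2 u = -divSq g φ u := by
    rw [h.divSq_eq_sum hu, Finset.sum_comm, ← Finset.sum_neg_distrib]
    conv_rhs => simp only [← Finset.sum_neg_distrib]; rw [Finset.sum_comm]
    refine Finset.sum_congr rfl fun J _ => ?_
    rw [← Finset.sum_mul]
    simp only [Matrix.mul_apply (N := cube _)]
    rw [Finset.sum_comm, Finset.sum_mul]
    refine Finset.sum_congr rfl fun I _ => ?_
    rw [← Finset.sum_mul, codiff_eq I.1]
    ring
  simp only [h3, Matrix.sub_apply, sub_mul, Finset.sum_sub_distrib, z1, z2, z3] at h2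
  linarith

end LocalSpin7

end Spin7

end

/-! ### The theorem on a manifold, chart by chart. -/

theorem mainTheorem11 {M : Type*} [TopologicalSpace M] [ChartedSpace Spin7.R8 M]
    [IsManifold 𝓘(ℝ, Spin7.R8) ∞ M] (S : Spin7.Spin7Structure M) (hθ : S.IsBalanced) :
    (S.RiemannianScalarFlat ∨ S.TorsionScalarFlat → S.IsParallel) ∧
      (S.HasClosedTorsion → S.IsParallel) := by
  suffices h : ∀ e ∈ atlas Spin7.R8 M, ∀ u ∈ e.target,
      (Spin7.divSq (S.gComp e) (S.ΦComp e) u = 0) →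
        ∀ p i j k l, Spin7.nablaForm (S.gComp e) (S.ΦComp e) p i j k l u = 0 by
    refine ⟨?_, fun hT e he u hu => h e he u hu
      ((S.localSpin7 he).divSq_eq_zero_of_closed hu (hθ e he) (hT e he u hu))⟩
    rintro (hS | hS) e he u hu
    · have h1 := (S.localSpin7 he).scal_balanced hu (hθ e he)
      rw [hS e he u hu] at h1
      exact h e he u hu (by linarith)
    -- Together the two formulas give `Scal = -divSq / 12 - divSq / 4 = -divSq / 3`.
    · have h1 := (S.localSpin7 he).scal_balanced hu (hθ e he)
      have h2 := (S.localSpin7 he).scal_torsionConn hu (hθ e he)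
      rw [hS e he u hu] at h2
      exact h e he u hu (by linarith)
  exact fun e he u hu h0 => (S.localSpin7 he).nablaForm_eq_zero hu (hθ e he u hu) h0
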